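/- Let $p\ge 2$, let $Y_1,Y_2,\dots$ be i.i.d. random vectors in $\mathbb R^p$, put $U_i=\|Y_i\|$, $V_i=Y_i/\|Y_i\|$, and suppose that $(U_i,V_i)$ has a density $f$ with respect to $\mathrm du\,\omega_{p-1}(\mathrm dv)$ on $(0,\infty)\times\mathbb S^{p-1}$, where $\omega_{p-1}(\mathrm dv)$ is the area element of the unit sphere $\mathbb S^{p-1}\subset\mathbb R^p$. Let $\omega_{p-1}=2\pi^{p/2}/\Gamma(p/2)$, $\omega_{p-2}=2\pi^{(p-1)/2}/\Gamma((p-1)/2)$, and let $$\mathcal M^2=\inf_{g}\int_0^\infty\!\!\int_{\mathbb S^{p-1}}\big(f(u,v)-g(u)\,\omega_{p-1}^{-1}\big)^2\,\omega_{p-1}(\mathrm dv)\,\mathrm du ,$$ the infimum being over all probability densities $g$ on $(0,\infty)$, be the deviation from spherical symmetry. Assume: (A1) $K\ge 0$ is a symmetric probability density supported on $(-1,1)$ with $\int K^4<\infty$. (A2) $f$ is twice differentiable; for each $u>0$ the second spherical derivative $\mathcal D^2_f(u,\cdot)$ is uniformly continuous on $\mathbb S^{p-1}$; for each $v\in\mathbb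 S^{p-1}$ the derivative $\partial^2 f(\cdot,v)/\partial u^2$ is uniformly continuous on $(0,\infty)$; and $f$, $\partial f/\partial u$, $\partial^2 f/\partial u^2$, $\mathcal D_f$, $\mathcal D_f^2$ are bounded on $(0,\infty)\times \mathbb S^{p-1}$. (Here $\mathcal D_f,\mathcal D_f^2$ are the first and second derivatives in $y$ of $f(u,y/\|y\|)$ at $y=v$.) (A3) $h=h_n>0$ and $\kappa=\kappa_n$ are deterministic with $h\to0$, $\kappa\to\infty$, $\kappa^{(p-1)/2}/(nh)\to 0$. For $n$ observations put $$\hat{\mathcal M}_n^2=\frac1{n(n-1)}\sum_{i\ne j}\frac1h K\Big(\frac{U_i-U_j}h\Big)\Big\{\frac{L(\kappa V_i^\top V_j)}{c_1(\kappa)}-\frac1{\omega_{p-1}}\Big\},$$ $$L(\kappa t)=\frac{\kappa^{p/2-1}e^{\kappa t}}{(2\pi)^{p/2}\mathcal I_{p/2-1}(\kappa)},\qquad c_1(\kappa)=\omega_{p-2}\int_0^\pi L(\kappa\cos\theta)(\sin\theta)^{p-2}\,\mathrm d\theta ,$$ with $\mathcal I_\nu$ the modified Bessel function of the first kind. Let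 $\hat{\mathcal M}^2_{n-1}(-i)$ be the same statistic, with the same $h=h_n$ and $\kappa=\kappa_n$, computed from the $n-1$ observations other than $Y_i$, let $\tilde{\mathcal M}_i^2=n\hat{\mathcal M}_n^2-(n-1)\hat{\mathcal M}_{n-1}^2(-i)$ be the jackknife pseudovalues, $\bar{\mathcal M}_n^2$ their mean, and $$\hat\sigma_n^2=\frac1{4(n-1)}\sum_{i=1}^n\big(\tilde{\mathcal M}_i^2-\bar{\mathcal M}_n^2\big)^2,\qquad \widehat{\mathrm{se}}_n=\frac{2\hat\sigma_n}{\sqrt n}.$$ Let $\Delta>0$, $\alpha\in(0,1)$, and let $u_q$ denote the $q$-quantile of the standard normal distribution. If $\mathcal M^2=\Delta$, assume in addition that either (B1) $\sqrt n/\kappa+\sqrt n h^2\to0$ and $\lim_{u\downarrow0}f(u,v)=0$ for every $v\in\mathbb S^{p-1}$, or (B2) $\sqrt n\,(\mathbb E[\hat{\mathcal M}_n^2]-\mathcal M^2)\to0$. Then $$\lim_{n\to\infty}\mathbb P\big(\hat{\mathcal M}_n^2>\Delta+u_{1-\alpha}\,\widehat{\mathrm{se}}_n\big)=\begin{cases}1,&\mathcal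 M^2>\Delta,\\ \alpha,&\mathcal M^2=\Delta,\\ 0,&\mathcal M^2<\Delta,\end{cases}$$ $$\lim_{n\to\infty}\mathbb P\big(\hat{\mathcal M}_n^2\le\Delta+u_{\alpha}\,\widehat{\mathrm{se}}_n\big)=\begin{cases}1,&\mathcal M^2<\Delta,\\ \alpha,&\mathcal M^2=\Delta,\\ 0,&\mathcal M^2>\Delta.\end{cases}$$ -/

import Mathlib

open MeasureTheory ProbabilityTheory Filter Topology Set

noncomputable section

namespace SphDev

/-- `p`-dimensional Euclidean space. -/
abbrev E (p : ℕ) : Type := EuclideanSpace ℝ (Fin p)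

/-- The unit sphere `S^{p-1}` of `ℝ^p`, as a set. -/
abbrev unitSphere (p : ℕ) : Set (E p) := Metric.sphere (0 : E p) 1

/-- The area element of `S^{p-1}`. -/
abbrev sphereMeasure (p : ℕ) : Measure (unitSphere p) :=
  (volume : Measure (E p)).toSphere

/-- The surface area `2 π^{p/2} / Γ(p/2)` of the unit sphere of `ℝ^p`
(so `ω_{p-1} = sphereArea p` and `ω_{p-2} = sphereArea (p - 1)`). -/
def sphereArea (p : ℕ) : ℝ :=
  2 * Real.pi ^ ((p : ℝ) / 2) / Real.Gamma ((p : ℝ) / 2)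

/-- The direction `y / ‖y‖`. -/
def direction {p : ℕ} (y : E p) : E p := ‖y‖⁻¹ • y

/-- `f` is the density of `(‖Y‖, Y / ‖Y‖)` with respect to `du ⊗ ω_{p-1}(dv)` on
`(0,∞) × S^{p-1}`, where `μ` is the law of `Y`. Only the values `f u v` with `u > 0` and
`‖v‖ = 1` matter. -/
def HasPolarDensity {p : ℕ} (μ : Measure (E p)) (f : ℝ → E p → ℝ) : Prop :=
  (∀ u : ℝ, 0 < u → ∀ v ∈ unitSphere p, 0 ≤ f u v) ∧
  μ.map (fun y => (‖y‖, direction y)) =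
    ((((volume : Measure ℝ).restrict (Ioi 0)).prod (sphereMeasure p)).withDensity
      (fun q => ENNReal.ofReal (f q.1 (q.2 : E p)))).map
      (fun q => (q.1, (q.2 : E p)))

/-- Probability densities on `(0,∞)`. -/
def IsRadialDensity (g : ℝ → ℝ) : Prop :=
  Measurable g ∧ (∀ u, 0 ≤ g u) ∧ ∫⁻ u in Ioi (0 : ℝ), ENNReal.ofReal (g u) = 1

/-- The minimal squared `L²`-distance between `f` and the densities `g(u) ω_{p-1}⁻¹` of spherical
distributions, as an extended nonnegative number. -/
def deviationENN {p : ℕ} (f : ℝ → E p → ℝ) : ENNReal :=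
  ⨅ (g : ℝ → ℝ) (_ : IsRadialDensity g),
    ∫⁻ v : unitSphere p, ∫⁻ u in Ioi (0 : ℝ),
      ENNReal.ofReal ((f u (v : E p) - g u * (sphereArea p)⁻¹) ^ 2) ∂volume ∂(sphereMeasure p)

/-- The measure `M²` of deviation from spherical symmetry. -/
def deviation {p : ℕ} (f : ℝ → E p → ℝ) : ℝ := (deviationENN f).toReal

/-- The modified Bessel function of the first kind, through Poisson's integral. -/
def besselI (ν κ : ℝ) : ℝ :=
  (κ / 2) ^ ν / (Real.Gamma (ν + 1 / 2) * Real.Gamma (1 / 2)) *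
    ∫ t in (-1 : ℝ)..1, Real.exp (κ * t) * (1 - t ^ 2) ^ (ν - 1 / 2)

/-- The Langevin (Fisher - von Mises) kernel `L(κ t)`. -/
def langevin (p : ℕ) (κ t : ℝ) : ℝ :=
  κ ^ ((p : ℝ) / 2 - 1) *
    ((2 * Real.pi) ^ ((p : ℝ) / 2) * besselI ((p : ℝ) / 2 - 1) κ)⁻¹ * Real.exp (κ * t)

/-- `c₁(κ) = ω_{p-2} ∫_0^π L(κ cos θ) (sin θ)^{p-2} dθ`. -/
def c1 (p : ℕ) (κ : ℝ) : ℝ :=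
  sphereArea (p - 1) *
    ∫ θ in (0 : ℝ)..Real.pi, langevin p κ (Real.cos θ) * Real.sin θ ^ (p - 2)

/-- The estimator of `∫ f_U²` from the observations `y i`, `i ∈ s`. -/
def Mhat1 {p : ℕ} (K : ℝ → ℝ) (h : ℝ) (s : Finset ℕ) (y : ℕ → E p) : ℝ :=
  1 / ((s.card : ℝ) * ((s.card : ℝ) - 1) * h) *
    ∑ i ∈ s, ∑ j ∈ s.erase i, K ((‖y i‖ - ‖y j‖) / h)

/-- The estimator of `∫∫ f²` from the observations `y i`, `i ∈ s`. -/
def Mhat2 {p : ℕ} (K : ℝ → ℝ) (h κ : ℝ) (s : Finset ℕ) (y : ℕ → E p) : ℝ :=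
  1 / ((s.card : ℝ) * ((s.card : ℝ) - 1) * c1 p κ * h) *
    ∑ i ∈ s, ∑ j ∈ s.erase i,
      K ((‖y i‖ - ‖y j‖) / h) * langevin p κ (inner ℝ (direction (y i)) (direction (y j)))

/-- The estimator of `M²` from the observations `y i`, `i ∈ s`. -/
def Mhat {p : ℕ} (K : ℝ → ℝ) (h κ : ℝ) (s : Finset ℕ) (y : ℕ → E p) : ℝ :=
  Mhat2 K h κ s y - (sphereArea p)⁻¹ * Mhat1 K h s y

/-- The `i`-th jackknife pseudovalue of the sample `y 0, …, y (n-1)`. -/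
def pseudovalue {p : ℕ} (K : ℝ → ℝ) (h κ : ℝ) (n : ℕ) (y : ℕ → E p) (i : ℕ) : ℝ :=
  (n : ℝ) * Mhat K h κ (Finset.range n) y
    - ((n : ℝ) - 1) * Mhat K h κ ((Finset.range n).erase i) y

/-- The mean of the pseudovalues. -/
def pseudomean {p : ℕ} (K : ℝ → ℝ) (h κ : ℝ) (n : ℕ) (y : ℕ → E p) : ℝ :=
  (n : ℝ)⁻¹ * ∑ i ∈ Finset.range n, pseudovalue K h κ n y i

/-- The jackknife estimator `σ̂_n` (of the standard deviation of
`f(U,V) - ω_{p-1}⁻¹ f_U(U)`, which is half the asymptotic standard deviation of `√n M̂_n²`). -/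
def sigmaHat {p : ℕ} (K : ℝ → ℝ) (h κ : ℝ) (n : ℕ) (y : ℕ → E p) : ℝ :=
  √(1 / (4 * ((n : ℝ) - 1)) *
    ∑ i ∈ Finset.range n, (pseudovalue K h κ n y i - pseudomean K h κ n y) ^ 2)

/-- The estimated standard error of `M̂_n²`. -/
def stdErr {p : ℕ} (K : ℝ → ℝ) (h κ : ℝ) (n : ℕ) (y : ℕ → E p) : ℝ :=
  2 * sigmaHat K h κ n y / √(n : ℝ)

/-- The `q`-quantile of the standard normal distribution. -/
def normalQuantile (q : ℝ) : ℝ := sInf {x : ℝ | q ≤ cdf (gaussianReal 0 1) x}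

/-- Conditions on the radial kernel: a symmetric density supported on `(-1,1)` with
finite fourth power integral. -/
structure KernelAssumption (K : ℝ → ℝ) : Prop where
  measurable : Measurable K
  nonneg : ∀ x, 0 ≤ K x
  integral_eq_one : ∫⁻ x, ENNReal.ofReal (K x) = 1
  symm : ∀ x, K (-x) = K x
  support : Function.support K ⊆ Ioo (-1) 1
  fourth : ∫⁻ x in Ioo (-1 : ℝ) 1, ENNReal.ofReal (K x ^ 4) < ⊤

/-- The extension of `f` to `ℝ × (ℝ^p ∖ {0})` that is homogeneous of degree `0` in the second
variable. -/
def radialExt {p : ℕ} (f : ℝ → E p → ℝ) (u : ℝ) (y : E p) : ℝ := f u (direction y)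

/-- The first derivative `D_f(u,v)` with respect to the spherical variable. -/
def sphD1 {p : ℕ} (f : ℝ → E p → ℝ) (u : ℝ) (v : E p) : E p →L[ℝ] ℝ :=
  fderiv ℝ (radialExt f u) v

/-- The second derivative `D²_f(u,v)` with respect to the spherical variable. -/
def sphD2 {p : ℕ} (f : ℝ → E p → ℝ) (u : ℝ) (v : E p) : E p →L[ℝ] E p →L[ℝ] ℝ :=
  fderiv ℝ (fderiv ℝ (radialExt f u)) v

/-- The derivative `∂f/∂u`. -/
def radD1 {p : ℕ} (f : ℝ → E p → ℝ) (u : ℝ) (v : E p) : ℝ :=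
  deriv (fun r => f r v) u

/-- The derivative `∂²f/∂u²`. -/
def radD2 {p : ℕ} (f : ℝ → E p → ℝ) (u : ℝ) (v : E p) : ℝ :=
  deriv (deriv (fun r => f r v)) u

/-- Smoothness of the polar density: twice differentiable on `(0,∞) × S^{p-1}`, with uniformly
continuous second derivatives, and bounded together with its derivatives. -/
structure DensityAssumption {p : ℕ} (f : ℝ → E p → ℝ) : Prop where
  differentiable : DifferentiableOn ℝ (fun q : ℝ × E p => radialExt f q.1 q.2)
    (Ioi (0 : ℝ) ×ˢ ({0}ᶜ : Set (E p)))
  twice_differentiable :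
    DifferentiableOn ℝ (fderiv ℝ (fun q : ℝ × E p => radialExt f q.1 q.2))
      (Ioi (0 : ℝ) ×ˢ ({0}ᶜ : Set (E p)))
  sph_uniform : ∀ u : ℝ, 0 < u → UniformContinuousOn (fun v => sphD2 f u v) (unitSphere p)
  rad_uniform : ∀ v ∈ unitSphere p, UniformContinuousOn (fun u => radD2 f u v) (Ioi (0 : ℝ))
  bounded : ∃ C : ℝ, ∀ u : ℝ, 0 < u → ∀ v ∈ unitSphere p,
    |f u v| ≤ C ∧ |radD1 f u v| ≤ C ∧ |radD2 f u v| ≤ C ∧ ‖sphD1 f u v‖ ≤ C ∧ ‖sphD2 f u v‖ ≤ C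

end SphDev

end

/-!
The statistic is a `U`-statistic of order two in the polar coordinates `(U_i, V_i)`, with a
symmetric kernel `H_n` that depends on `n` through the bandwidths. The Langevin kernel divided by
`c₁(κ)` is the Fisher–von Mises density (`langevin_div_c1`): by the Funk–Hecke formula it
integrates to one over the sphere, it is bounded by a multiple of `κ^{(p-1)/2}`, and it
concentrates at rate `κ^{-1/2}`.

Smoothing in both variables, with second differences of the density bounded in the radius and along
great circles (`RegularDensity`), shows that the projection `x ↦ E H_n(x, X)` differs from
`g(u,v) = f(u,v) - f_U(u)/ω_{p-1}` by `O(1/κ + h)` away from `u = 0`, and that the points with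
`u < h` have probability `O(h)`. The second moment of `H_n` is `O(κ^{(p-1)/2}/h) = o(n)`. These two
facts are collected in `KernelLimit`, and they suffice for everything stochastic: in Hoeffding's
decomposition the degenerate part is `o(n^{-1/2})` in mean square, and the linear part is
`2/n ∑ (g(X_i) - E g)` up to `o(n^{-1/2})`, so that the central limit theorem applies
(`KernelLimit.tendsto_measureReal_le`). The pseudovalues are affine functions of the row sums of
the kernel matrix, whose normalized versions approximate `g(X_i)` in mean square; hence `σ̂_n`
tends in probability to the standard deviation of `g(U,V)`
(`KernelLimit.tendstoInMeasure_jackknifeScale`).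

The limit `E g(U,V)` of the statistic is the deviation from spherical symmetry
(`RegularDensity.deviation_eq`): for each radius the best multiple of `ω_{p-1}⁻¹` is the spherical
integral of the density. Off the boundary, consistency is enough, since the standard error tends to
zero. On the boundary the bias is negligible, by assumption or because the density vanishes at
radius zero, which makes the bias `O(h)` near zero and `O(1/κ + h²)` on average
(`RegularDensity.tendsto_bias`). Finally the limit variance is positive there
(`RegularDensity.variance_pos`): if `g(U,V)` were constant almost surely, `f` would have a gap
between zero and that positive constant, which is impossible for an integrable continuous
function on the connected set `(0,∞) × S^{p-1}`.
-/

open scoped Pointwise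

set_option linter.unusedSectionVars false

namespace SphDev

/-! ### Integration on the sphere -/

/-- Integration in polar coordinates, for nonnegative functions. -/
theorem lintegral_eq_lintegral_sphere {p : ℕ} (hp : 1 ≤ p) {Φ : E p → ENNReal}
    (hΦ : Measurable Φ) :
    ∫⁻ y, Φ y = ∫⁻ w : unitSphere p, (∫⁻ r in Ioi (0 : ℝ),
      ENNReal.ofReal (r ^ (p - 1)) * Φ (r • (w : E p))) ∂(sphereMeasure p) := by
  have : Nonempty (Fin p) := ⟨⟨0, hp⟩⟩
  have hmp := (volume : Measure (E p)).measurePreserving_homeomorphUnitSphereProd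
  have h1 := hmp.lintegral_comp_emb (Homeomorph.measurableEmbedding _)
    (fun q => Φ ((q.2 : ℝ) • (q.1 : E p)))
  have h2 : ∀ a : ({0}ᶜ : Set (E p)),
      Φ (((homeomorphUnitSphereProd (E p) a).2 : ℝ) • ((homeomorphUnitSphereProd (E p) a).1 : E p))
        = Φ a := by
    intro a
    have ha : ‖(a : E p)‖ ≠ 0 := norm_ne_zero_iff.2 a.2
    simp [homeomorphUnitSphereProd_apply_snd_coe, homeomorphUnitSphereProd_apply_fst_coe,
      smul_smul, ha]
  simp only [h2] at h1
  have hmeas : Measurable fun q : unitSphere p × Ioi (0 : ℝ) => Φ ((q.2 : ℝ) • (q.1 : E p)) := by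
    fun_prop
  rw [lintegral_subtype_comap (measurableSet_singleton _).compl, restrict_compl_singleton] at h1
  rw [h1, lintegral_prod _ hmeas.aemeasurable]
  refine lintegral_congr fun w => ?_
  rw [Measure.volumeIoiPow, lintegral_withDensity_eq_lintegral_mul _ (by fun_prop) (by fun_prop)]
  simp only [Pi.mul_apply, finrank_euclideanSpace, Fintype.card_fin]
  exact lintegral_subtype_comap measurableSet_Ioi
    (fun r : ℝ => ENNReal.ofReal (r ^ (p - 1)) * Φ (r • (w : E p)))

theorem sphereArea_pos {p : ℕ} (hp : 1 ≤ p) : 0 < sphereArea p := by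
  have : (0 : ℝ) < p := by exact_mod_cast hp
  have := Real.Gamma_pos_of_pos (show (0 : ℝ) < p / 2 by positivity)
  unfold sphereArea
  positivity

theorem sphereMeasure_univ {p : ℕ} (hp : 1 ≤ p) :
    sphereMeasure p univ = ENNReal.ofReal (sphereArea p) := by
  have : Nonempty (Fin p) := ⟨⟨0, hp⟩⟩
  have hp' : (0 : ℝ) < p := by exact_mod_cast hp
  rw [Measure.toSphere_apply_univ, EuclideanSpace.volume_ball]
  simp only [finrank_euclideanSpace, Fintype.card_fin, ENNReal.ofReal_one, one_pow, one_mul]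
  rw [← ENNReal.ofReal_natCast, ← ENNReal.ofReal_mul (by positivity)]
  congr 1
  rw [Real.Gamma_add_one (by positivity), sphereArea, Real.sqrt_eq_rpow, ← Real.rpow_natCast,
    ← Real.rpow_mul Real.pi_pos.le]
  have := (Real.Gamma_pos_of_pos (show (0 : ℝ) < p / 2 by positivity)).ne'
  have e : (1 / 2 * (p : ℝ)) = p / 2 := by ring
  rw [e]
  field_simp

/-- The map induced on the sphere by a linear isometry. -/
noncomputable def sphereMap {p : ℕ} (e : E p ≃ₗᵢ[ℝ] E p) (w : unitSphere p) : unitSphere p :=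
  ⟨e w, by simp⟩

theorem measurePreserving_sphereMap {p : ℕ} (e : E p ≃ₗᵢ[ℝ] E p) :
    MeasurePreserving (sphereMap e) (sphereMeasure p) (sphereMeasure p) := by
  have hc : Measurable (sphereMap e) :=
    (Continuous.subtype_mk (by fun_prop) _).measurable
  refine ⟨hc, Measure.ext fun s hs => ?_⟩
  rw [Measure.map_apply hc hs, Measure.toSphere_apply' _ hs, Measure.toSphere_apply' _ (hc hs)]
  congr 1
  rw [← e.measurePreserving.measure_preimage_emb e.toHomeomorph.measurableEmbedding
    (Ioo (0 : ℝ) 1 • ((↑) '' s : Set (E p)))]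
  congr 1
  ext y
  simp only [Set.mem_smul, mem_preimage, mem_image, Subtype.exists]
  constructor
  · rintro ⟨r, hr, _, ⟨w, hw, hws, rfl⟩, h⟩
    exact ⟨r, hr, e w, ⟨e w, by simpa using hw, hws, rfl⟩, by simp [← h]⟩
  · rintro ⟨r, hr, _, ⟨w, hw, hws, rfl⟩, h⟩
    refine ⟨r, hr, e.symm w, ⟨e.symm w, by simpa using hw, ?_, rfl⟩, ?_⟩
    · simpa [sphereMap] using hws
    · simp only [← map_smul, h]; simp

/-- Lebesgue measure on `ℝ^{m+1}` splits off the first coordinate, for functions of that coordinate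
and of the norm. -/
theorem lintegral_coord_norm {m : ℕ} {G : ℝ → ℝ → ENNReal}
    (hG : Measurable (Function.uncurry G)) :
    ∫⁻ y : E (m + 1), G (y 0) ‖y‖ = ∫⁻ x : ℝ, ∫⁻ z : E m, G x (√(x ^ 2 + ‖z‖ ^ 2)) := by
  have h1 := (EuclideanSpace.volume_preserving_symm_measurableEquiv_toLp (Fin (m + 1)))
  have h2 := (volume_preserving_piFinSuccAbove (fun _ : Fin (m + 1) => ℝ) 0)
  have h3 := ((MeasurePreserving.id (volume : Measure ℝ)).prod
    (EuclideanSpace.volume_preserving_symm_measurableEquiv_toLp (Fin m)).symm)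
  have h := (h3.comp (h2.comp h1))
  have e : ∀ y : E (m + 1), G (y 0) ‖y‖ = (fun q : ℝ × E m => G q.1 (√(q.1 ^ 2 + ‖q.2‖ ^ 2)))
      ((Prod.map id (MeasurableEquiv.toLp 2 (Fin m → ℝ)).symm.symm ∘
        (MeasurableEquiv.piFinSuccAbove (fun _ : Fin (m + 1) => ℝ) 0) ∘
        (MeasurableEquiv.toLp 2 (Fin (m + 1) → ℝ)).symm) y) := by
    intro y
    have : ‖y‖ = √(y 0 ^ 2 + ∑ i : Fin m, y i.succ ^ 2) := by
      rw [EuclideanSpace.norm_eq, Fin.sum_univ_succ]; simp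
    rw [this]
    simp [EuclideanSpace.norm_sq_eq, MeasurableEquiv.piFinSuccAbove, Fin.tail]
  simp_rw [e]
  have hm : Measurable fun q : ℝ × E m => G q.1 (√(q.1 ^ 2 + ‖q.2‖ ^ 2)) :=
    hG.comp (f := fun q : ℝ × E m => (q.1, √(q.1 ^ 2 + ‖q.2‖ ^ 2))) (by fun_prop)
  rw [h.lintegral_comp hm, lintegral_prod _ hm.aemeasurable]

/-- The radial factor of the area of a ball. -/
theorem lintegral_pow_unit (n : ℕ) :
    ∫⁻ r in Ioi (0 : ℝ), ENNReal.ofReal (r ^ n) * (Iio (1 : ℝ)).indicator 1 r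
      = ENNReal.ofReal (1 / (n + 1)) := by
  have h := Measure.volumeIoiPow_apply_Iio n ⟨1, mem_Ioi.2 one_pos⟩
  rw [← lintegral_indicator_one measurableSet_Iio, Measure.volumeIoiPow,
    lintegral_withDensity_eq_lintegral_mul _ (by fun_prop)
      (measurable_one.indicator measurableSet_Iio)] at h
  simp only [one_pow] at h
  rw [← h, ← lintegral_subtype_comap measurableSet_Ioi]
  rfl

/-- Integration of a function of one coordinate over the sphere. -/
theorem lintegral_sphere_coord {m : ℕ} (hm : 1 ≤ m) {φ : ℝ → ENNReal} (hφ : Measurable φ) :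
    ∫⁻ w : unitSphere (m + 1), φ ((w : E (m + 1)) 0) ∂(sphereMeasure (m + 1)) =
      ENNReal.ofReal (sphereArea m) *
        ∫⁻ θ in Ioo 0 Real.pi, ENNReal.ofReal (Real.sin θ ^ (m - 1)) * φ (Real.cos θ) := by
  set ρ : ℝ → ENNReal := (Iio (1 : ℝ)).indicator 1 with hρ
  have hρm : Measurable ρ := measurable_const.indicator measurableSet_Iio
  set c : ENNReal := ∫⁻ r in Ioi (0 : ℝ), ENNReal.ofReal (r ^ m) * ρ r with hc
  have hc' : c = ENNReal.ofReal (1 / (m + 1)) := lintegral_pow_unit m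
  have hc0 : c ≠ 0 := by rw [hc']; simp; positivity
  have hct : c ≠ ⊤ := by rw [hc']; simp
  -- Both sides times `c` are the integral of `φ (y 0 / ‖y‖) ρ ‖y‖` over the whole space.
  have hG : Measurable (Function.uncurry fun x r : ℝ => φ (x / r) * ρ r) := by
    have : Measurable fun q : ℝ × ℝ => φ (q.1 / q.2) * ρ q.2 := by fun_prop
    exact this
  have hL : ∫⁻ y : E (m + 1), φ (y 0 / ‖y‖) * ρ ‖y‖ =
      (∫⁻ w : unitSphere (m + 1), φ ((w : E (m + 1)) 0) ∂(sphereMeasure (m + 1))) * c := by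
    rw [lintegral_eq_lintegral_sphere (by omega) (by fun_prop),
      ← lintegral_mul_const _ (by fun_prop)]
    refine lintegral_congr fun w => ?_
    rw [hc, ← lintegral_const_mul _ (by fun_prop)]
    refine setLIntegral_congr_fun measurableSet_Ioi fun r hr => ?_
    have hr0 : (0 : ℝ) < r := hr
    have hw : ‖r • (w : E (m + 1))‖ = r := by
      rw [norm_smul, norm_eq_of_mem_sphere, mul_one, Real.norm_of_nonneg hr0.le]
    simp only [hw, PiLp.smul_apply, smul_eq_mul, mul_div_cancel_left₀ _ hr0.ne', Nat.add_sub_cancel]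
    ring
  have hR : ∫⁻ y : E (m + 1), φ (y 0 / ‖y‖) * ρ ‖y‖ = (ENNReal.ofReal (sphereArea m) *
        ∫⁻ θ in Ioo 0 Real.pi, ENNReal.ofReal (Real.sin θ ^ (m - 1)) * φ (Real.cos θ)) * c := by
    rw [lintegral_coord_norm hG]
    set Ψ : ℝ × ℝ → ENNReal := fun q => (Ioi (0 : ℝ)).indicator 1 q.2 *
      (ENNReal.ofReal (q.2 ^ (m - 1)) *
        (φ (q.1 / √(q.1 ^ 2 + q.2 ^ 2)) * ρ (√(q.1 ^ 2 + q.2 ^ 2)))) with hΨ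
    have hi : Measurable ((Ioi (0 : ℝ)).indicator (1 : ℝ → ENNReal)) :=
      measurable_const.indicator measurableSet_Ioi
    have hΨm : Measurable Ψ := by fun_prop
    have h1 : ∀ x : ℝ, ∫⁻ z : E m, φ (x / √(x ^ 2 + ‖z‖ ^ 2)) * ρ (√(x ^ 2 + ‖z‖ ^ 2)) =
        ENNReal.ofReal (sphereArea m) * ∫⁻ s, Ψ (x, s) := by
      intro x
      rw [lintegral_eq_lintegral_sphere hm (by fun_prop), ← sphereMeasure_univ hm, mul_comm,
        ← lintegral_const]
      refine lintegral_congr fun w => ?_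
      rw [← lintegral_indicator measurableSet_Ioi]
      refine lintegral_congr fun s => ?_
      by_cases hs : 0 < s
      · have hw : ‖s • (w : E m)‖ = s := by
          rw [norm_smul, norm_eq_of_mem_sphere, mul_one, Real.norm_of_nonneg hs.le]
        simp [hΨ, hs, hw]
      · simp [hΨ, hs]
    simp_rw [h1]
    rw [lintegral_const_mul _ (Measurable.lintegral_prod_right hΨm), mul_assoc]
    congr 1
    rw [← lintegral_prod _ hΨm.aemeasurable, ← Measure.volume_eq_prod,
      ← lintegral_comp_polarCoord_symm, polarCoord_target, Measure.volume_eq_prod,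
      ← Measure.prod_restrict, lintegral_prod]
    · rw [mul_comm, hc, ← lintegral_mul_const _ (by fun_prop)]
      refine setLIntegral_congr_fun measurableSet_Ioi fun r hr => ?_
      have hr0 : (0 : ℝ) < r := hr
      have hsub : Ioo 0 Real.pi ⊆ Ioo (-Real.pi) Real.pi :=
        Ioo_subset_Ioo_left (by linarith [Real.pi_pos])
      rw [← lintegral_const_mul _ (by fun_prop), ← lintegral_indicator measurableSet_Ioo,
        ← lintegral_indicator measurableSet_Ioo]
      refine lintegral_congr fun θ => ?_
      have hsq : √((r * Real.cos θ) ^ 2 + (r * Real.sin θ) ^ 2) = r := by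
        rw [mul_pow, mul_pow, ← mul_add, Real.cos_sq_add_sin_sq, mul_one, Real.sqrt_sq hr0.le]
      by_cases hθ : θ ∈ Ioo 0 Real.pi
      · have hs := Real.sin_pos_of_mem_Ioo hθ
        have hm1 : r ^ m = r * r ^ (m - 1) := by
          rw [← pow_succ', Nat.sub_add_cancel hm]
        simp only [hθ, hsub hθ, indicator_of_mem, hΨ, polarCoord_symm_apply, hsq, smul_eq_mul,
          mul_div_cancel_left₀ _ hr0.ne', mem_Ioi, mul_pos hr0 hs, Pi.one_apply, one_mul, hm1]
        simp only [mul_pow, ENNReal.ofReal_mul hr0.le, ENNReal.ofReal_mul (pow_nonneg hr0.le _)]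
        ring
      · by_cases hθ' : θ ∈ Ioo (-Real.pi) Real.pi
        · have hs : ¬ (0 < r * Real.sin θ) := by
            have : Real.sin θ ≤ 0 := Real.sin_nonpos_of_nonpos_of_neg_pi_le
              (not_lt.1 fun h => hθ ⟨h, hθ'.2⟩) hθ'.1.le
            nlinarith
          simp [hθ, hθ', hΨ, polarCoord_symm_apply, hs]
        · simp [hθ, hθ']
    · have : Measurable fun q : ℝ × ℝ => ENNReal.ofReal q.1 • Ψ (polarCoord.symm q) :=
        (by fun_prop : Measurable fun q : ℝ × ℝ => ENNReal.ofReal q.1).mul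
          (hΨm.comp continuous_polarCoord_symm.measurable)
      exact this.aemeasurable
  exact (ENNReal.mul_left_inj hc0 hct).1 (hL.symm.trans hR)

/-- The **Funk–Hecke formula** for zonal functions. -/
theorem lintegral_sphere_inner {p : ℕ} (hp : 2 ≤ p) {φ : ℝ → ENNReal} (hφ : Measurable φ)
    {v : E p} (hv : ‖v‖ = 1) :
    ∫⁻ w : unitSphere p, φ (inner ℝ v (w : E p)) ∂(sphereMeasure p) =
      ENNReal.ofReal (sphereArea (p - 1)) *
        ∫⁻ θ in Ioo 0 Real.pi, ENNReal.ofReal (Real.sin θ ^ (p - 2)) * φ (Real.cos θ) := by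
  obtain ⟨m, rfl⟩ : ∃ m, p = m + 1 := ⟨p - 1, by omega⟩
  have h := lintegral_sphere_coord (m := m) (by omega) hφ
  rw [show m + 1 - 1 = m by omega, show m + 1 - 2 = m - 1 by omega, ← h]
  set e₀ : E (m + 1) := EuclideanSpace.single 0 1
  have he₀ : ‖e₀‖ = 1 := by simp [e₀]
  set R := (Submodule.span ℝ {v - e₀})ᗮ.reflection
  have hR : R v = e₀ := Submodule.reflection_sub (hv.trans he₀.symm)
  rw [← (measurePreserving_sphereMap R).lintegral_comp (f := fun w => φ ((w : E (m + 1)) 0))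
    (by fun_prop)]
  refine lintegral_congr fun w => ?_
  have : inner ℝ v (w : E (m + 1)) = inner ℝ (R v) (R w) := (R.inner_map_map _ _).symm
  rw [this, hR]
  simp [e₀, EuclideanSpace.inner_single_left, sphereMap]

/-- The Funk–Hecke formula for Bochner integrals of zonal functions. -/
theorem integral_sphere_inner {p : ℕ} (hp : 2 ≤ p) {φ : ℝ → ℝ} (hφ : Measurable φ)
    (hφ0 : ∀ t ∈ Icc (-1 : ℝ) 1, 0 ≤ φ t) {v : E p} (hv : ‖v‖ = 1) :
    ∫ w : unitSphere p, φ (inner ℝ v (w : E p)) ∂(sphereMeasure p) =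
      sphereArea (p - 1) * ∫ θ in (0 : ℝ)..Real.pi, φ (Real.cos θ) * Real.sin θ ^ (p - 2) := by
  have hin : ∀ w : unitSphere p, inner ℝ v (w : E p) ∈ Icc (-1 : ℝ) 1 := by
    intro w
    have := abs_real_inner_le_norm v (w : E p)
    rw [hv, norm_eq_of_mem_sphere, one_mul] at this
    exact abs_le.1 this
  rw [integral_eq_lintegral_of_nonneg_ae (Eventually.of_forall fun w => hφ0 _ (hin w))
      (Measurable.aestronglyMeasurable (by fun_prop)),
    lintegral_sphere_inner hp (φ := fun t => ENNReal.ofReal (φ t)) (by fun_prop) hv,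
    ENNReal.toReal_mul, ENNReal.toReal_ofReal (sphereArea_pos (by omega)).le,
    intervalIntegral.integral_of_le Real.pi_pos.le, integral_Ioc_eq_integral_Ioo,
    integral_eq_lintegral_of_nonneg_ae _ (Measurable.aestronglyMeasurable (by fun_prop))]
  · congr 2
    refine setLIntegral_congr_fun measurableSet_Ioo fun θ hθ => ?_
    rw [mul_comm, ENNReal.ofReal_mul (hφ0 _ ⟨Real.neg_one_le_cos θ, Real.cos_le_one θ⟩)]
  · filter_upwards [ae_restrict_mem measurableSet_Ioo] with θ hθ
    exact mul_nonneg (hφ0 _ ⟨Real.neg_one_le_cos θ, Real.cos_le_one θ⟩)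
      (pow_nonneg (Real.sin_pos_of_mem_Ioo hθ).le _)

/-! ### The Langevin kernel -/

/-- The weight of Poisson's integral is integrable, by comparison with the derivative of
`arcsin`. -/
theorem intervalIntegrable_one_sub_sq_rpow {s : ℝ} (hs : -(1 / 2) ≤ s) :
    IntervalIntegrable (fun t : ℝ => (1 - t ^ 2) ^ s) volume (-1) 1 := by
  have h1 : IntegrableOn (fun x : ℝ => 1 / √(1 - x ^ 2)) (Ioc (-1) 1) :=
    intervalIntegral.integrableOn_deriv_of_nonneg Real.continuous_arcsin.continuousOn
      (fun x hx => Real.hasDerivAt_arcsin hx.1.ne' hx.2.ne) (fun x _ => by positivity)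
  rw [intervalIntegrable_iff_integrableOn_Ioo_of_le (by norm_num)]
  refine Integrable.mono' (h1.mono_set Ioo_subset_Ioc_self)
    (Measurable.aestronglyMeasurable (by fun_prop)) ?_
  filter_upwards [ae_restrict_mem measurableSet_Ioo] with t ht
  have h0 : 0 < 1 - t ^ 2 := by nlinarith [ht.1, ht.2]
  rw [Real.norm_of_nonneg (Real.rpow_nonneg h0.le _), Real.sqrt_eq_rpow, one_div,
    ← Real.rpow_neg h0.le]
  exact Real.rpow_le_rpow_of_exponent_ge h0 (by nlinarith [sq_nonneg t]) hs

theorem besselI_pos {ν κ : ℝ} (hν : 0 ≤ ν) (hκ : 0 < κ) : 0 < besselI ν κ := by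
  unfold besselI
  have h1 := Real.Gamma_pos_of_pos (show (0 : ℝ) < ν + 1 / 2 by positivity)
  have h2 := Real.Gamma_pos_of_pos (show (0 : ℝ) < 1 / 2 by positivity)
  refine mul_pos (by positivity) ?_
  refine intervalIntegral.intervalIntegral_pos_of_pos_on ?_ ?_ (by norm_num)
  · exact (intervalIntegrable_one_sub_sq_rpow (by linarith)).continuousOn_mul
      (Continuous.continuousOn (by fun_prop))
  · intro t ht
    have h0 : 0 < 1 - t ^ 2 := by nlinarith [ht.1, ht.2]
    positivity

/-- The normalizing integral of the weight `exp (κ (cos θ - 1))`. -/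
noncomputable def fisherNorm (p : ℕ) (κ : ℝ) : ℝ :=
  ∫ θ in (0 : ℝ)..Real.pi, Real.exp (κ * (Real.cos θ - 1)) * Real.sin θ ^ (p - 2)

/-- The Fisher–von Mises density with concentration `κ`, as a function of the cosine of the angle
to its mean direction. -/
noncomputable def fisherKernel (p : ℕ) (κ t : ℝ) : ℝ :=
  Real.exp (κ * (t - 1)) / (sphereArea (p - 1) * fisherNorm p κ)

@[fun_prop]
theorem continuous_fisherKernel (p : ℕ) (κ : ℝ) : Continuous (fisherKernel p κ) := by
  unfold fisherKernel; fun_prop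

theorem fisherNorm_pos (p : ℕ) (κ : ℝ) : 0 < fisherNorm p κ := by
  refine intervalIntegral.intervalIntegral_pos_of_pos_on
    (Continuous.intervalIntegrable (by fun_prop) _ _) ?_ Real.pi_pos
  intro θ hθ
  have := Real.sin_pos_of_mem_Ioo hθ
  positivity

theorem fisherKernel_nonneg {p : ℕ} (hp : 2 ≤ p) (κ t : ℝ) : 0 ≤ fisherKernel p κ t := by
  have := fisherNorm_pos p κ
  have := sphereArea_pos (show 1 ≤ p - 1 by omega)
  unfold fisherKernel
  positivity

/-- The normalized Langevin kernel is the Fisher–von Mises density. -/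
theorem langevin_div_c1 {p : ℕ} (hp : 2 ≤ p) {κ : ℝ} (hκ : 0 < κ) (t : ℝ) :
    langevin p κ t / c1 p κ = fisherKernel p κ t := by
  have hp' : (2 : ℝ) ≤ p := by exact_mod_cast hp
  have hI := besselI_pos (show (0 : ℝ) ≤ p / 2 - 1 by linarith) hκ
  set A := κ ^ ((p : ℝ) / 2 - 1) *
    ((2 * Real.pi) ^ ((p : ℝ) / 2) * besselI ((p : ℝ) / 2 - 1) κ)⁻¹ with hA
  have hA0 : 0 < A := by positivity
  have hL : ∀ s, langevin p κ s = A * Real.exp κ * Real.exp (κ * (s - 1)) := by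
    intro s
    rw [langevin, ← hA, mul_assoc A, ← Real.exp_add]
    ring_nf
  have hc : c1 p κ = A * Real.exp κ * (sphereArea (p - 1) * fisherNorm p κ) := by
    simp only [c1, hL, fisherNorm, mul_assoc, intervalIntegral.integral_const_mul]
    ring
  rw [hL, hc, fisherKernel, mul_div_mul_left _ _ (by positivity)]

theorem integral_fisherKernel {p : ℕ} (hp : 2 ≤ p) (κ : ℝ) {v : E p} (hv : ‖v‖ = 1) :
    ∫ w : unitSphere p, fisherKernel p κ (inner ℝ v (w : E p)) ∂(sphereMeasure p) = 1 := by
  rw [integral_sphere_inner hp (by fun_prop) (fun t _ => fisherKernel_nonneg hp κ t) hv]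
  have := fisherNorm_pos p κ
  have := sphereArea_pos (show 1 ≤ p - 1 by omega)
  simp only [fisherKernel, div_mul_eq_mul_div, intervalIntegral.integral_div]
  rw [← fisherNorm]
  field_simp

/-- The angles up to `κ^{-1/2}` contribute the order `κ^{-(p-1)/2}` to the normalizing
integral. -/
theorem exists_le_fisherNorm (p : ℕ) :
    ∃ c > 0, ∀ κ : ℝ, 1 ≤ κ → c * (κ ^ (-(1 / 2) : ℝ)) ^ (p - 2 + 1) ≤ fisherNorm p κ := by
  set n := p - 2 with hn
  refine ⟨Real.exp (-(1 / 2)) * (2 / Real.pi) ^ n / (n + 1), by positivity, fun κ hκ => ?_⟩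
  have hκ0 : 0 < κ := by linarith
  set a : ℝ := κ ^ (-(1 / 2) : ℝ) with ha
  have ha0 : 0 < a := by positivity
  have ha1 : a ≤ 1 := Real.rpow_le_one_of_one_le_of_nonpos hκ (by norm_num)
  have ha2 : κ * a ^ 2 = 1 := by
    rw [ha, ← Real.rpow_natCast, ← Real.rpow_mul hκ0.le]
    norm_num
    rw [Real.rpow_neg_one, mul_inv_cancel₀ hκ0.ne']
  have hpi := Real.pi_gt_three
  have hint : ∫ θ in (0 : ℝ)..a, Real.exp (-(1 / 2)) * (2 / Real.pi) ^ n * θ ^ n =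
      Real.exp (-(1 / 2)) * (2 / Real.pi) ^ n / (n + 1) * a ^ (n + 1) := by
    rw [intervalIntegral.integral_const_mul, integral_pow]
    simp
    ring
  rw [← hint]
  have hle : ∫ θ in (0 : ℝ)..a, Real.exp (-(1 / 2)) * (2 / Real.pi) ^ n * θ ^ n ≤
      ∫ θ in (0 : ℝ)..a, Real.exp (κ * (Real.cos θ - 1)) * Real.sin θ ^ n := by
    refine intervalIntegral.integral_mono_on ha0.le
      (Continuous.intervalIntegrable (by fun_prop) _ _)
      (Continuous.intervalIntegrable (by fun_prop) _ _) fun θ hθ => ?_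
    have h1 := Real.one_sub_sq_div_two_le_cos (x := θ)
    have h2 := Real.mul_le_sin hθ.1 (by linarith [hθ.2])
    have h0 : 0 ≤ 2 / Real.pi * θ := mul_nonneg (by positivity) hθ.1
    have h3 : -(1 / 2) ≤ κ * (Real.cos θ - 1) := by
      have : θ ^ 2 ≤ a ^ 2 := pow_le_pow_left₀ hθ.1 hθ.2 2
      nlinarith
    rw [mul_assoc, ← mul_pow]
    gcongr
  refine hle.trans (intervalIntegral.integral_mono_interval le_rfl ha0.le (by linarith) ?_
    (Continuous.intervalIntegrable (by fun_prop) _ _))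
  filter_upwards [ae_restrict_mem measurableSet_Ioc] with θ hθ
  exact mul_nonneg (Real.exp_nonneg _)
    (pow_nonneg (Real.sin_nonneg_of_nonneg_of_le_pi hθ.1.le hθ.2) _)

theorem rpow_neg_half_pow {p : ℕ} (hp : 2 ≤ p) {κ : ℝ} (hκ : 0 < κ) :
    ((κ ^ (-(1 / 2) : ℝ)) ^ (p - 2 + 1))⁻¹ = κ ^ (((p : ℝ) - 1) / 2) := by
  rw [← Real.rpow_natCast, ← Real.rpow_mul hκ.le, ← Real.rpow_neg hκ.le]
  congr 1
  rw [Nat.cast_add, Nat.cast_sub hp]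
  push_cast
  ring

/-- The maximum of the Fisher–von Mises density grows like `κ^{(p-1)/2}`. -/
theorem exists_fisherKernel_le {p : ℕ} (hp : 2 ≤ p) :
    ∃ C > 0, ∀ κ : ℝ, 1 ≤ κ → ∀ t ≤ 1, fisherKernel p κ t ≤ C * κ ^ (((p : ℝ) - 1) / 2) := by
  obtain ⟨c, hc, h⟩ := exists_le_fisherNorm p
  have hω := sphereArea_pos (show 1 ≤ p - 1 by omega)
  refine ⟨(sphereArea (p - 1) * c)⁻¹, by positivity, fun κ hκ t ht => ?_⟩
  have hκ0 : 0 < κ := by linarith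
  rw [← rpow_neg_half_pow hp hκ0, ← mul_inv, fisherKernel, div_eq_mul_inv]
  have h1 : Real.exp (κ * (t - 1)) ≤ 1 := Real.exp_le_one_iff.2 (by nlinarith)
  have := h κ hκ
  have hpos : 0 < sphereArea (p - 1) * c * (κ ^ (-(1 / 2) : ℝ)) ^ (p - 2 + 1) := by positivity
  calc _ ≤ 1 * (sphereArea (p - 1) * fisherNorm p κ)⁻¹ := by
        have := fisherNorm_pos p κ
        gcongr
    _ ≤ _ := by
        rw [one_mul]
        refine inv_anti₀ hpos ?_
        rw [mul_assoc]
        gcongr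

/-- The Fisher–von Mises density concentrates at rate `κ^{-1/2}`. -/
theorem exists_integral_one_sub_mul_fisherKernel_le {p : ℕ} (hp : 2 ≤ p) :
    ∃ C > 0, ∀ κ : ℝ, 1 ≤ κ → ∀ v : E p, ‖v‖ = 1 →
      ∫ w : unitSphere p, (1 - inner ℝ v (w : E p)) * fisherKernel p κ (inner ℝ v (w : E p))
        ∂(sphereMeasure p) ≤ C / κ := by
  obtain ⟨c, hc, h⟩ := exists_le_fisherNorm p
  have hω := sphereArea_pos (show 1 ≤ p - 1 by omega)
  set n := p - 2 with hn
  set b : ℝ := 2 / Real.pi ^ 2 with hb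
  have hb0 : 0 < b := by positivity
  set D : ℝ := b ^ (-((n : ℝ) + 2 + 1) / 2) * (1 / 2) * Real.Gamma (((n : ℝ) + 2 + 1) / 2) with hD
  have hD0 : 0 < D := by
    have := Real.Gamma_pos_of_pos (show (0 : ℝ) < ((n : ℝ) + 2 + 1) / 2 by positivity)
    positivity
  refine ⟨D / 2 / c, by positivity, fun κ hκ v hv => ?_⟩
  have hκ0 : 0 < κ := by linarith
  rw [integral_sphere_inner hp (φ := fun t => (1 - t) * fisherKernel p κ t) (by fun_prop)
    (fun t ht => mul_nonneg (by linarith [ht.2]) (fisherKernel_nonneg hp κ t)) hv]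
  have hW := fisherNorm_pos p κ
  have e : (fun θ : ℝ => (1 - Real.cos θ) * fisherKernel p κ (Real.cos θ) * Real.sin θ ^ (p - 2)) =
      fun θ => (1 - Real.cos θ) * Real.exp (κ * (Real.cos θ - 1)) * Real.sin θ ^ n /
        (sphereArea (p - 1) * fisherNorm p κ) := by
    funext θ; rw [fisherKernel, ← hn]; ring
  rw [e, intervalIntegral.integral_div, ← mul_div_assoc, mul_div_mul_left _ _ hω.ne']
  -- The moment is compared with a Gaussian moment through `2 θ² / π² ≤ 1 - cos θ ≤ θ² / 2`.
  have hG : IntegrableOn (fun θ : ℝ => θ ^ ((n : ℝ) + 2) * Real.exp (-(b * κ) * θ ^ (2 : ℝ)))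
      (Ioi 0) := integrableOn_rpow_mul_exp_neg_mul_rpow (by linarith [n.cast_nonneg (α := ℝ)])
        (by norm_num) (by positivity)
  have hmom : ∫ θ in (0 : ℝ)..Real.pi,
      (1 - Real.cos θ) * Real.exp (κ * (Real.cos θ - 1)) * Real.sin θ ^ n ≤
      D / 2 * (κ ^ (-(1 / 2) : ℝ)) ^ (n + 1) / κ := by
    have hI : ∫ θ in Ioi (0 : ℝ), θ ^ ((n : ℝ) + 2) * Real.exp (-(b * κ) * θ ^ (2 : ℝ)) =
        D * (κ ^ (-(1 / 2) : ℝ)) ^ (n + 1) / κ := by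
      rw [integral_rpow_mul_exp_neg_mul_rpow (by norm_num)
        (by linarith [n.cast_nonneg (α := ℝ)]) (by positivity), hD, Real.mul_rpow hb0.le hκ0.le]
      have : κ ^ (-((n : ℝ) + 2 + 1) / 2) = (κ ^ (-(1 / 2) : ℝ)) ^ (n + 1) / κ := by
        rw [← Real.rpow_natCast, ← Real.rpow_mul hκ0.le, ← Real.rpow_sub_one hκ0.ne']
        congr 1; push_cast; ring
      rw [this]; ring
    calc _ ≤ ∫ θ in Ioc (0 : ℝ) Real.pi,
          1 / 2 * (θ ^ ((n : ℝ) + 2) * Real.exp (-(b * κ) * θ ^ (2 : ℝ))) := by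
          rw [intervalIntegral.integral_of_le Real.pi_pos.le]
          refine setIntegral_mono_on ?_ ?_ measurableSet_Ioc fun θ hθ => ?_
          · exact (Continuous.intervalIntegrable (by fun_prop) (0 : ℝ) Real.pi).1
          · exact (hG.mono_set Ioc_subset_Ioi_self).const_mul _
          · have h1 := Real.one_sub_sq_div_two_le_cos (x := θ)
            have h2 := Real.cos_le_one_sub_mul_cos_sq (x := θ) (by
              rw [abs_of_pos hθ.1]; exact hθ.2)
            have h3 := Real.sin_nonneg_of_nonneg_of_le_pi hθ.1.le hθ.2
            have h4 := Real.sin_le hθ.1.le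
            have h5 : θ ^ ((n : ℝ) + 2) = θ ^ 2 * θ ^ n := by
              rw [Real.rpow_add hθ.1, Real.rpow_natCast, Real.rpow_two]; ring
            rw [h5, Real.rpow_two]
            calc _ ≤ (θ ^ 2 / 2) * Real.exp (-(b * κ) * θ ^ 2) * θ ^ n := by
                  have h6 : κ * (Real.cos θ - 1) ≤ -(b * κ) * θ ^ 2 := by
                    rw [← hb] at h2
                    nlinarith
                  refine mul_le_mul (mul_le_mul (by linarith) (Real.exp_le_exp.2 h6)
                    (Real.exp_nonneg _) (by positivity)) (pow_le_pow_left₀ h3 h4 _)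
                    (pow_nonneg h3 _) (by positivity)
              _ = _ := by ring
      _ = 1 / 2 * ∫ θ in Ioc (0 : ℝ) Real.pi,
          (θ ^ ((n : ℝ) + 2) * Real.exp (-(b * κ) * θ ^ (2 : ℝ))) := integral_const_mul _ _
      _ ≤ 1 / 2 * (D * (κ ^ (-(1 / 2) : ℝ)) ^ (n + 1) / κ) := by
          rw [← hI]
          refine mul_le_mul_of_nonneg_left ?_ (by norm_num)
          refine setIntegral_mono_set hG ?_ (Eventually.of_forall Ioc_subset_Ioi_self)
          filter_upwards [ae_restrict_mem measurableSet_Ioi] with θ hθ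
          have : (0 : ℝ) < θ := hθ
          positivity
      _ = _ := by ring
  calc _ ≤ (D / 2 * (κ ^ (-(1 / 2) : ℝ)) ^ (n + 1) / κ) / (c * (κ ^ (-(1 / 2) : ℝ)) ^ (n + 1)) := by
        gcongr
        exact h κ hκ
    _ = _ := by
        have : 0 < (κ ^ (-(1 / 2) : ℝ)) ^ (n + 1) := by positivity
        field_simp

/-! ### Convergence in probability -/

section InProbability

variable {Ω : Type*} [MeasurableSpace Ω] {P : Measure Ω} [IsProbabilityMeasure P]

/-- Continuous mapping for convergence in probability to constants. -/
theorem tendstoInMeasure_comp₂ {A B : ℕ → Ω → ℝ} {a b : ℝ}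
    (hA : TendstoInMeasure P A atTop fun _ => a) (hB : TendstoInMeasure P B atTop fun _ => b)
    {ψ : ℝ × ℝ → ℝ} (hψ : ContinuousAt ψ (a, b)) :
    TendstoInMeasure P (fun n ω => ψ (A n ω, B n ω)) atTop fun _ => ψ (a, b) := by
  rw [tendstoInMeasure_iff_dist] at *
  intro ε hε
  obtain ⟨δ, hδ, h⟩ := Metric.continuousAt_iff.1 hψ ε hε
  have hs := (hA δ hδ).add (hB δ hδ)
  rw [add_zero] at hs
  refine tendsto_of_tendsto_of_tendsto_of_le_of_le tendsto_const_nhds hs (fun _ => bot_le)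
    fun n => (measure_mono fun ω hω => ?_).trans (measure_union_le _ _)
  by_contra hc
  simp only [mem_union, mem_ofPred_eq, not_or, not_le] at hc hω
  have := h (x := (A n ω, B n ω)) (by rw [Prod.dist_eq]; exact max_lt hc.1 hc.2)
  linarith

theorem tendstoInMeasure_const_seq {c : ℕ → ℝ} {c₀ : ℝ} (hc : Tendsto c atTop (𝓝 c₀)) :
    TendstoInMeasure P (fun n _ => c n) atTop fun _ : Ω => c₀ := by
  refine tendstoInMeasure_of_tendsto_ae (fun n => aestronglyMeasurable_const) ?_
  exact Eventually.of_forall fun _ => hc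

/-- Markov's inequality, for squares. -/
theorem tendstoInMeasure_zero_of_sq {T : ℕ → Ω → ℝ} {b : ℕ → ℝ}
    (hT : ∀ᶠ n in atTop, Integrable (fun ω => T n ω ^ 2) P)
    (hb : ∀ᶠ n in atTop, ∫ ω, T n ω ^ 2 ∂P ≤ b n) (hb0 : Tendsto b atTop (𝓝 0)) :
    TendstoInMeasure P T atTop fun _ => 0 := by
  rw [tendstoInMeasure_iff_measureReal_norm]
  intro ε hε
  have hlim : Tendsto (fun n => (ε ^ 2)⁻¹ * b n) atTop (𝓝 0) := by
    simpa using hb0.const_mul (ε ^ 2)⁻¹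
  refine tendsto_of_tendsto_of_tendsto_of_le_of_le' tendsto_const_nhds hlim
    (Eventually.of_forall fun n => measureReal_nonneg) ?_
  filter_upwards [hT, hb] with n h1 h2
  have h3 := mul_meas_ge_le_integral_of_nonneg (μ := P) (f := fun ω => T n ω ^ 2)
    (Eventually.of_forall fun ω => sq_nonneg _) h1 (ε ^ 2)
  have hset : {ω | ε ≤ ‖T n ω - 0‖} = {ω | ε ^ 2 ≤ T n ω ^ 2} := by
    ext ω
    simp only [mem_ofPred_eq, sub_zero, Real.norm_eq_abs]
    rw [← sq_abs (T n ω), sq_le_sq₀ hε.le (abs_nonneg _)]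
  rw [hset, ← div_eq_inv_mul, le_div_iff₀ (by positivity), mul_comm]
  exact h3.trans h2

/-- Perturbation of convergence in probability by an error that is at most `C n`. -/
theorem tendstoInMeasure_of_abs_sub_le {A B C : ℕ → Ω → ℝ} {a : ℝ}
    (hB : TendstoInMeasure P B atTop fun _ => a) (hC : TendstoInMeasure P C atTop fun _ => 0)
    (hle : ∀ᶠ n in atTop, ∀ ω, |A n ω - B n ω| ≤ C n ω) :
    TendstoInMeasure P A atTop fun _ => a := by
  have hAB : TendstoInMeasure P (fun n ω => A n ω - B n ω) atTop fun _ => 0 := by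
    rw [tendstoInMeasure_iff_norm] at *
    intro ε hε
    refine tendsto_of_tendsto_of_tendsto_of_le_of_le' tendsto_const_nhds (hC ε hε)
      (Eventually.of_forall fun _ => bot_le) ?_
    filter_upwards [hle] with n hn
    refine measure_mono fun ω hω => ?_
    simp only [mem_ofPred_eq, sub_zero, Real.norm_eq_abs] at hω ⊢
    exact hω.trans ((hn ω).trans (le_abs_self _))
  have := tendstoInMeasure_comp₂ hAB hB (ψ := fun q => q.1 + q.2) (by fun_prop)
  simpa using this

/-- A threshold below the limit in probability is eventually exceeded. -/
theorem tendsto_measureReal_le_of_lt {T : ℕ → Ω → ℝ} {a Δ : ℝ}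
    (hT : TendstoInMeasure P T atTop fun _ => a) (h : Δ < a) :
    Tendsto (fun n => P.real {ω | T n ω ≤ Δ}) atTop (𝓝 0) := by
  rw [tendstoInMeasure_iff_measureReal_norm] at hT
  refine squeeze_zero (fun _ => measureReal_nonneg) (fun n => ?_) (hT (a - Δ) (by linarith))
  refine measureReal_mono fun ω hω => ?_
  simp only [mem_ofPred_eq, Real.norm_eq_abs] at hω ⊢
  rw [abs_sub_comm]
  exact le_trans (by linarith) (le_abs_self _)

/-- A threshold above the limit in probability is eventually not exceeded. -/
theorem tendsto_measureReal_gt_of_lt {T : ℕ → Ω → ℝ} {a Δ : ℝ}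
    (hT : TendstoInMeasure P T atTop fun _ => a) (h : a < Δ) :
    Tendsto (fun n => P.real {ω | Δ < T n ω}) atTop (𝓝 0) := by
  rw [tendstoInMeasure_iff_measureReal_norm] at hT
  refine squeeze_zero (fun _ => measureReal_nonneg) (fun n => ?_) (hT (Δ - a) (by linarith))
  refine measureReal_mono fun ω hω => ?_
  simp only [mem_ofPred_eq, Real.norm_eq_abs] at hω ⊢
  exact le_trans (by linarith) (le_abs_self _)

theorem sq_integral_le_integral_sq {f : Ω → ℝ} (hf : MemLp f 2 P) :
    (∫ ω, f ω ∂P) ^ 2 ≤ ∫ ω, f ω ^ 2 ∂P := by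
  have h := variance_nonneg f P
  rw [variance_eq_sub hf] at h
  simpa using h

theorem integral_sq_sum {ι : Type*} (A : Finset ι) {W : ι → Ω → ℝ}
    (hW : ∀ a ∈ A, MemLp (W a) 2 P) :
    ∫ ω, (∑ a ∈ A, W a ω) ^ 2 ∂P = ∑ a ∈ A, ∑ b ∈ A, ∫ ω, W a ω * W b ω ∂P := by
  have hint : ∀ a ∈ A, ∀ b ∈ A, Integrable (fun ω => W a ω * W b ω) P :=
    fun a ha b hb => (hW a ha).integrable_mul (hW b hb)
  simp_rw [sq, Finset.sum_mul_sum]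
  rw [integral_finsetSum _ fun a ha => integrable_finsetSum _ fun b hb =>
    hint a ha b hb]
  refine Finset.sum_congr rfl fun a ha => ?_
  rw [integral_finsetSum _ fun b hb => hint a ha b hb]

end InProbability

/-! ### Second moments of `U`-statistics -/

section UStatistics

variable {Ω 𝒳 : Type*} [MeasurableSpace Ω] [MeasurableSpace 𝒳] {P : Measure Ω}
  [IsProbabilityMeasure P] {lam : Measure 𝒳} [IsProbabilityMeasure lam] {X : ℕ → Ω → 𝒳}

theorem map_pair (hX : ∀ i, Measurable (X i)) (hind : iIndepFun X P)
    (hlaw : ∀ i, P.map (X i) = lam) {i j : ℕ} (hij : i ≠ j) :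
    P.map (fun ω => (X i ω, X j ω)) = lam.prod lam := by
  rw [(indepFun_iff_map_prod_eq_prod_map_map (hX i).aemeasurable (hX j).aemeasurable).1
    (hind.indepFun hij), hlaw, hlaw]

theorem integral_pair (hX : ∀ i, Measurable (X i)) (hind : iIndepFun X P)
    (hlaw : ∀ i, P.map (X i) = lam) {i j : ℕ} (hij : i ≠ j) {D : 𝒳 → 𝒳 → ℝ}
    (hD : Measurable (Function.uncurry D)) :
    ∫ ω, D (X i ω) (X j ω) ∂P = ∫ z, D z.1 z.2 ∂(lam.prod lam) := by
  rw [← map_pair hX hind hlaw hij, integral_map ((hX i).prodMk (hX j)).aemeasurable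
    (show Measurable fun z : 𝒳 × 𝒳 => D z.1 z.2 from hD).aestronglyMeasurable]

theorem memLp_pair (hX : ∀ i, Measurable (X i)) (hind : iIndepFun X P)
    (hlaw : ∀ i, P.map (X i) = lam) {i j : ℕ} (hij : i ≠ j) {D : 𝒳 → 𝒳 → ℝ}
    (hD : MemLp (Function.uncurry D) 2 (lam.prod lam)) :
    MemLp (fun ω => D (X i ω) (X j ω)) 2 P := by
  rw [← map_pair hX hind hlaw hij] at hD
  exact hD.comp_of_map ((hX i).prodMk (hX j)).aemeasurable

/-- A kernel that is centred in its first argument is orthogonal to every function of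
observations other than that argument. -/
theorem integral_mul_eq_zero (hX : ∀ i, Measurable (X i)) (hind : iIndepFun X P)
    (hlaw : ∀ i, P.map (X i) = lam) {D G : 𝒳 → 𝒳 → ℝ}
    (hD : Measurable (Function.uncurry D)) (hG : Measurable (Function.uncurry G))
    (hD0 : ∀ y, ∫ x, D x y ∂lam = 0) {i j k l : ℕ} (hij : i ≠ j) (hik : i ≠ k) (hil : i ≠ l) :
    ∫ ω, D (X i ω) (X j ω) * G (X k ω) (X l ω) ∂P = 0 := by
  have hT := hind.indepFun_finset ({i} : Finset ℕ) ({j, k, l} : Finset ℕ)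
    (by simp [hij, hik, hil]) hX
  have hI : IndepFun (X i) (fun ω => (X j ω, X k ω, X l ω)) P :=
    hT.comp (φ := fun a : ({i} : Finset ℕ) → 𝒳 => a ⟨i, by simp⟩)
      (ψ := fun a : ({j, k, l} : Finset ℕ) → 𝒳 =>
        (a ⟨j, by simp⟩, a ⟨k, by simp⟩, a ⟨l, by simp⟩))
      (by fun_prop) (by fun_prop)
  have hW : Measurable fun ω => (X j ω, X k ω, X l ω) := by fun_prop
  have hmap := (indepFun_iff_map_prod_eq_prod_map_map (hX i).aemeasurable hW.aemeasurable).1 hI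
  set Φ : 𝒳 × 𝒳 × 𝒳 × 𝒳 → ℝ := fun q => D q.1 q.2.1 * G q.2.2.1 q.2.2.2 with hΦ
  have hΦm : Measurable Φ := by
    refine Measurable.mul ?_ ?_
    · exact hD.comp (by fun_prop : Measurable fun q : 𝒳 × 𝒳 × 𝒳 × 𝒳 => (q.1, q.2.1))
    · exact hG.comp (by fun_prop : Measurable fun q : 𝒳 × 𝒳 × 𝒳 × 𝒳 => (q.2.2.1, q.2.2.2))
  have h1 : ∫ ω, D (X i ω) (X j ω) * G (X k ω) (X l ω) ∂P =
      ∫ q, Φ q ∂(lam.prod (P.map fun ω => (X j ω, X k ω, X l ω))) := by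
    rw [← hlaw i, ← hmap, integral_map ((hX i).prodMk hW).aemeasurable hΦm.aestronglyMeasurable]
  have := Measure.isProbabilityMeasure_map (μ := P) hW.aemeasurable
  rw [h1]
  by_cases hint : Integrable Φ (lam.prod (P.map fun ω => (X j ω, X k ω, X l ω)))
  · rw [integral_prod_symm _ hint]
    simp [hΦ, integral_mul_const, hD0]
  · exact integral_undef hint

theorem integral_sq_sum_centred (hX : ∀ i, Measurable (X i)) (hind : iIndepFun X P)
    (hlaw : ∀ i, P.map (X i) = lam) {r : 𝒳 → ℝ} (hr : Measurable r) (hr2 : MemLp r 2 lam)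
    (hr0 : ∫ x, r x ∂lam = 0) (s : Finset ℕ) :
    ∫ ω, (∑ i ∈ s, r (X i ω)) ^ 2 ∂P = s.card * ∫ x, r x ^ 2 ∂lam := by
  have hm : ∀ i, MemLp (fun ω => r (X i ω)) 2 P := fun i =>
    MemLp.comp_of_map (by rwa [hlaw i]) (hX i).aemeasurable
  rw [integral_sq_sum s fun i _ => hm i, ← nsmul_eq_mul, ← Finset.sum_const]
  refine Finset.sum_congr rfl fun i hi => ?_
  rw [Finset.sum_eq_single_of_mem i hi]
  · rw [← hlaw i, integral_map (hX i).aemeasurable (hr.pow_const 2).aestronglyMeasurable]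
    simp_rw [sq]
  · intro j _ hj
    exact integral_mul_eq_zero hX hind hlaw (D := fun x _ => r x) (G := fun x _ => r x)
      (hr.comp measurable_fst) (hr.comp measurable_fst) (fun _ => hr0) hj.symm hj.symm hj.symm

/-- Second moment of the sums `∑_j R(X_i, X_j)` for a kernel centred in its second
argument. -/
theorem integral_sq_sum_row (hX : ∀ i, Measurable (X i)) (hind : iIndepFun X P)
    (hlaw : ∀ i, P.map (X i) = lam) {R : 𝒳 → 𝒳 → ℝ} (hR : Measurable (Function.uncurry R))
    (hR2 : MemLp (Function.uncurry R) 2 (lam.prod lam)) (hR0 : ∀ x, ∫ y, R x y ∂lam = 0)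
    (s : Finset ℕ) (i : ℕ) :
    ∫ ω, (∑ j ∈ s.erase i, R (X i ω) (X j ω)) ^ 2 ∂P =
      (s.erase i).card * ∫ z, R z.1 z.2 ^ 2 ∂(lam.prod lam) := by
  rw [integral_sq_sum _ fun j hj => memLp_pair hX hind hlaw (Finset.ne_of_mem_erase hj).symm hR2,
    ← nsmul_eq_mul, ← Finset.sum_const]
  refine Finset.sum_congr rfl fun j hj => ?_
  have hji := Finset.ne_of_mem_erase hj
  rw [Finset.sum_eq_single_of_mem j hj]
  · rw [← integral_pair hX hind hlaw hji.symm (D := fun x y => R x y ^ 2) (hR.pow_const 2)]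
    simp_rw [sq]
  · intro k hk hkj
    exact integral_mul_eq_zero hX hind hlaw (D := fun y x => R x y) (hR.comp measurable_swap) hR
      hR0 hji hji hkj.symm

/-- Second moment of a completely degenerate `U`-statistic. -/
theorem integral_sq_sum_degenerate (hX : ∀ i, Measurable (X i)) (hind : iIndepFun X P)
    (hlaw : ∀ i, P.map (X i) = lam) {D : 𝒳 → 𝒳 → ℝ} (hD : Measurable (Function.uncurry D))
    (hD2 : MemLp (Function.uncurry D) 2 (lam.prod lam)) (hsymm : ∀ x y, D x y = D y x)
    (hD0 : ∀ x, ∫ y, D x y ∂lam = 0) (s : Finset ℕ) :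
    ∫ ω, (∑ i ∈ s, ∑ j ∈ s.erase i, D (X i ω) (X j ω)) ^ 2 ∂P =
      2 * (s.card * (s.card - 1)) * ∫ z, D z.1 z.2 ^ 2 ∂(lam.prod lam) := by
  have hD0' : ∀ y, ∫ x, D x y ∂lam = 0 := fun y => by simp_rw [hsymm _ y]; exact hD0 y
  have hoff : ∀ F : ℕ → ℕ → ℝ, ∑ i ∈ s, ∑ j ∈ s.erase i, F i j = ∑ a ∈ s.offDiag, F a.1 a.2 := by
    intro F
    rw [Finset.sum_sigma']
    refine Finset.sum_bij' (fun a _ => (a.1, a.2)) (fun a _ => ⟨a.1, a.2⟩) ?_ ?_ ?_ ?_ ?_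
    · intro a ha
      simp only [Finset.mem_sigma, Finset.mem_erase] at ha
      simp [ha, ha.2.1.symm]
    · intro a ha
      simp only [Finset.mem_offDiag] at ha
      simp [ha, Ne.symm ha.2.2]
    all_goals simp
  simp_rw [hoff]
  rw [integral_sq_sum _ fun a ha => memLp_pair hX hind hlaw (Finset.mem_offDiag.1 ha).2.2 hD2]
  have hcard : (s.offDiag.card : ℝ) = s.card * (s.card - 1) := by
    rw [Finset.offDiag_card, Nat.cast_sub (Nat.le_mul_self _)]
    push_cast; ring
  rw [← hcard, mul_comm 2 (s.offDiag.card : ℝ), mul_assoc, ← nsmul_eq_mul, ← Finset.sum_const]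
  refine Finset.sum_congr rfl fun a ha => ?_
  obtain ⟨ha1, ha2, hne⟩ := Finset.mem_offDiag.1 ha
  have hI : ∫ ω, D (X a.1 ω) (X a.2 ω) * D (X a.1 ω) (X a.2 ω) ∂P =
      ∫ z, D z.1 z.2 ^ 2 ∂(lam.prod lam) := by
    rw [← integral_pair hX hind hlaw hne (D := fun x y => D x y ^ 2) (hD.pow_const 2)]
    simp_rw [sq]
  have hsub : ({a, a.swap} : Finset (ℕ × ℕ)) ⊆ s.offDiag := by
    intro b hb
    rcases Finset.mem_insert.1 hb with rfl | hb
    · exact ha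
    · rw [Finset.mem_singleton.1 hb]
      exact Finset.mem_offDiag.2 ⟨ha2, ha1, hne.symm⟩
  rw [← Finset.sum_subset hsub, Finset.sum_pair, hI]
  · simp_rw [Prod.fst_swap, Prod.snd_swap, hsymm (X a.2 _) (X a.1 _), hI]
    ring
  · intro h
    exact hne (congrArg Prod.fst h)
  · intro b hb hba
    obtain ⟨-, -, hbne⟩ := Finset.mem_offDiag.1 hb
    simp only [Finset.mem_insert, Finset.mem_singleton, not_or, Prod.ext_iff, Prod.fst_swap,
      Prod.snd_swap] at hba
    -- One of the two indices of `a` is not an index of `b`, and can be integrated out.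
    by_cases h1 : a.1 ≠ b.1 ∧ a.1 ≠ b.2
    · exact integral_mul_eq_zero hX hind hlaw hD hD hD0' hne h1.1 h1.2
    · have h2 : a.2 ≠ b.1 ∧ a.2 ≠ b.2 := by
        constructor <;> intro h <;> omega
      simp_rw [hsymm (X a.1 _) (X a.2 _)]
      exact integral_mul_eq_zero hX hind hlaw hD hD hD0' hne.symm h2.1 h2.2

end UStatistics

/-! ### Hoeffding's projections -/

section Projection

variable {𝒳 : Type*} [MeasurableSpace 𝒳] {lam : Measure 𝒳} [IsProbabilityMeasure lam]

/-- The projection `x ↦ E H(x, X)` of a kernel. -/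
noncomputable def kernelProj (lam : Measure 𝒳) (H : 𝒳 → 𝒳 → ℝ) (x : 𝒳) : ℝ := ∫ y, H x y ∂lam

variable {H : 𝒳 → 𝒳 → ℝ}

theorem measurable_kernelProj (hH : Measurable (Function.uncurry H)) :
    Measurable (kernelProj lam H) :=
  (StronglyMeasurable.integral_prod_right hH.stronglyMeasurable).measurable

theorem sq_kernelProj_le (hH : Measurable (Function.uncurry H))
    (hH2 : MemLp (Function.uncurry H) 2 (lam.prod lam)) :
    ∀ᵐ x ∂lam, kernelProj lam H x ^ 2 ≤ ∫ y, H x y ^ 2 ∂lam := by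
  filter_upwards [hH2.integrable_sq.prod_right_ae] with x hx
  have hm : Measurable (H x) := hH.comp measurable_prodMk_left
  exact sq_integral_le_integral_sq ((memLp_two_iff_integrable_sq hm.aestronglyMeasurable).2 hx)

theorem memLp_kernelProj (hH : Measurable (Function.uncurry H))
    (hH2 : MemLp (Function.uncurry H) 2 (lam.prod lam)) : MemLp (kernelProj lam H) 2 lam := by
  have hm := (measurable_kernelProj (lam := lam) hH)
  refine (memLp_two_iff_integrable_sq hm.aestronglyMeasurable).2 ?_
  refine Integrable.mono' hH2.integrable_sq.integral_prod_left
    (hm.pow_const 2).aestronglyMeasurable ?_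
  filter_upwards [sq_kernelProj_le hH hH2] with x hx
  rw [Real.norm_of_nonneg (sq_nonneg _)]
  exact hx

theorem integral_sq_kernelProj_le (hH : Measurable (Function.uncurry H))
    (hH2 : MemLp (Function.uncurry H) 2 (lam.prod lam)) :
    ∫ x, kernelProj lam H x ^ 2 ∂lam ≤ ∫ z, H z.1 z.2 ^ 2 ∂(lam.prod lam) := by
  have h1 := hH2.integrable_sq
  rw [show ∫ z, H z.1 z.2 ^ 2 ∂(lam.prod lam) = ∫ x, ∫ y, H x y ^ 2 ∂lam ∂lam from
    integral_prod _ h1]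
  exact integral_mono_ae (memLp_kernelProj hH hH2).integrable_sq h1.integral_prod_left
    (sq_kernelProj_le hH hH2)

theorem integral_kernelProj (hH2 : MemLp (Function.uncurry H) 2 (lam.prod lam)) :
    ∫ x, kernelProj lam H x ∂lam = ∫ z, H z.1 z.2 ∂(lam.prod lam) :=
  (integral_prod _ (hH2.integrable (by norm_num))).symm

/-- The kernel minus its projection on the first argument. -/
noncomputable def rowKernel (lam : Measure 𝒳) (H : 𝒳 → 𝒳 → ℝ) (x y : 𝒳) : ℝ :=
  H x y - kernelProj lam H x

/-- The completely degenerate part in Hoeffding's decomposition. -/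
noncomputable def degenerateKernel (lam : Measure 𝒳) (H : 𝒳 → 𝒳 → ℝ) (x y : 𝒳) : ℝ :=
  H x y - kernelProj lam H x - kernelProj lam H y + ∫ x, kernelProj lam H x ∂lam

theorem measurable_rowKernel (hH : Measurable (Function.uncurry H)) :
    Measurable (Function.uncurry (rowKernel lam H)) :=
  hH.sub ((measurable_kernelProj hH).comp measurable_fst)

theorem measurable_degenerateKernel (hH : Measurable (Function.uncurry H)) :
    Measurable (Function.uncurry (degenerateKernel lam H)) :=
  ((hH.sub ((measurable_kernelProj hH).comp measurable_fst)).sub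
    ((measurable_kernelProj hH).comp measurable_snd)).add_const _

theorem memLp_rowKernel (hH : Measurable (Function.uncurry H))
    (hH2 : MemLp (Function.uncurry H) 2 (lam.prod lam)) :
    MemLp (Function.uncurry (rowKernel lam H)) 2 (lam.prod lam) :=
  hH2.sub ((memLp_kernelProj hH hH2).comp_fst lam)

theorem memLp_degenerateKernel (hH : Measurable (Function.uncurry H))
    (hH2 : MemLp (Function.uncurry H) 2 (lam.prod lam)) :
    MemLp (Function.uncurry (degenerateKernel lam H)) 2 (lam.prod lam) :=
  ((hH2.sub ((memLp_kernelProj hH hH2).comp_fst lam)).sub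
    ((memLp_kernelProj hH hH2).comp_snd lam)).add (memLp_const _)

theorem integral_rowKernel (hHi : ∀ x, Integrable (H x) lam) (x : 𝒳) :
    ∫ y, rowKernel lam H x y ∂lam = 0 := by
  simp only [rowKernel]
  rw [integral_sub (hHi x) (integrable_const _)]
  simp [kernelProj]

theorem integral_degenerateKernel (hH : Measurable (Function.uncurry H))
    (hH2 : MemLp (Function.uncurry H) 2 (lam.prod lam))
    (hHi : ∀ x, Integrable (H x) lam) (x : 𝒳) :
    ∫ y, degenerateKernel lam H x y ∂lam = 0 := by
  have h1 : Integrable (kernelProj lam H) lam :=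
    (memLp_kernelProj hH hH2).integrable (by norm_num)
  have h2 : Integrable (fun y => H x y - kernelProj lam H x) lam :=
    (hHi x).sub (integrable_const _)
  have h3 : Integrable (fun y => H x y - kernelProj lam H x - kernelProj lam H y) lam := h2.sub h1
  simp only [degenerateKernel]
  rw [integral_add h3 (integrable_const _), integral_sub h2 h1,
    integral_sub (hHi x) (integrable_const _)]
  simp [kernelProj]

theorem integral_sq_rowKernel_le (hH : Measurable (Function.uncurry H))
    (hH2 : MemLp (Function.uncurry H) 2 (lam.prod lam)) :
    ∫ z, rowKernel lam H z.1 z.2 ^ 2 ∂(lam.prod lam) ≤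
      4 * ∫ z, H z.1 z.2 ^ 2 ∂(lam.prod lam) := by
  have hp := memLp_kernelProj hH hH2
  have i1 : Integrable (fun z : 𝒳 × 𝒳 => H z.1 z.2 ^ 2) (lam.prod lam) := hH2.integrable_sq
  have i2 : Integrable (fun z : 𝒳 × 𝒳 => kernelProj lam H z.1 ^ 2) (lam.prod lam) :=
    (hp.comp_fst lam).integrable_sq
  have e2 : ∫ z, kernelProj lam H z.1 ^ 2 ∂(lam.prod lam) = ∫ x, kernelProj lam H x ^ 2 ∂lam := by
    rw [integral_fun_fst fun x => kernelProj lam H x ^ 2]; simp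
  have h := integral_sq_kernelProj_le hH hH2
  calc _ ≤ ∫ z : 𝒳 × 𝒳, (2 * H z.1 z.2 ^ 2 + 2 * kernelProj lam H z.1 ^ 2) ∂(lam.prod lam) := by
        refine integral_mono (memLp_rowKernel hH hH2).integrable_sq
          ((i1.const_mul 2).add (i2.const_mul 2)) fun z => ?_
        simp only [rowKernel]
        nlinarith [sq_nonneg (H z.1 z.2 + kernelProj lam H z.1)]
    _ ≤ _ := by
        rw [integral_add (i1.const_mul 2) (i2.const_mul 2), integral_const_mul,
          integral_const_mul, e2]
        linarith

theorem integral_sq_degenerateKernel_le (hH : Measurable (Function.uncurry H))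
    (hH2 : MemLp (Function.uncurry H) 2 (lam.prod lam)) :
    ∫ z, degenerateKernel lam H z.1 z.2 ^ 2 ∂(lam.prod lam) ≤
      16 * ∫ z, H z.1 z.2 ^ 2 ∂(lam.prod lam) := by
  have hp := memLp_kernelProj hH hH2
  have i1 : Integrable (fun z : 𝒳 × 𝒳 => H z.1 z.2 ^ 2) (lam.prod lam) := hH2.integrable_sq
  have i2 : Integrable (fun z : 𝒳 × 𝒳 => kernelProj lam H z.1 ^ 2) (lam.prod lam) :=
    (hp.comp_fst lam).integrable_sq
  have i3 : Integrable (fun z : 𝒳 × 𝒳 => kernelProj lam H z.2 ^ 2) (lam.prod lam) :=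
    (hp.comp_snd lam).integrable_sq
  have e2 : ∫ z, kernelProj lam H z.1 ^ 2 ∂(lam.prod lam) = ∫ x, kernelProj lam H x ^ 2 ∂lam := by
    rw [integral_fun_fst fun x => kernelProj lam H x ^ 2]; simp
  have e3 : ∫ z, kernelProj lam H z.2 ^ 2 ∂(lam.prod lam) = ∫ x, kernelProj lam H x ^ 2 ∂lam := by
    rw [integral_fun_snd fun x => kernelProj lam H x ^ 2]; simp
  have h := integral_sq_kernelProj_le hH hH2
  have hθ := sq_integral_le_integral_sq hp
  set θ := ∫ x, kernelProj lam H x ∂lam with hθd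
  have i12 : Integrable (fun z : 𝒳 × 𝒳 => 4 * H z.1 z.2 ^ 2 + 4 * kernelProj lam H z.1 ^ 2)
      (lam.prod lam) := (i1.const_mul 4).add (i2.const_mul 4)
  have i123 : Integrable (fun z : 𝒳 × 𝒳 => 4 * H z.1 z.2 ^ 2 + 4 * kernelProj lam H z.1 ^ 2 +
      4 * kernelProj lam H z.2 ^ 2) (lam.prod lam) := i12.add (i3.const_mul 4)
  calc _ ≤ ∫ z : 𝒳 × 𝒳, (4 * H z.1 z.2 ^ 2 + 4 * kernelProj lam H z.1 ^ 2 +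
          4 * kernelProj lam H z.2 ^ 2 + 4 * θ ^ 2) ∂(lam.prod lam) := by
        refine integral_mono (memLp_degenerateKernel hH hH2).integrable_sq
          (i123.add (integrable_const _)) fun z => ?_
        simp only [degenerateKernel, ← hθd]
        set a := H z.1 z.2
        set b := kernelProj lam H z.1
        set c := kernelProj lam H z.2
        nlinarith [sq_nonneg (a + b), sq_nonneg (a + c), sq_nonneg (a - θ), sq_nonneg (b - c),
          sq_nonneg (b + θ), sq_nonneg (c + θ)]
    _ ≤ _ := by
        rw [integral_add i123 (integrable_const _), integral_add i12 (i3.const_mul 4),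
          integral_add (i1.const_mul 4) (i2.const_mul 4), integral_const_mul, integral_const_mul,
          integral_const_mul, e2, e3]
        simp only [integral_const, probReal_univ, smul_eq_mul, one_mul]
        linarith

end Projection

/-! ### Asymptotics of `U`-statistics with varying kernels -/

section Asymptotics

/-- The sum `∑_{j ≠ i} H(x_i, x_j)` over a sample of size `n`. -/
noncomputable def rowSum {𝒳 : Type*} (H : 𝒳 → 𝒳 → ℝ) (n : ℕ) (x : ℕ → 𝒳) (i : ℕ) : ℝ :=
  ∑ j ∈ (Finset.range n).erase i, H (x i) (x j)

/-- The `U`-statistic with kernel `H` of a sample of size `n`. -/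
noncomputable def uStat {𝒳 : Type*} (H : 𝒳 → 𝒳 → ℝ) (n : ℕ) (x : ℕ → 𝒳) : ℝ :=
  ((n : ℝ) * ((n : ℝ) - 1))⁻¹ * ∑ i ∈ Finset.range n, rowSum H n x i

/-- The empirical variance of the normalized row sums. -/
noncomputable def rowVar {𝒳 : Type*} (H : 𝒳 → 𝒳 → ℝ) (n : ℕ) (x : ℕ → 𝒳) : ℝ :=
  (n : ℝ)⁻¹ * ∑ i ∈ Finset.range n, (((n : ℝ) - 1)⁻¹ * rowSum H n x i - uStat H n x) ^ 2

theorem abs_sum_le_sqrt_card_mul {ι : Type*} (s : Finset ι) (e : ι → ℝ) :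
    |∑ i ∈ s, e i| ≤ √(s.card * ∑ i ∈ s, e i ^ 2) := by
  refine Real.abs_le_sqrt ?_
  exact sq_sum_le_card_mul_sum_sq

theorem uStat_eq_mean {𝒳 : Type*} (H : 𝒳 → 𝒳 → ℝ) (n : ℕ) (x : ℕ → 𝒳) :
    uStat H n x = (n : ℝ)⁻¹ * ∑ i ∈ Finset.range n, ((n : ℝ) - 1)⁻¹ * rowSum H n x i := by
  rw [uStat, mul_inv, mul_assoc, ← Finset.mul_sum]

theorem empiricalVar_eq {n : ℕ} (hn : 0 < n) (b : ℕ → ℝ) :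
    (n : ℝ)⁻¹ * ∑ i ∈ Finset.range n, (b i - (n : ℝ)⁻¹ * ∑ j ∈ Finset.range n, b j) ^ 2 =
      (n : ℝ)⁻¹ * ∑ i ∈ Finset.range n, b i ^ 2 -
        ((n : ℝ)⁻¹ * ∑ j ∈ Finset.range n, b j) ^ 2 := by
  have hn0 : (0 : ℝ) < n := by exact_mod_cast hn
  set m := (n : ℝ)⁻¹ * ∑ j ∈ Finset.range n, b j with hm
  have hs : ∑ j ∈ Finset.range n, b j = n * m := by rw [hm]; field_simp
  have : ∀ i, (b i - m) ^ 2 = b i ^ 2 - 2 * m * b i + m ^ 2 := fun i => by ring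
  simp_rw [this, Finset.sum_add_distrib, Finset.sum_sub_distrib, ← Finset.mul_sum, hs]
  simp
  field_simp
  ring

/-- Perturbation of the empirical variance. -/
theorem abs_empiricalVar_sub_le {n : ℕ} (hn : 0 < n) {a g : ℕ → ℝ} {B : ℝ} (hB : ∀ i, |g i| ≤ B) :
    |(n : ℝ)⁻¹ * ∑ i ∈ Finset.range n, (a i - (n : ℝ)⁻¹ * ∑ j ∈ Finset.range n, a j) ^ 2 -
      (n : ℝ)⁻¹ * ∑ i ∈ Finset.range n, (g i - (n : ℝ)⁻¹ * ∑ j ∈ Finset.range n, g j) ^ 2| ≤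
      2 * ((n : ℝ)⁻¹ * ∑ i ∈ Finset.range n, (a i - g i) ^ 2) +
        4 * B * √((n : ℝ)⁻¹ * ∑ i ∈ Finset.range n, (a i - g i) ^ 2) := by
  have hn0 : (0 : ℝ) < n := by exact_mod_cast hn
  have hB0 : 0 ≤ B := (abs_nonneg _).trans (hB 0)
  set e : ℕ → ℝ := fun i => a i - g i with he
  have hae : ∀ i, a i = g i + e i := fun i => by simp [he]
  set Q := (n : ℝ)⁻¹ * ∑ i ∈ Finset.range n, (a i - g i) ^ 2 with hQ
  have hQ0 : 0 ≤ Q := by positivity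
  have habs : (n : ℝ)⁻¹ * ∑ i ∈ Finset.range n, |e i| ≤ √Q := by
    have h1 := abs_sum_le_sqrt_card_mul (Finset.range n) fun i => |e i|
    rw [abs_of_nonneg (Finset.sum_nonneg fun i _ => abs_nonneg _), Finset.card_range] at h1
    simp only [sq_abs] at h1
    have h2 : (n : ℝ) * ∑ i ∈ Finset.range n, e i ^ 2 = (n : ℝ) ^ 2 * Q := by
      rw [hQ]; field_simp; rfl
    rw [h2, Real.sqrt_mul (by positivity), Real.sqrt_sq hn0.le] at h1
    rw [inv_mul_le_iff₀ hn0]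
    exact h1
  set E := (n : ℝ)⁻¹ * ∑ i ∈ Finset.range n, e i with hE
  set G := (n : ℝ)⁻¹ * ∑ i ∈ Finset.range n, g i with hG
  have hEabs : |E| ≤ √Q := by
    refine le_trans ?_ habs
    rw [hE, abs_mul, abs_of_pos (inv_pos.2 hn0)]
    gcongr
    exact Finset.abs_sum_le_sum_abs _ _
  have hGabs : |G| ≤ B := by
    rw [hG, abs_mul, abs_of_pos (inv_pos.2 hn0), inv_mul_le_iff₀ hn0]
    refine (Finset.abs_sum_le_sum_abs _ _).trans ?_
    refine (Finset.sum_le_sum fun i _ => hB i).trans ?_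
    simp
  have hC : |(n : ℝ)⁻¹ * ∑ i ∈ Finset.range n, g i * e i| ≤ B * √Q := by
    rw [abs_mul, abs_of_pos (inv_pos.2 hn0)]
    calc _ ≤ (n : ℝ)⁻¹ * ∑ i ∈ Finset.range n, B * |e i| := by
          gcongr
          refine (Finset.abs_sum_le_sum_abs _ _).trans (Finset.sum_le_sum fun i _ => ?_)
          rw [abs_mul]
          gcongr
          exact hB i
      _ = B * ((n : ℝ)⁻¹ * ∑ i ∈ Finset.range n, |e i|) := by rw [← Finset.mul_sum]; ring
      _ ≤ _ := by gcongr
  have hA : (n : ℝ)⁻¹ * ∑ j ∈ Finset.range n, a j = G + E := by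
    simp_rw [hae, Finset.sum_add_distrib, hG, hE]; ring
  have hA2 : (n : ℝ)⁻¹ * ∑ j ∈ Finset.range n, a j ^ 2 =
      (n : ℝ)⁻¹ * ∑ i ∈ Finset.range n, g i ^ 2 +
        2 * ((n : ℝ)⁻¹ * ∑ i ∈ Finset.range n, g i * e i) + Q := by
    have : ∀ i, a i ^ 2 = g i ^ 2 + 2 * (g i * e i) + (a i - g i) ^ 2 := fun i => by
      rw [hae]; ring
    simp_rw [hQ]
    rw [Finset.sum_congr rfl fun i _ => this i]
    simp_rw [Finset.sum_add_distrib, ← Finset.mul_sum]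
    ring
  rw [empiricalVar_eq hn, empiricalVar_eq hn, hA, hA2]
  have hE2 : E ^ 2 ≤ Q := by
    rw [← Real.sq_sqrt hQ0, ← sq_abs E]
    exact pow_le_pow_left₀ (abs_nonneg _) hEabs 2
  have hGE : |G * E| ≤ B * √Q := by
    rw [abs_mul]; gcongr
  rw [abs_le] at *
  constructor <;> nlinarith [sq_nonneg E]

variable {Ω 𝒳 : Type*} [MeasurableSpace Ω] [MeasurableSpace 𝒳] {P : Measure Ω}
  [IsProbabilityMeasure P] {lam : Measure 𝒳} [IsProbabilityMeasure lam] {X : ℕ → Ω → 𝒳}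
  {H : ℕ → 𝒳 → 𝒳 → ℝ} {g : 𝒳 → ℝ}

/-- The weak law of large numbers. -/
theorem tendstoInMeasure_mean (hX : ∀ i, Measurable (X i)) (hind : iIndepFun X P)
    (hlaw : ∀ i, P.map (X i) = lam) {φ : 𝒳 → ℝ} (hφ : Measurable φ) (hφ2 : MemLp φ 2 lam) :
    TendstoInMeasure P (fun (n : ℕ) ω => (n : ℝ)⁻¹ * ∑ i ∈ Finset.range n, φ (X i ω)) atTop
      fun _ => ∫ x, φ x ∂lam := by
  set m := ∫ x, φ x ∂lam with hm
  have hr2 : MemLp (fun x => φ x - m) 2 lam := hφ2.sub (memLp_const m)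
  have hr0 : ∫ x, (φ x - m) ∂lam = 0 := by
    rw [integral_sub (hφ2.integrable (by norm_num)) (integrable_const _)]; simp [hm]
  have hsum := integral_sq_sum_centred hX hind hlaw (hφ.sub_const m) hr2 hr0
  have hmem : ∀ i, MemLp (fun ω => φ (X i ω) - m) 2 P := fun i =>
    MemLp.comp_of_map (g := fun x => φ x - m) (by rwa [hlaw i]) (hX i).aemeasurable
  have h0 : TendstoInMeasure P (fun (n : ℕ) ω => (n : ℝ)⁻¹ * ∑ i ∈ Finset.range n, (φ (X i ω) - m))
      atTop fun _ => 0 := by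
    refine tendstoInMeasure_zero_of_sq (b := fun n : ℕ => (∫ x, (φ x - m) ^ 2 ∂lam) / n)
      (Eventually.of_forall fun n => ?_) ?_ (tendsto_const_div_atTop_nhds_zero_nat _)
    · exact ((memLp_finsetSum (Finset.range n) fun i _ => hmem i).const_mul _).integrable_sq
    · filter_upwards [eventually_gt_atTop 0] with n hn
      have hn0 : (0 : ℝ) < n := by exact_mod_cast hn
      simp_rw [mul_pow]
      rw [integral_const_mul, hsum, Finset.card_range]
      apply le_of_eq
      field_simp
  have := tendstoInMeasure_comp₂ h0 (tendstoInMeasure_const_seq (tendsto_const_nhds (x := m)))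
    (ψ := fun q => q.1 + q.2) (by fun_prop)
  rw [zero_add] at this
  refine this.congr' ?_ (ae_eq_refl _)
  filter_upwards [eventually_gt_atTop 0] with n hn
  have hn0 : (0 : ℝ) < n := by exact_mod_cast hn
  refine Eventually.of_forall fun ω => ?_
  simp only [Finset.sum_sub_distrib, Finset.sum_const, Finset.card_range, nsmul_eq_mul]
  field_simp
  ring

/-- The kernels `H n` are asymptotically equivalent, as far as `U`-statistics of samples of size
`n` from `lam` are concerned, to the bounded function `g`: the projections converge to `g` in
`L²`, and the second moments are `o(n)`. -/
structure KernelLimit (lam : Measure 𝒳) (H : ℕ → 𝒳 → 𝒳 → ℝ) (g : 𝒳 → ℝ) : Prop where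
  measurable : ∀ n, Measurable (Function.uncurry (H n))
  symm : ∀ n x y, H n x y = H n y x
  integrable : ∀ n x, Integrable (H n x) lam
  memLp : ∀ n, MemLp (Function.uncurry (H n)) 2 (lam.prod lam)
  measurable_limit : Measurable g
  bounded : ∃ B, ∀ x, |g x| ≤ B
  second_moment : Tendsto (fun n : ℕ => (∫ z, H n z.1 z.2 ^ 2 ∂(lam.prod lam)) / n) atTop (𝓝 0)
  proj : Tendsto (fun n => ∫ x, (kernelProj lam (H n) x - g x) ^ 2 ∂lam) atTop (𝓝 0)

namespace KernelLimit

theorem memLp_limit (h : KernelLimit lam H g) : MemLp g 2 lam := by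
  obtain ⟨B, hB⟩ := h.bounded
  exact MemLp.of_bound h.measurable_limit.aestronglyMeasurable B (Eventually.of_forall hB)

theorem tendsto_second_moment_div_sub_one (h : KernelLimit lam H g) :
    Tendsto (fun n : ℕ => (∫ z, H n z.1 z.2 ^ 2 ∂(lam.prod lam)) / ((n : ℝ) - 1)) atTop (𝓝 0) := by
  have h1 : Tendsto (fun n : ℕ => (n : ℝ) / ((n : ℝ) - 1)) atTop (𝓝 1) := by
    have := tendsto_natCast_div_add_atTop (-1 : ℝ)
    simpa [sub_eq_add_neg] using this
  have h2 := h.second_moment.mul h1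
  rw [zero_mul] at h2
  refine h2.congr' ?_
  filter_upwards [eventually_gt_atTop 0] with n hn
  have : (n : ℝ) ≠ 0 := by positivity
  rw [div_mul_div_comm, mul_comm (n : ℝ), mul_div_mul_right _ _ this]

/-- The normalized row sums approximate `g(X_i)`, in mean square. -/
theorem tendstoInMeasure_rowError (h : KernelLimit lam H g) (hX : ∀ i, Measurable (X i))
    (hind : iIndepFun X P) (hlaw : ∀ i, P.map (X i) = lam) :
    TendstoInMeasure P (fun (n : ℕ) ω => (n : ℝ)⁻¹ * ∑ i ∈ Finset.range n,
      (((n : ℝ) - 1)⁻¹ * rowSum (H n) n (fun i => X i ω) i - g (X i ω)) ^ 2) atTop fun _ => 0 := by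
  have hm : ∀ (n : ℕ) i, MemLp (fun ω =>
      ((n : ℝ) - 1)⁻¹ * rowSum (H n) n (fun i => X i ω) i - g (X i ω)) 2 P := by
    intro n i
    refine MemLp.sub ?_ (MemLp.comp_of_map (by rw [hlaw i]; exact h.memLp_limit)
      (hX i).aemeasurable)
    exact (memLp_finsetSum _ fun j hj => memLp_pair hX hind hlaw
      (Finset.ne_of_mem_erase hj).symm (h.memLp n)).const_mul _
  set b : ℕ → ℝ := fun n => 8 * ((∫ z, H n z.1 z.2 ^ 2 ∂(lam.prod lam)) / ((n : ℝ) - 1)) +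
    2 * ∫ x, (kernelProj lam (H n) x - g x) ^ 2 ∂lam with hb
  have hb0 : Tendsto b atTop (𝓝 0) := by
    simpa using (h.tendsto_second_moment_div_sub_one.const_mul 8).add (h.proj.const_mul 2)
  have hrow : ∀ n, 2 ≤ n → ∀ i ∈ Finset.range n,
      ∫ ω, (((n : ℝ) - 1)⁻¹ * rowSum (H n) n (fun i => X i ω) i - g (X i ω)) ^ 2 ∂P ≤ b n := by
    intro n hn i hi
    have hn1 : (0 : ℝ) < (n : ℝ) - 1 := by
      have : (2 : ℝ) ≤ n := by exact_mod_cast hn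
      linarith
    have hcard : (((Finset.range n).erase i).card : ℝ) = (n : ℝ) - 1 := by
      rw [Finset.card_erase_of_mem hi, Finset.card_range, Nat.cast_sub (by omega), Nat.cast_one]
    have hR := integral_sq_sum_row hX hind hlaw (measurable_rowKernel (h.measurable n))
      (memLp_rowKernel (h.measurable n) (h.memLp n)) (integral_rowKernel (h.integrable n))
      (Finset.range n) i
    rw [hcard] at hR
    have hsplit : ∀ ω, ((n : ℝ) - 1)⁻¹ * rowSum (H n) n (fun i => X i ω) i - g (X i ω) =
        ((n : ℝ) - 1)⁻¹ * ∑ j ∈ (Finset.range n).erase i, rowKernel lam (H n) (X i ω) (X j ω) +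
          (kernelProj lam (H n) (X i ω) - g (X i ω)) := by
      intro ω
      simp only [rowSum, rowKernel, Finset.sum_sub_distrib, Finset.sum_const, nsmul_eq_mul, hcard]
      field_simp
      ring
    have hm1 : MemLp (fun ω => ∑ j ∈ (Finset.range n).erase i,
        rowKernel lam (H n) (X i ω) (X j ω)) 2 P :=
      memLp_finsetSum _ fun j hj => memLp_pair hX hind hlaw (Finset.ne_of_mem_erase hj).symm
        (memLp_rowKernel (h.measurable n) (h.memLp n))
    have hm2 : MemLp (fun x => kernelProj lam (H n) x - g x) 2 lam :=
      (memLp_kernelProj (h.measurable n) (h.memLp n)).sub h.memLp_limit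
    have hm3 : MemLp (fun ω => kernelProj lam (H n) (X i ω) - g (X i ω)) 2 P :=
      MemLp.comp_of_map (g := fun x => kernelProj lam (H n) x - g x) (by rwa [hlaw i])
        (hX i).aemeasurable
    have he : ∫ ω, (kernelProj lam (H n) (X i ω) - g (X i ω)) ^ 2 ∂P =
        ∫ x, (kernelProj lam (H n) x - g x) ^ 2 ∂lam := by
      rw [← hlaw i, integral_map (hX i).aemeasurable]
      rw [hlaw i]
      exact hm2.integrable_sq.aestronglyMeasurable
    calc _ ≤ ∫ ω, (2 * ((((n : ℝ) - 1)⁻¹) ^ 2 * (∑ j ∈ (Finset.range n).erase i,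
            rowKernel lam (H n) (X i ω) (X j ω)) ^ 2) +
            2 * (kernelProj lam (H n) (X i ω) - g (X i ω)) ^ 2) ∂P := by
          refine integral_mono (hm n i).integrable_sq
            (((hm1.integrable_sq.const_mul _).const_mul 2).add (hm3.integrable_sq.const_mul 2))
            fun ω => ?_
          simp only [hsplit]
          rw [← mul_pow]
          nlinarith [sq_nonneg (((n : ℝ) - 1)⁻¹ * ∑ j ∈ (Finset.range n).erase i,
            rowKernel lam (H n) (X i ω) (X j ω) - (kernelProj lam (H n) (X i ω) - g (X i ω)))]
      _ ≤ _ := by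
          rw [integral_add ((hm1.integrable_sq.const_mul _).const_mul 2)
            (hm3.integrable_sq.const_mul 2), integral_const_mul, integral_const_mul,
            integral_const_mul, hR, he, hb]
          have hle := integral_sq_rowKernel_le (h.measurable n) (h.memLp n)
          have : (((n : ℝ) - 1)⁻¹) ^ 2 * (((n : ℝ) - 1) *
              ∫ z, rowKernel lam (H n) z.1 z.2 ^ 2 ∂(lam.prod lam)) =
              (∫ z, rowKernel lam (H n) z.1 z.2 ^ 2 ∂(lam.prod lam)) / ((n : ℝ) - 1) := by
            field_simp
          rw [this]
          have h4 : (∫ z, rowKernel lam (H n) z.1 z.2 ^ 2 ∂(lam.prod lam)) / ((n : ℝ) - 1) ≤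
              (4 * ∫ z, H n z.1 z.2 ^ 2 ∂(lam.prod lam)) / ((n : ℝ) - 1) := by gcongr
          rw [mul_div_assoc] at h4
          simp only
          linarith
  have hQ : ∀ n : ℕ, Integrable (fun ω => (n : ℝ)⁻¹ * ∑ i ∈ Finset.range n,
      (((n : ℝ) - 1)⁻¹ * rowSum (H n) n (fun i => X i ω) i - g (X i ω)) ^ 2) P := fun n =>
    (integrable_finsetSum _ fun i _ => (hm n i).integrable_sq).const_mul _
  have hnn : ∀ (n : ℕ) ω, 0 ≤ (n : ℝ)⁻¹ * ∑ i ∈ Finset.range n,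
      (((n : ℝ) - 1)⁻¹ * rowSum (H n) n (fun i => X i ω) i - g (X i ω)) ^ 2 := fun n ω => by
    positivity
  -- Markov's inequality is applied to the square root.
  have hsqrt := tendstoInMeasure_zero_of_sq (P := P) (b := b) (T := fun (n : ℕ) ω =>
    √((n : ℝ)⁻¹ * ∑ i ∈ Finset.range n,
      (((n : ℝ) - 1)⁻¹ * rowSum (H n) n (fun i => X i ω) i - g (X i ω)) ^ 2))
    (Eventually.of_forall fun n => by
      simp_rw [Real.sq_sqrt (hnn n _)]
      exact hQ n) (by
      filter_upwards [eventually_ge_atTop 2] with n hn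
      simp_rw [Real.sq_sqrt (hnn n _)]
      have hn0 : (0 : ℝ) < n := by positivity
      rw [integral_const_mul, integral_finsetSum _ fun i _ => (hm n i).integrable_sq,
        inv_mul_le_iff₀ hn0]
      refine (Finset.sum_le_sum (hrow n hn)).trans ?_
      simp) hb0
  have := tendstoInMeasure_comp₂ hsqrt hsqrt (ψ := fun q => q.1 ^ 2) (by fun_prop)
  simp_rw [Real.sq_sqrt (hnn _ _)] at this
  simpa using this

/-- Consistency of the `U`-statistic. -/
theorem tendstoInMeasure_uStat (h : KernelLimit lam H g) (hX : ∀ i, Measurable (X i))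
    (hind : iIndepFun X P) (hlaw : ∀ i, P.map (X i) = lam) :
    TendstoInMeasure P (fun n ω => uStat (H n) n fun i => X i ω) atTop
      fun _ => ∫ x, g x ∂lam := by
  have hQ := h.tendstoInMeasure_rowError hX hind hlaw
  have hC := tendstoInMeasure_comp₂ hQ hQ (ψ := fun q => √q.1) (by fun_prop)
  rw [Real.sqrt_zero] at hC
  refine tendstoInMeasure_of_abs_sub_le
    (tendstoInMeasure_mean hX hind hlaw h.measurable_limit h.memLp_limit) hC ?_
  filter_upwards [eventually_gt_atTop 0] with n hn ω
  have hn0 : (0 : ℝ) < n := by exact_mod_cast hn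
  rw [uStat_eq_mean, ← mul_sub, ← Finset.sum_sub_distrib, abs_mul, abs_of_pos (inv_pos.2 hn0)]
  have h1 := abs_sum_le_sqrt_card_mul (Finset.range n)
    fun i => ((n : ℝ) - 1)⁻¹ * rowSum (H n) n (fun i => X i ω) i - g (X i ω)
  rw [Finset.card_range] at h1
  rw [inv_mul_le_iff₀ hn0]
  refine h1.trans (le_of_eq ?_)
  rw [← Real.sqrt_sq hn0.le, ← Real.sqrt_mul (by positivity), Real.sqrt_sq hn0.le]
  congr 1
  field_simp

/-- Consistency of the jackknife variance. -/
theorem tendstoInMeasure_rowVar (h : KernelLimit lam H g) (hX : ∀ i, Measurable (X i))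
    (hind : iIndepFun X P) (hlaw : ∀ i, P.map (X i) = lam) :
    TendstoInMeasure P (fun n ω => rowVar (H n) n fun i => X i ω) atTop fun _ => Var[g; lam] := by
  obtain ⟨B, hB⟩ := h.bounded
  have hg2 : MemLp (fun x => g x ^ 2) 2 lam :=
    MemLp.of_bound (h.measurable_limit.pow_const 2).aestronglyMeasurable (B ^ 2)
      (Eventually.of_forall fun x => by
        rw [norm_pow]; exact pow_le_pow_left₀ (norm_nonneg _) (hB x) 2)
  have hV := tendstoInMeasure_comp₂
    (tendstoInMeasure_mean hX hind hlaw (h.measurable_limit.pow_const 2) hg2)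
    (tendstoInMeasure_mean hX hind hlaw h.measurable_limit h.memLp_limit)
    (ψ := fun q => q.1 - q.2 ^ 2) (by fun_prop)
  have hQ := h.tendstoInMeasure_rowError hX hind hlaw
  have hC := tendstoInMeasure_comp₂ hQ hQ (ψ := fun q => 2 * q.1 + 4 * B * √q.2) (by fun_prop)
  have hvar : ∫ x, g x ^ 2 ∂lam - (∫ x, g x ∂lam) ^ 2 = Var[g; lam] := by
    rw [variance_eq_sub h.memLp_limit]; rfl
  simp only [hvar] at hV
  simp only [mul_zero, Real.sqrt_zero, add_zero] at hC
  refine tendstoInMeasure_of_abs_sub_le hV hC ?_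
  filter_upwards [eventually_gt_atTop 0] with n hn ω
  rw [rowVar, uStat_eq_mean, ← empiricalVar_eq hn fun i => g (X i ω)]
  exact abs_empiricalVar_sub_le hn fun i => hB (X i ω)

/-- Hoeffding's decomposition of the `U`-statistic. -/
theorem uStat_sub_eq {n : ℕ} (hn : 2 ≤ n) (H : 𝒳 → 𝒳 → ℝ) (x : ℕ → 𝒳) :
    uStat H n x - ∫ x, kernelProj lam H x ∂lam =
      2 * (n : ℝ)⁻¹ * ∑ i ∈ Finset.range n, (kernelProj lam H (x i) - ∫ x, kernelProj lam H x ∂lam)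
        + ((n : ℝ) * ((n : ℝ) - 1))⁻¹ * ∑ i ∈ Finset.range n, ∑ j ∈ (Finset.range n).erase i,
          degenerateKernel lam H (x i) (x j) := by
  have hn2 : (2 : ℝ) ≤ n := by exact_mod_cast hn
  have hn1 : (n : ℝ) - 1 ≠ 0 := by linarith
  set θ := ∫ x, kernelProj lam H x ∂lam with hθ
  have hcard : ∀ i ∈ Finset.range n, (((Finset.range n).erase i).card : ℝ) = (n : ℝ) - 1 := by
    intro i hi
    rw [Finset.card_erase_of_mem hi, Finset.card_range, Nat.cast_sub (by omega), Nat.cast_one]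
  have hswap : ∑ i ∈ Finset.range n, ∑ j ∈ (Finset.range n).erase i, kernelProj lam H (x j) =
      ∑ i ∈ Finset.range n, ((n : ℝ) - 1) * kernelProj lam H (x i) := by
    have : ∀ i ∈ Finset.range n, ∑ j ∈ (Finset.range n).erase i, kernelProj lam H (x j) =
        ∑ j ∈ Finset.range n, kernelProj lam H (x j) - kernelProj lam H (x i) := fun i hi => by
      rw [← Finset.sum_erase_add _ _ hi]; ring
    rw [Finset.sum_congr rfl this, Finset.sum_sub_distrib, Finset.sum_const, Finset.card_range,
      nsmul_eq_mul, ← Finset.mul_sum]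
    ring
  have hrow : ∀ i ∈ Finset.range n, ∑ j ∈ (Finset.range n).erase i,
      degenerateKernel lam H (x i) (x j) = rowSum H n x i - ((n : ℝ) - 1) * kernelProj lam H (x i)
        - ∑ j ∈ (Finset.range n).erase i, kernelProj lam H (x j) + ((n : ℝ) - 1) * θ := by
    intro i hi
    simp only [degenerateKernel, Finset.sum_add_distrib, Finset.sum_sub_distrib, Finset.sum_const,
      nsmul_eq_mul, hcard i hi, rowSum, ← hθ]
  rw [Finset.sum_congr rfl hrow, Finset.sum_add_distrib, Finset.sum_sub_distrib,
    Finset.sum_sub_distrib, hswap, uStat]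
  simp only [Finset.sum_sub_distrib, Finset.sum_const, Finset.card_range, nsmul_eq_mul,
    ← Finset.mul_sum]
  field_simp
  ring

/-- The degenerate part of the `U`-statistic is negligible. -/
theorem tendstoInMeasure_degenerate (h : KernelLimit lam H g) (hX : ∀ i, Measurable (X i))
    (hind : iIndepFun X P) (hlaw : ∀ i, P.map (X i) = lam) :
    TendstoInMeasure P (fun (n : ℕ) ω => √(n : ℝ) * (((n : ℝ) * ((n : ℝ) - 1))⁻¹ *
      ∑ i ∈ Finset.range n, ∑ j ∈ (Finset.range n).erase i,
        degenerateKernel lam (H n) (X i ω) (X j ω))) atTop fun _ => 0 := by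
  have hm : ∀ n : ℕ, MemLp (fun ω => ∑ i ∈ Finset.range n, ∑ j ∈ (Finset.range n).erase i,
      degenerateKernel lam (H n) (X i ω) (X j ω)) 2 P := fun n =>
    memLp_finsetSum _ fun i _ => memLp_finsetSum _ fun j hj =>
      memLp_pair hX hind hlaw (Finset.ne_of_mem_erase hj).symm
        (memLp_degenerateKernel (h.measurable n) (h.memLp n))
  have hlim := h.tendsto_second_moment_div_sub_one.const_mul 32
  rw [mul_zero] at hlim
  refine tendstoInMeasure_zero_of_sq (Eventually.of_forall fun n => ?_) ?_ hlim
  · simp_rw [mul_pow]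
    exact ((hm n).integrable_sq.const_mul _).const_mul _
  · filter_upwards [eventually_ge_atTop 2] with n hn
    have hn2 : (2 : ℝ) ≤ n := by exact_mod_cast hn
    have hn1 : (0 : ℝ) < (n : ℝ) - 1 := by linarith
    have hsymm : ∀ x y, degenerateKernel lam (H n) x y = degenerateKernel lam (H n) y x := by
      intro x y
      simp only [degenerateKernel, h.symm n x y]; ring
    simp_rw [mul_pow]
    rw [integral_const_mul, integral_const_mul, integral_sq_sum_degenerate hX hind hlaw
      (measurable_degenerateKernel (h.measurable n))
      (memLp_degenerateKernel (h.measurable n) (h.memLp n)) hsymm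
      (integral_degenerateKernel (h.measurable n) (h.memLp n) (h.integrable n)),
      Finset.card_range, Real.sq_sqrt (by positivity)]
    have hle := integral_sq_degenerateKernel_le (h.measurable n) (h.memLp n)
    calc _ = 2 / ((n : ℝ) - 1) *
          ∫ z, degenerateKernel lam (H n) z.1 z.2 ^ 2 ∂(lam.prod lam) := by field_simp
      _ ≤ 2 / ((n : ℝ) - 1) * (16 * ∫ z, H n z.1 z.2 ^ 2 ∂(lam.prod lam)) := by gcongr
      _ = _ := by ring

/-- The `U`-statistic is asymptotically a normalized sum of the limits of its projections. -/
theorem tendstoInMeasure_linearization (h : KernelLimit lam H g) (hX : ∀ i, Measurable (X i))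
    (hind : iIndepFun X P) (hlaw : ∀ i, P.map (X i) = lam) :
    TendstoInMeasure P (fun (n : ℕ) ω =>
      √(n : ℝ) * (uStat (H n) n (fun i => X i ω) - ∫ x, kernelProj lam (H n) x ∂lam) -
        2 * ((√(n : ℝ))⁻¹ * (∑ i ∈ Finset.range n, g (X i ω) - n * ∫ x, g x ∂lam))) atTop
      fun _ => 0 := by
  have hgi := h.memLp_limit.integrable (q := 2) (by norm_num)
  set r : ℕ → 𝒳 → ℝ := fun n x => (kernelProj lam (H n) x - g x) -
    (∫ x, kernelProj lam (H n) x ∂lam - ∫ x, g x ∂lam) with hr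
  have hrm : ∀ n, Measurable (r n) := fun n =>
    ((measurable_kernelProj (h.measurable n)).sub h.measurable_limit).sub_const _
  have hp2 : ∀ n, MemLp (fun x => kernelProj lam (H n) x - g x) 2 lam := fun n =>
    (memLp_kernelProj (h.measurable n) (h.memLp n)).sub h.memLp_limit
  have hr2 : ∀ n, MemLp (r n) 2 lam := fun n => (hp2 n).sub (memLp_const _)
  have hpi : ∀ n, ∫ x, (kernelProj lam (H n) x - g x) ∂lam =
      ∫ x, kernelProj lam (H n) x ∂lam - ∫ x, g x ∂lam := fun n =>
    integral_sub ((memLp_kernelProj (h.measurable n) (h.memLp n)).integrable (by norm_num)) hgi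
  have hr0 : ∀ n, ∫ x, r n x ∂lam = 0 := fun n => by
    simp only [hr]
    rw [integral_sub ((hp2 n).integrable (by norm_num)) (integrable_const _), hpi]
    simp
  have hrle : ∀ n, ∫ x, r n x ^ 2 ∂lam ≤ ∫ x, (kernelProj lam (H n) x - g x) ^ 2 ∂lam := by
    intro n
    have h1 := variance_le_expectation_sq (μ := lam) (X := fun x => kernelProj lam (H n) x - g x)
      (hp2 n).aestronglyMeasurable
    rw [variance_eq_integral (hp2 n).aemeasurable, hpi] at h1
    exact h1
  have hm : ∀ n : ℕ, MemLp (fun ω => ∑ i ∈ Finset.range n, r n (X i ω)) 2 P := fun n =>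
    memLp_finsetSum _ fun i _ =>
      MemLp.comp_of_map (g := r n) (by rw [hlaw i]; exact hr2 n) (hX i).aemeasurable
  have hA : TendstoInMeasure P (fun (n : ℕ) ω => (√(n : ℝ))⁻¹ * ∑ i ∈ Finset.range n, r n (X i ω))
      atTop fun _ => 0 := by
    refine tendstoInMeasure_zero_of_sq (Eventually.of_forall fun n => ?_) ?_ h.proj
    · simp_rw [mul_pow]
      exact (hm n).integrable_sq.const_mul _
    · filter_upwards [eventually_gt_atTop 0] with n hn
      have hn0 : (0 : ℝ) < n := by exact_mod_cast hn
      simp_rw [mul_pow]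
      rw [integral_const_mul, integral_sq_sum_centred hX hind hlaw (hrm n) (hr2 n) (hr0 n),
        Finset.card_range, inv_pow, Real.sq_sqrt hn0.le, inv_mul_cancel_left₀ hn0.ne']
      exact hrle n
  have hB := h.tendstoInMeasure_degenerate hX hind hlaw
  have := tendstoInMeasure_comp₂ hA hB (ψ := fun q => 2 * q.1 + q.2) (by fun_prop)
  simp only [mul_zero, add_zero] at this
  refine this.congr' ?_ (ae_eq_refl _)
  filter_upwards [eventually_ge_atTop 2] with n hn
  refine Eventually.of_forall fun ω => ?_
  have hn2 : (2 : ℝ) ≤ n := by exact_mod_cast hn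
  have hn0 : (0 : ℝ) < n := by linarith
  have hs : √(n : ℝ) * (n : ℝ)⁻¹ = (√(n : ℝ))⁻¹ := by
    have := Real.sq_sqrt hn0.le
    have hs0 : 0 < √(n : ℝ) := Real.sqrt_pos.2 hn0
    field_simp
    exact this
  simp only
  rw [uStat_sub_eq (lam := lam) hn]
  simp only [hr, Finset.sum_sub_distrib, Finset.sum_const, Finset.card_range, nsmul_eq_mul]
  linear_combination (-2 * (∑ i ∈ Finset.range n, kernelProj lam (H n) (X i ω) -
    n * ∫ x, kernelProj lam (H n) x ∂lam)) * hs

theorem measurable_uStat (h : KernelLimit lam H g) (hX : ∀ i, Measurable (X i)) (n : ℕ) :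
    Measurable (fun ω => uStat (H n) n fun i => X i ω) := by
  unfold uStat rowSum
  refine Measurable.const_mul (Finset.measurable_sum _ fun i _ => Finset.measurable_sum _
    fun j _ => ?_) _
  exact (h.measurable n).comp ((hX i).prodMk (hX j))

/-- The rejection probability at the boundary: a normal approximation with estimated scale. -/
theorem tendsto_measureReal_le (h : KernelLimit lam H g) (hX : ∀ i, Measurable (X i))
    (hind : iIndepFun X P) (hlaw : ∀ i, P.map (X i) = lam) (hv : 0 < Var[g; lam])
    {s : ℕ → Ω → ℝ} (hs : TendstoInMeasure P s atTop fun _ => 2 * √Var[g; lam])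
    (hsm : ∀ n, Measurable (s n)) {Δ : ℝ}
    (hbias : Tendsto (fun n : ℕ => √(n : ℝ) * (∫ x, kernelProj lam (H n) x ∂lam - Δ)) atTop (𝓝 0))
    (c : ℝ) :
    Tendsto (fun n : ℕ => P.real {ω | uStat (H n) n (fun i => X i ω) ≤ Δ + c * (s n ω / √(n : ℝ))})
      atTop (𝓝 (cdf (gaussianReal 0 1) c)) := by
  set v := Var[g; lam] with hvdef
  have hsv : 0 < √v := Real.sqrt_pos.2 hv
  set Γ := gaussianReal 0 1
  have hYlaw : HasLaw (fun z : ℝ => √v * z) (gaussianReal 0 v.toNNReal) Γ := by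
    refine ⟨by fun_prop, ?_⟩
    rw [gaussianReal_map_const_mul]
    congr 1
    · simp
    · ext; simp [Real.sq_sqrt hv.le, hv.le]
  have hgX : ∀ i, MemLp (fun ω => g (X i ω)) 2 P := fun i =>
    MemLp.comp_of_map (g := g) (by rw [hlaw i]; exact h.memLp_limit) (hX i).aemeasurable
  have hid : ∀ i, IdentDistrib (fun ω => g (X i ω)) (fun ω => g (X 0 ω)) P P := fun i =>
    (IdentDistrib.mk (hX i).aemeasurable (hX 0).aemeasurable (by rw [hlaw, hlaw])).comp
      h.measurable_limit
  have hvar : Var[fun ω => g (X 0 ω); P] = v := by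
    rw [hvdef, ← hlaw 0, variance_map h.measurable_limit.aemeasurable (hX 0).aemeasurable]
    rfl
  have hmean : ∫ ω, g (X 0 ω) ∂P = ∫ x, g x ∂lam := by
    rw [← hlaw 0, integral_map (hX 0).aemeasurable h.measurable_limit.aestronglyMeasurable]
  have hclt := tendstoInDistribution_inv_sqrt_mul_sum_sub (P := P) (P' := Γ)
    (X := fun i ω => g (X i ω)) (Y := fun z : ℝ => √v * z) (by rw [hvar]; exact hYlaw) (hgX 0)
    (hind.comp (fun _ => g) fun _ => h.measurable_limit) hid
  have hclt2 := hclt.continuous_comp (g := fun x : ℝ => 2 * x) (by fun_prop)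
  -- The event is `T n ≤ 0`, and `T n` tends in law to `2 √v Z - 2 c √v` with `Z` standard normal.
  set T : ℕ → Ω → ℝ := fun n ω => √(n : ℝ) * (uStat (H n) n (fun i => X i ω) - Δ) - c * s n ω
  have hTm : ∀ n, Measurable (T n) := fun n =>
    (((h.measurable_uStat hX n).sub_const _).const_mul _).sub ((hsm n).const_mul _)
  have hA : ∀ n : ℕ, Measurable fun ω => 2 * ((√(n : ℝ))⁻¹ *
      (∑ i ∈ Finset.range n, g (X i ω) - n * ∫ x, g x ∂lam)) := fun n =>
    (((Finset.measurable_sum _ fun i _ => h.measurable_limit.comp (hX i)).sub_const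
      _).const_mul _).const_mul _
  have hrem : TendstoInMeasure P (fun (n : ℕ) ω => T n ω - 2 * ((√(n : ℝ))⁻¹ *
      (∑ i ∈ Finset.range n, g (X i ω) - n * ∫ x, g x ∂lam))) atTop fun _ => -(c * (2 * √v)) := by
    have h1 := tendstoInMeasure_comp₂ (h.tendstoInMeasure_linearization hX hind hlaw)
      (tendstoInMeasure_const_seq hbias) (ψ := fun q => q.1 + q.2) (by fun_prop)
    have h2 := tendstoInMeasure_comp₂ h1 hs (ψ := fun q => q.1 - c * q.2) (by fun_prop)
    simp only [add_zero, zero_sub] at h2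
    refine h2.congr_left fun n => Eventually.of_forall fun ω => ?_
    simp only [T]
    ring
  have hT : TendstoInDistribution T atTop (fun z : ℝ => 2 * (√v * z) + -(c * (2 * √v)))
      (fun _ => P) Γ := by
    rw [hmean] at hclt2
    refine (hclt2.add_of_tendstoInMeasure_const hrem
      (fun n => ((hTm n).sub (hA n)).aemeasurable)).congr
      (fun n => Eventually.of_forall fun ω => ?_)
      (ae_eq_refl _)
    simp
  have hset : (fun z : ℝ => 2 * (√v * z) + -(c * (2 * √v))) ⁻¹' Iic 0 = Iic c := by
    ext z
    simp only [mem_preimage, mem_Iic]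
    constructor
    · intro hz
      by_contra hc
      have : 0 < √v * (z - c) := mul_pos hsv (by linarith [not_le.1 hc])
      nlinarith
    · intro hz
      nlinarith [mul_nonneg hsv.le (sub_nonneg.2 hz)]
  have hset0 : (fun z : ℝ => 2 * (√v * z) + -(c * (2 * √v))) ⁻¹' {0} = {c} := by
    ext z
    simp only [mem_preimage, mem_singleton_iff]
    constructor
    · intro hz
      have : √v * (z - c) = 0 := by linarith
      rcases mul_eq_zero.1 this with h | h
      · exact absurd h hsv.ne'
      · linarith
    · rintro rfl; ring
  have hzm : Measurable fun z : ℝ => 2 * (√v * z) + -(c * (2 * √v)) := by fun_prop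
  have := nullSingletonClass_gaussianReal (μ := 0) (v := 1) one_ne_zero
  have hlim := ProbabilityMeasure.tendsto_measure_of_null_frontier_of_tendsto' hT.tendsto
    (E := Iic (0 : ℝ)) (by
      simp only [frontier_Iic, ProbabilityMeasure.coe_mk]
      rw [Measure.map_apply hzm (measurableSet_singleton _), hset0]
      exact measure_singleton c)
  simp only [ProbabilityMeasure.coe_mk] at hlim
  rw [Measure.map_apply hzm measurableSet_Iic, hset] at hlim
  have hlim' := (ENNReal.tendsto_toReal (measure_ne_top Γ (Iic c))).comp hlim
  rw [cdf_eq_real]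
  refine hlim'.congr' ?_
  filter_upwards [eventually_gt_atTop 0] with n hn
  have hn0 : (0 : ℝ) < n := by exact_mod_cast hn
  have hsn : 0 < √(n : ℝ) := Real.sqrt_pos.2 hn0
  simp only [Function.comp]
  rw [Measure.map_apply (hTm n) measurableSet_Iic]
  congr 2
  ext ω
  simp only [mem_preimage, mem_Iic, mem_ofPred_eq, T]
  rw [← mul_div_assoc, ← sub_le_iff_le_add', le_div_iff₀ hsn]
  constructor <;> intro h <;> linarith

end KernelLimit
end Asymptotics

/-! ### Smoothness of the density -/

/-- Second differences of a function with bounded second derivative. -/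
theorem abs_second_difference_le {φ φ' φ'' : ℝ → ℝ} {x s C : ℝ} (hs : 0 ≤ s)
    (h1 : ∀ t ∈ Icc (x - s) (x + s), HasDerivAt φ (φ' t) t)
    (h2 : ∀ t ∈ Icc (x - s) (x + s), HasDerivAt φ' (φ'' t) t)
    (hC : ∀ t ∈ Icc (x - s) (x + s), |φ'' t| ≤ C) :
    |φ (x + s) + φ (x - s) - 2 * φ x| ≤ 2 * C * s ^ 2 := by
  have hC0 : 0 ≤ C := (abs_nonneg _).trans (hC x ⟨by linarith, by linarith⟩)
  have hb : ∀ t ∈ Icc 0 s, |φ' (x + t) - φ' (x - t)| ≤ 2 * C * s := by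
    intro t ht
    have hconv := (convex_Icc (x - s) (x + s)).norm_image_sub_le_of_norm_hasDerivWithin_le
      (fun y hy => (h2 y hy).hasDerivWithinAt) (fun y hy => hC y hy)
      (show x - t ∈ Icc (x - s) (x + s) from ⟨by linarith [ht.2], by linarith [ht.1]⟩)
      (show x + t ∈ Icc (x - s) (x + s) from ⟨by linarith [ht.1], by linarith [ht.2]⟩)
    simp only [Real.norm_eq_abs] at hconv
    rw [show x + t - (x - t) = 2 * t by ring, abs_of_nonneg (by linarith [ht.1] : 0 ≤ 2 * t)]
      at hconv
    nlinarith [ht.2]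
  have hd : ∀ t ∈ Icc 0 s, HasDerivWithinAt (fun t => φ (x + t) + φ (x - t))
      (φ' (x + t) - φ' (x - t)) (Icc 0 s) t := by
    intro t ht
    have d1 := (h1 (x + t) ⟨by linarith [ht.1], by linarith [ht.2]⟩).comp_const_add x t
    have d2 := (h1 (x - t) ⟨by linarith [ht.2], by linarith [ht.1]⟩).comp_const_sub x t
    rw [sub_eq_add_neg]
    exact (d1.add d2).hasDerivWithinAt
  have := (convex_Icc 0 s).norm_image_sub_le_of_norm_hasDerivWithin_le hd hb
    (left_mem_Icc.2 hs) (right_mem_Icc.2 hs)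
  simp only [Real.norm_eq_abs, add_zero, sub_zero, abs_of_nonneg hs] at this
  rw [show φ (x + s) + φ (x - s) - 2 * φ x = φ (x + s) + φ (x - s) - (φ x + φ x) by ring]
  nlinarith

variable {p : ℕ} {f : ℝ → E p → ℝ}

theorem direction_of_mem {v : E p} (hv : v ∈ unitSphere p) : direction v = v := by
  simp [direction, mem_sphere_zero_iff_norm.1 hv]

theorem ne_zero_of_mem_unitSphere {v : E p} (hv : v ∈ unitSphere p) : v ≠ 0 := by
  rintro rfl
  simp at hv

namespace DensityAssumption

theorem isOpen_domain : IsOpen (Ioi (0 : ℝ) ×ˢ ({0}ᶜ : Set (E p))) :=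
  isOpen_Ioi.prod isOpen_compl_singleton

theorem differentiableAt (hf : DensityAssumption f) {u : ℝ} (hu : 0 < u) {y : E p} (hy : y ≠ 0) :
    DifferentiableAt ℝ (fun q : ℝ × E p => radialExt f q.1 q.2) (u, y) :=
  hf.differentiable.differentiableAt (isOpen_domain.mem_nhds ⟨hu, hy⟩)

theorem differentiableAt_fderiv (hf : DensityAssumption f) {u : ℝ} (hu : 0 < u) {y : E p}
    (hy : y ≠ 0) :
    DifferentiableAt ℝ (fderiv ℝ (fun q : ℝ × E p => radialExt f q.1 q.2)) (u, y) :=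
  hf.twice_differentiable.differentiableAt (isOpen_domain.mem_nhds ⟨hu, hy⟩)

theorem hasFDerivAt_radialExt (hf : DensityAssumption f) {u : ℝ} (hu : 0 < u) {y : E p}
    (hy : y ≠ 0) : HasFDerivAt (radialExt f u)
      ((fderiv ℝ (fun q : ℝ × E p => radialExt f q.1 q.2) (u, y)).comp
        (ContinuousLinearMap.inr ℝ ℝ (E p))) y :=
  (hf.differentiableAt hu hy).hasFDerivAt.comp y (hasFDerivAt_prodMk_right u y)

theorem differentiableAt_fderiv_radialExt (hf : DensityAssumption f) {u : ℝ} (hu : 0 < u)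
    {y : E p} (hy : y ≠ 0) : DifferentiableAt ℝ (fderiv ℝ (radialExt f u)) y := by
  have he : fderiv ℝ (radialExt f u) =ᶠ[𝓝 y] fun z =>
      (fderiv ℝ (fun q : ℝ × E p => radialExt f q.1 q.2) (u, z)).comp
        (ContinuousLinearMap.inr ℝ ℝ (E p)) := by
    filter_upwards [isOpen_compl_singleton.mem_nhds hy] with z hz
    exact (hf.hasFDerivAt_radialExt hu hz).fderiv
  refine DifferentiableAt.congr_of_eventuallyEq ?_ he
  have h1 : DifferentiableAt ℝ (fun z : E p =>
      fderiv ℝ (fun q : ℝ × E p => radialExt f q.1 q.2) (u, z)) y :=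
    (hf.differentiableAt_fderiv hu hy).comp y
      (hasFDerivAt_prodMk_right u y).differentiableAt
  exact h1.clm_comp (differentiableAt_const _)

theorem hasDerivAt_radial (hf : DensityAssumption f) {u : ℝ} (hu : 0 < u) {v : E p}
    (hv : v ∈ unitSphere p) : HasDerivAt (fun r => f r v)
      (fderiv ℝ (fun q : ℝ × E p => radialExt f q.1 q.2) (u, v) (1, 0)) u := by
  have h := (hf.differentiableAt hu (ne_zero_of_mem_unitSphere hv)).hasFDerivAt.comp_hasDerivAt u
    ((hasDerivAt_id u).prodMk (hasDerivAt_const u v))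
  have e : (fun r => f r v) = (fun q : ℝ × E p => radialExt f q.1 q.2) ∘ fun r => (id r, v) := by
    funext r
    simp [radialExt, direction_of_mem hv]
  rw [e]
  exact h

theorem hasDerivAt_radD1 (hf : DensityAssumption f) {u : ℝ} (hu : 0 < u) {v : E p}
    (hv : v ∈ unitSphere p) : HasDerivAt (fun r => radD1 f r v) (radD2 f u v) u := by
  refine DifferentiableAt.hasDerivAt ?_
  have he : (fun r => radD1 f r v) =ᶠ[𝓝 u] fun r =>
      fderiv ℝ (fun q : ℝ × E p => radialExt f q.1 q.2) (r, v) (1, 0) := by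
    filter_upwards [isOpen_Ioi.mem_nhds (show u ∈ Ioi 0 from hu)] with r hr
    exact (hf.hasDerivAt_radial hr hv).deriv
  refine DifferentiableAt.congr_of_eventuallyEq ?_ he
  have h1 : DifferentiableAt ℝ (fun r : ℝ =>
      fderiv ℝ (fun q : ℝ × E p => radialExt f q.1 q.2) (r, v)) u :=
    (hf.differentiableAt_fderiv hu (ne_zero_of_mem_unitSphere hv)).comp u
      (hasFDerivAt_prodMk_left u v).differentiableAt
  exact h1.clm_apply (differentiableAt_const _)

/-- Second differences of the density along a great circle, parametrized by the angle. -/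
theorem abs_great_circle_le (hf : DensityAssumption f) {C : ℝ}
    (hC : ∀ u : ℝ, 0 < u → ∀ v ∈ unitSphere p, ‖sphD1 f u v‖ ≤ C ∧ ‖sphD2 f u v‖ ≤ C)
    {u : ℝ} (hu : 0 < u) {v ξ : E p} (hv : ‖v‖ = 1) (hξ : ‖ξ‖ = 1) (hvξ : inner ℝ v ξ = 0)
    {θ : ℝ} (hθ : 0 ≤ θ) :
    |f u (Real.cos θ • v + Real.sin θ • ξ) + f u (Real.cos θ • v - Real.sin θ • ξ) - 2 * f u v| ≤
      4 * C * θ ^ 2 := by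
  set γ : ℝ → E p := fun t => Real.cos t • v + Real.sin t • ξ with hγ
  set γ' : ℝ → E p := fun t => -Real.sin t • v + Real.cos t • ξ with hγ'
  have hnorm : ∀ a b : ℝ, a ^ 2 + b ^ 2 = 1 → ‖a • v + b • ξ‖ = 1 := by
    intro a b hab
    have : ‖a • v + b • ξ‖ ^ 2 = 1 := by
      rw [norm_add_sq_real, norm_smul, norm_smul, hv, hξ, inner_smul_left, inner_smul_right, hvξ]
      simp [hab]
    exact (pow_eq_one_iff_of_nonneg (norm_nonneg _) two_ne_zero).1 this
  have hγn : ∀ t, ‖γ t‖ = 1 := fun t => hnorm _ _ (Real.cos_sq_add_sin_sq t)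
  have hγn' : ∀ t, ‖γ' t‖ = 1 := fun t => hnorm _ _ (by rw [neg_sq]; exact Real.sin_sq_add_cos_sq t)
  have hγs : ∀ t, γ t ∈ unitSphere p := fun t => mem_sphere_zero_iff_norm.2 (hγn t)
  have dγ : ∀ t, HasDerivAt γ (γ' t) t := fun t =>
    ((Real.hasDerivAt_cos t).smul_const v).add ((Real.hasDerivAt_sin t).smul_const ξ)
  have dγ' : ∀ t, HasDerivAt γ' (-γ t) t := fun t => by
    have := ((Real.hasDerivAt_sin t).neg.smul_const v).add ((Real.hasDerivAt_cos t).smul_const ξ)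
    convert! this using 1
    simp only [hγ]
    module
  have d1 : ∀ t, HasDerivAt (fun t => radialExt f u (γ t)) (sphD1 f u (γ t) (γ' t)) t := fun t =>
    (hf.hasFDerivAt_radialExt hu (ne_zero_of_mem_unitSphere
      (hγs t))).differentiableAt.hasFDerivAt.comp_hasDerivAt t (dγ t)
  have d2 : ∀ t, HasDerivAt (fun t => sphD1 f u (γ t) (γ' t))
      (sphD2 f u (γ t) (γ' t) (γ' t) + sphD1 f u (γ t) (-γ t)) t := fun t => by
    have h1 : HasDerivAt (fun t => sphD1 f u (γ t)) (sphD2 f u (γ t) (γ' t)) t :=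
      (hf.differentiableAt_fderiv_radialExt hu (ne_zero_of_mem_unitSphere
        (hγs t))).hasFDerivAt.comp_hasDerivAt t (dγ t)
    exact h1.clm_apply (dγ' t)
  have hb : ∀ t, |sphD2 f u (γ t) (γ' t) (γ' t) + sphD1 f u (γ t) (-γ t)| ≤ 2 * C := fun t => by
    have b1 := (sphD2 f u (γ t)).le_opNorm₂ (γ' t) (γ' t)
    have b2 := (sphD1 f u (γ t)).le_opNorm (-γ t)
    rw [hγn', mul_one, mul_one, Real.norm_eq_abs] at b1
    rw [norm_neg, hγn, mul_one, Real.norm_eq_abs] at b2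
    have := hC u hu _ (hγs t)
    exact (abs_add_le _ _).trans (by linarith [this.1, this.2])
  have h := abs_second_difference_le (x := 0) hθ (fun t _ => d1 t) (fun t _ => d2 t)
    (fun t _ => hb t)
  have e : ∀ t, radialExt f u (γ t) = f u (γ t) := fun t => by
    rw [radialExt, direction_of_mem (hγs t)]
  simp only [e] at h
  simp only [hγ, zero_add, zero_sub, Real.cos_neg, Real.sin_neg, Real.cos_zero, Real.sin_zero,
    one_smul, zero_smul, add_zero, neg_smul, ← sub_eq_add_neg] at h
  linarith

end DensityAssumption

/-- The density `f`, extended by zero outside `(0,∞) × S^{p-1}`. -/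
noncomputable def extDensity (f : ℝ → E p → ℝ) (u : ℝ) (v : E p) : ℝ :=
  (Ioi (0 : ℝ) ×ˢ unitSphere p).indicator (fun q => f q.1 q.2) (u, v)

/-- What the asymptotic analysis needs to know of the polar density `F`, extended by zero: it is
bounded, Lipschitz in the radius, and has second differences of second order, both in the
radius and along great circles. The points `w` and `2 ⟪v, w⟫ v - w` are symmetric about `v` on a
great circle, and `1 - ⟪v, w⟫` is of the order of the squared angle between `v` and `w`. -/
structure RegularDensity (F : ℝ → E p → ℝ) (C : ℝ) : Prop where
  measurable : Measurable (Function.uncurry F)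
  nonneg : ∀ u v, 0 ≤ F u v
  le : ∀ u v, F u v ≤ C
  eq_zero : ∀ u ≤ 0, ∀ v, F u v = 0
  continuousOn : ContinuousOn (Function.uncurry F) (Ioi (0 : ℝ) ×ˢ unitSphere p)
  lipschitz : ∀ v ∈ unitSphere p, ∀ u > 0, ∀ u' > 0, |F u v - F u' v| ≤ C * |u - u'|
  radial : ∀ v ∈ unitSphere p, ∀ u s, |s| < u → |F (u + s) v + F (u - s) v - 2 * F u v| ≤ C * s ^ 2
  spherical : ∀ u, ∀ v ∈ unitSphere p, ∀ w ∈ unitSphere p,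
    |F u w + F u ((2 * inner ℝ v w) • v - w) - 2 * F u v| ≤ C * (1 - inner ℝ v w)

theorem extDensity_eq {u : ℝ} (hu : 0 < u) {v : E p} (hv : v ∈ unitSphere p) :
    extDensity f u v = f u v :=
  indicator_of_mem (show (u, v) ∈ Ioi (0 : ℝ) ×ˢ unitSphere p from ⟨hu, hv⟩) _

theorem extDensity_of_nonpos {u : ℝ} (hu : u ≤ 0) (v : E p) : extDensity f u v = 0 :=
  indicator_of_notMem (fun h => absurd h.1 (not_lt.2 hu)) _

theorem reflect_mem {v w : E p} (hv : v ∈ unitSphere p) (hw : w ∈ unitSphere p) :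
    (2 * inner ℝ v w) • v - w ∈ unitSphere p := by
  rw [mem_sphere_zero_iff_norm] at *
  have : ‖(2 * inner ℝ v w) • v - w‖ ^ 2 = 1 := by
    rw [norm_sub_sq_real, norm_smul, hv, hw, inner_smul_left, mul_one, Real.norm_eq_abs, sq_abs]
    simp
    ring
  exact (pow_eq_one_iff_of_nonneg (norm_nonneg _) two_ne_zero).1 this

theorem DensityAssumption.continuousOn (hf : DensityAssumption f) :
    ContinuousOn (fun q : ℝ × E p => f q.1 q.2) (Ioi (0 : ℝ) ×ˢ unitSphere p) := by
  have h : ContinuousOn (fun q : ℝ × E p => radialExt f q.1 q.2) (Ioi (0 : ℝ) ×ˢ unitSphere p) :=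
    hf.differentiable.continuousOn.mono
      (prod_mono_right fun v hv => ne_zero_of_mem_unitSphere hv)
  refine h.congr fun q hq => ?_
  simp [radialExt, direction_of_mem hq.2]

theorem DensityAssumption.regularDensity (hf : DensityAssumption f)
    (h0 : ∀ u : ℝ, 0 < u → ∀ v ∈ unitSphere p, 0 ≤ f u v) :
    ∃ C, 0 < C ∧ RegularDensity (extDensity f) C := by
  obtain ⟨C₀, hC₀⟩ := hf.bounded
  set C := |C₀| + 1 with hCdef
  have hCpos : 0 < C := by positivity
  have hC : ∀ u : ℝ, 0 < u → ∀ v ∈ unitSphere p,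
      |f u v| ≤ C ∧ |radD1 f u v| ≤ C ∧ |radD2 f u v| ≤ C ∧ ‖sphD1 f u v‖ ≤ C ∧
        ‖sphD2 f u v‖ ≤ C := fun u hu v hv => by
    have := hC₀ u hu v hv
    have hle : C₀ ≤ C := (le_abs_self C₀).trans (by linarith)
    exact ⟨this.1.trans hle, this.2.1.trans hle, this.2.2.1.trans hle, this.2.2.2.1.trans hle,
      this.2.2.2.2.trans hle⟩
  -- The factor `2 π²` comes from `2 θ² / π² ≤ 1 - cos θ`, which turns a bound in terms of the angle
  -- into one in terms of the inner product.
  have hpi : 9 < Real.pi ^ 2 := by nlinarith [Real.pi_gt_three]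
  have hCC : C ≤ 2 * Real.pi ^ 2 * C := by nlinarith
  have hS : MeasurableSet (Ioi (0 : ℝ) ×ˢ unitSphere p) :=
    measurableSet_Ioi.prod Metric.isClosed_sphere.measurableSet
  refine ⟨2 * Real.pi ^ 2 * C, by positivity, ?_, ?_, ?_, ?_, ?_, ?_, ?_, ?_⟩
  · have : Function.uncurry (extDensity f) =
        (Ioi (0 : ℝ) ×ˢ unitSphere p).indicator (fun q => f q.1 q.2) := rfl
    classical
    rw [this, ← piecewise_eq_indicator]
    exact hf.continuousOn.measurable_piecewise continuousOn_const hS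
  · intro u v
    exact indicator_nonneg (fun q hq => h0 q.1 hq.1 q.2 hq.2) _
  · intro u v
    unfold extDensity
    refine indicator_apply_le' (fun hq => ?_) (fun _ => by positivity)
    exact (le_abs_self _).trans ((hC u hq.1 v hq.2).1.trans hCC)
  · intro u hu v
    exact extDensity_of_nonpos hu v
  · exact hf.continuousOn.congr fun q hq => extDensity_eq hq.1 hq.2
  · intro v hv u hu u' hu'
    rw [extDensity_eq hu hv, extDensity_eq hu' hv]
    have := (convex_Ioi (0 : ℝ)).norm_image_sub_le_of_norm_hasDerivWithin_le (f := fun r => f r v)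
      (f' := fun r => radD1 f r v) (C := C)
      (fun r hr => (hf.hasDerivAt_radial hr hv).differentiableAt.hasDerivAt.hasDerivWithinAt)
      (fun r hr => (hC r hr v hv).2.1) (show u' ∈ Ioi 0 from hu') (show u ∈ Ioi 0 from hu)
    simp only [Real.norm_eq_abs] at this
    exact this.trans (by gcongr)
  · intro v hv u s hs
    have key : ∀ s : ℝ, 0 ≤ s → s < u →
        |extDensity f (u + s) v + extDensity f (u - s) v - 2 * extDensity f u v| ≤
          2 * Real.pi ^ 2 * C * s ^ 2 := by
      intro s hs0 hsu
      rw [extDensity_eq (by linarith) hv, extDensity_eq (by linarith) hv,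
        extDensity_eq (by linarith) hv]
      have := abs_second_difference_le (φ := fun r => f r v) (φ' := fun r => radD1 f r v)
        (φ'' := fun r => radD2 f r v) (x := u) (C := C) hs0
        (fun r hr => (hf.hasDerivAt_radial (by linarith [hr.1]) hv).differentiableAt.hasDerivAt)
        (fun r hr => hf.hasDerivAt_radD1 (by linarith [hr.1]) hv)
        (fun r hr => (hC r (by linarith [hr.1]) v hv).2.2.1)
      refine this.trans ?_
      have : 2 * C ≤ 2 * Real.pi ^ 2 * C := by nlinarith
      gcongr
    rcases le_total 0 s with h | h
    · exact key s h (lt_of_abs_lt hs)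
    · have := key (-s) (by linarith) (by rwa [abs_of_nonpos h] at hs)
      rw [neg_sq] at this
      convert! this using 2
      ring_nf
  · intro u v hv w hw
    have hv1 := mem_sphere_zero_iff_norm.1 hv
    have hw1 := mem_sphere_zero_iff_norm.1 hw
    set t := inner ℝ v w with ht
    have ht1 : |t| ≤ 1 := by
      have := abs_real_inner_le_norm v w
      rwa [hv1, hw1, one_mul] at this
    obtain ⟨ht1, ht2⟩ := abs_le.1 ht1
    have hnn : 0 ≤ 2 * Real.pi ^ 2 * C * (1 - t) := mul_nonneg (by positivity) (by linarith)
    rcases le_or_gt u 0 with hu | hu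
    · simpa [extDensity_of_nonpos hu] using hnn
    rw [extDensity_eq hu hv, extDensity_eq hu hw, extDensity_eq hu (reflect_mem hv hw)]
    rcases eq_or_lt_of_le ht2 with h1 | h1
    · have : v = w := (inner_eq_one_iff_of_norm_eq_one hv1 hw1).1 h1
      have e : (2 * t) • v - w = v := by rw [h1, ← this]; module
      rw [e, ← this, h1, ← two_mul, sub_self, sub_self]
      simp
    -- Antipodal points do not determine a great circle, but are far apart.
    rcases eq_or_lt_of_le ht1 with h2 | h2
    · have b1 := abs_le.1 (hC u hu v hv).1
      have b2 := abs_le.1 (hC u hu w hw).1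
      have b3 := abs_le.1 (hC u hu _ (reflect_mem hv hw)).1
      rw [← ht] at b3
      have : 4 * C ≤ 2 * Real.pi ^ 2 * C * (1 - t) := by rw [← h2]; nlinarith
      refine le_trans (abs_le.2 ⟨?_, ?_⟩) this <;> linarith [b1.1, b1.2, b2.1, b2.2, b3.1, b3.2]
    · have hs : 0 < 1 - t ^ 2 := by nlinarith
      have hsq := Real.sqrt_pos.2 hs
      set σ := √(1 - t ^ 2) with hσ
      have hσ2 : σ ^ 2 = 1 - t ^ 2 := Real.sq_sqrt hs.le
      set ξ : E p := σ⁻¹ • (w - t • v) with hξ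
      have hξ1 : ‖ξ‖ = 1 := by
        have : ‖w - t • v‖ ^ 2 = σ ^ 2 := by
          rw [norm_sub_sq_real, norm_smul, hw1, hv1, inner_smul_right, real_inner_comm, ← ht, hσ2,
            mul_one, Real.norm_eq_abs, sq_abs]
          ring
        have h3 : ‖w - t • v‖ = σ := (pow_left_inj₀ (norm_nonneg _) hsq.le two_ne_zero).1 this
        rw [hξ, norm_smul, h3, Real.norm_of_nonneg (by positivity), inv_mul_cancel₀ hsq.ne']
      have hvξ : inner ℝ v ξ = 0 := by
        rw [hξ, inner_smul_right, inner_sub_right, inner_smul_right, ← ht,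
          real_inner_self_eq_norm_sq, hv1]
        ring
      have hcos : Real.cos (Real.arccos t) = t := Real.cos_arccos ht1 ht2
      have hsin : Real.sin (Real.arccos t) = σ := Real.sin_arccos t
      have := hf.abs_great_circle_le (fun u hu v hv => (hC u hu v hv).2.2.2) hu hv1 hξ1 hvξ
        (Real.arccos_nonneg t)
      have e : σ • ξ = w - t • v := by rw [hξ, smul_smul, mul_inv_cancel₀ hsq.ne', one_smul]
      rw [hcos, hsin, e, show t • v + (w - t • v) = w by module,
        show t • v - (w - t • v) = (2 * t) • v - w by module] at this
      refine this.trans ?_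
      have hb := Real.cos_le_one_sub_mul_cos_sq (x := Real.arccos t) (by
        rw [abs_of_nonneg (Real.arccos_nonneg t)]; exact Real.arccos_le_pi t)
      rw [hcos] at hb
      have hb' : Real.arccos t ^ 2 ≤ Real.pi ^ 2 / 2 * (1 - t) := by
        have hh : Real.arccos t ^ 2 = Real.pi ^ 2 / 2 * (2 / Real.pi ^ 2 * Real.arccos t ^ 2) := by
          field_simp
        rw [hh]
        gcongr
        linarith
      calc _ ≤ 4 * C * (Real.pi ^ 2 / 2 * (1 - t)) := by gcongr
        _ = _ := by ring

/-! ### Radial smoothing -/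

theorem integral_rescale {h : ℝ} (hh : 0 < h) (G : ℝ → ℝ) (u : ℝ) :
    ∫ r, h⁻¹ * G ((u - r) / h) = ∫ t, G t := by
  rw [integral_const_mul, integral_sub_left_eq_self (fun r => G (r / h)) volume u,
    Measure.integral_comp_div, abs_of_pos hh, smul_eq_mul, inv_mul_cancel_left₀ hh.ne']

theorem integrable_rescale {h : ℝ} (hh : 0 < h) {G : ℝ → ℝ} (hG : Integrable G) (u : ℝ) :
    Integrable fun r => h⁻¹ * G ((u - r) / h) :=
  ((hG.comp_div hh.ne').comp_sub_left u).const_mul _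

namespace KernelAssumption

variable {K : ℝ → ℝ}

theorem eq_zero (hK : KernelAssumption K) {t : ℝ} (ht : t ∉ Ioo (-1 : ℝ) 1) : K t = 0 := by
  by_contra h
  exact ht (hK.support h)

theorem integrable (hK : KernelAssumption K) : Integrable K := by
  refine ⟨hK.measurable.aestronglyMeasurable, ?_⟩
  rw [hasFiniteIntegral_iff_ofReal (Eventually.of_forall hK.nonneg), hK.integral_eq_one]
  exact ENNReal.one_lt_top

theorem integral_eq (hK : KernelAssumption K) : ∫ t, K t = 1 := by
  rw [integral_eq_lintegral_of_nonneg_ae (Eventually.of_forall hK.nonneg)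
    hK.measurable.aestronglyMeasurable, hK.integral_eq_one, ENNReal.toReal_one]

theorem integrable_sq (hK : KernelAssumption K) : Integrable fun t => K t ^ 2 := by
  have hsupp : Function.support (fun t => K t ^ 2) ⊆ Ioo (-1) 1 := fun t ht =>
    hK.support fun h => ht (by simp [h])
  rw [← integrableOn_iff_integrable_of_support_subset hsupp]
  have h4 : IntegrableOn (fun t => K t ^ 4) (Ioo (-1) 1) := by
    refine ⟨(hK.measurable.pow_const 4).aestronglyMeasurable, ?_⟩
    rw [hasFiniteIntegral_iff_ofReal (Eventually.of_forall fun t => by positivity)]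
    exact hK.fourth
  have h1 : IntegrableOn (fun _ : ℝ => (1 : ℝ)) (Ioo (-1) 1) := by simp
  refine Integrable.mono' (h4.add h1) (hK.measurable.pow_const 2).aestronglyMeasurable
    (Eventually.of_forall fun t => ?_)
  rw [Real.norm_of_nonneg (sq_nonneg _)]
  simp only [Pi.add_apply]
  nlinarith [sq_nonneg (K t ^ 2 - 1)]

theorem abs_integral_mul_le (hK : KernelAssumption K) {ψ : ℝ → ℝ} {B : ℝ}
    (hψ : ∀ t ∈ Ioo (-1 : ℝ) 1, |ψ t| ≤ B) : |∫ t, K t * ψ t| ≤ B := by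
  have h := norm_integral_le_of_norm_le (μ := volume) (f := fun t => K t * ψ t)
    (hK.integrable.mul_const B) (Eventually.of_forall fun t => by
      rw [norm_mul, Real.norm_of_nonneg (hK.nonneg t)]
      by_cases ht : t ∈ Ioo (-1 : ℝ) 1
      · exact mul_le_mul_of_nonneg_left (hψ t ht) (hK.nonneg t)
      · simp [hK.eq_zero ht])
  rwa [integral_mul_const, hK.integral_eq, one_mul] at h

theorem integrable_mul (hK : KernelAssumption K) {ψ : ℝ → ℝ} (hψ : Measurable ψ) {B : ℝ}
    (hB : ∀ t, |ψ t| ≤ B) : Integrable fun t => K t * ψ t :=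
  hK.integrable.mul_bdd hψ.aestronglyMeasurable (Eventually.of_forall hB)

variable {γ : ℝ → ℝ} {L : ℝ}

theorem integral_mul_sub_eq (hK : KernelAssumption K) (hγ : Measurable γ) (hL : ∀ u, |γ u| ≤ L)
    (h u : ℝ) : (∫ t, K t * γ (u - h * t)) - γ u = ∫ t, K t * (γ (u - h * t) - γ u) := by
  simp_rw [mul_sub]
  rw [integral_sub (hK.integrable_mul (ψ := fun t => γ (u - h * t)) (by fun_prop) fun t => hL _)
    (hK.integrable.mul_const _), integral_mul_const, hK.integral_eq, one_mul]

/-- First order bias of radial smoothing away from the boundary. -/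
theorem abs_smooth_sub_le (hK : KernelAssumption K) (hγ : Measurable γ) (hL : ∀ u, |γ u| ≤ L)
    (hlip : ∀ u > 0, ∀ u' > 0, |γ u - γ u'| ≤ L * |u - u'|) {h u : ℝ} (hh : 0 < h) (hu : h ≤ u) :
    |(∫ t, K t * γ (u - h * t)) - γ u| ≤ L * h := by
  have hL0 : 0 ≤ L := (abs_nonneg _).trans (hL 0)
  rw [hK.integral_mul_sub_eq hγ hL]
  refine hK.abs_integral_mul_le fun t ht => ?_
  refine (hlip _ (by nlinarith [ht.2]) _ (by linarith)).trans ?_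
  gcongr
  rw [show u - h * t - u = h * (-t) by ring, abs_mul, abs_of_pos hh, abs_neg]
  have : |t| ≤ 1 := abs_le.2 ⟨ht.1.le, ht.2.le⟩
  nlinarith

/-- Second order bias of radial smoothing away from the boundary. -/
theorem abs_smooth_sub_le_sq (hK : KernelAssumption K) (hγ : Measurable γ) (hL : ∀ u, |γ u| ≤ L)
    (hdiff : ∀ u s, |s| < u → |γ (u + s) + γ (u - s) - 2 * γ u| ≤ L * s ^ 2) {h u : ℝ}
    (hh : 0 < h) (hu : h ≤ u) : |(∫ t, K t * γ (u - h * t)) - γ u| ≤ L * h ^ 2 := by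
  have hL0 : 0 ≤ L := (abs_nonneg _).trans (hL 0)
  have i1 : Integrable fun t => K t * γ (u - h * t) :=
    hK.integrable_mul (ψ := fun t => γ (u - h * t)) (by fun_prop) fun t => hL _
  have i2 : Integrable fun t => K t * γ (u + h * t) :=
    hK.integrable_mul (ψ := fun t => γ (u + h * t)) (by fun_prop) fun t => hL _
  have hsym : ∫ t, K t * γ (u - h * t) = ∫ t, K t * γ (u + h * t) := by
    rw [← integral_neg_eq_self]
    simp [hK.symm]
  have h2 : 2 * ((∫ t, K t * γ (u - h * t)) - γ u) =
      ∫ t, K t * (γ (u + h * t) + γ (u - h * t) - 2 * γ u) := by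
    have i12 : Integrable fun t => K t * γ (u + h * t) + K t * γ (u - h * t) := i2.add i1
    simp_rw [mul_sub (K _), mul_add (K _)]
    rw [integral_sub i12 (hK.integrable.mul_const _), integral_add i2 i1, ← hsym,
      integral_mul_const, hK.integral_eq]
    ring
  have h3 : |∫ t, K t * (γ (u + h * t) + γ (u - h * t) - 2 * γ u)| ≤ L * h ^ 2 := by
    refine hK.abs_integral_mul_le fun t ht => ?_
    have ht1 : |t| < 1 := abs_lt.2 ht
    have : |h * t| < u := by
      rw [abs_mul, abs_of_pos hh]; nlinarith
    refine (hdiff u (h * t) this).trans ?_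
    have : t ^ 2 ≤ 1 := (sq_le_one_iff_abs_le_one t).2 ht1.le
    rw [mul_pow]
    nlinarith [mul_nonneg hL0 (sq_nonneg h)]
  rw [← h2, abs_mul, abs_two] at h3
  nlinarith [abs_nonneg ((∫ t, K t * γ (u - h * t)) - γ u)]

end KernelAssumption

/-! ### The law of the polar coordinates -/

variable {F : ℝ → E p → ℝ} {C : ℝ}

/-- The measure `du ω_{p-1}(dv)` on `ℝ × S^{p-1}`. -/
noncomputable abbrev polarMeasure (p : ℕ) : Measure (ℝ × unitSphere p) :=
  (volume : Measure ℝ).prod (sphereMeasure p)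

/-- The law on `ℝ × ℝ^p` with density `F` with respect to `du ω_{p-1}(dv)`. -/
noncomputable def polarLaw (F : ℝ → E p → ℝ) : Measure (ℝ × E p) :=
  ((polarMeasure p).withDensity fun q => ENNReal.ofReal (F q.1 q.2)).map
    fun q => (q.1, (q.2 : E p))

theorem measurable_coe_polar : Measurable fun q : ℝ × unitSphere p => (q.1, (q.2 : E p)) := by
  fun_prop

theorem HasPolarDensity.map_eq_polarLaw {μ : Measure (E p)} {f : ℝ → E p → ℝ}
    (hf : HasPolarDensity μ f) :
    μ.map (fun y => (‖y‖, direction y)) = polarLaw (extDensity f) := by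
  rw [hf.2, polarLaw]
  congr 1
  have h1 : ((volume : Measure ℝ).restrict (Ioi 0)).prod (sphereMeasure p) =
      (polarMeasure p).restrict (Ioi 0 ×ˢ univ) := by
    rw [← Measure.prod_restrict, Measure.restrict_univ]
  rw [h1, ← withDensity_indicator (measurableSet_Ioi.prod MeasurableSet.univ)]
  congr 1
  funext q
  by_cases hq : 0 < q.1
  · rw [extDensity_eq hq q.2.2]
    simp [hq]
  · rw [extDensity_of_nonpos (not_lt.1 hq)]
    simp [hq]

namespace RegularDensity

theorem nonneg_const (hF : RegularDensity F C) : 0 ≤ C := (hF.nonneg 0 0).trans (hF.le 0 0)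

theorem measurable_polar (hF : RegularDensity F C) :
    Measurable fun q : ℝ × unitSphere p => F q.1 q.2 :=
  hF.measurable.comp measurable_coe_polar

theorem measurable_sphere (hF : RegularDensity F C) (u : ℝ) :
    Measurable fun w : unitSphere p => F u w :=
  hF.measurable_polar.comp measurable_prodMk_left

theorem integral_polarLaw (hF : RegularDensity F C) {φ : ℝ × E p → ℝ} (hφ : Measurable φ) :
    ∫ x, φ x ∂(polarLaw F) =
      ∫ q : ℝ × unitSphere p, F q.1 q.2 * φ (q.1, q.2) ∂(polarMeasure p) := by
  rw [polarLaw, integral_map measurable_coe_polar.aemeasurable hφ.aestronglyMeasurable,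
    integral_withDensity_eq_integral_toReal_smul hF.measurable_polar.ennreal_ofReal
      (Eventually.of_forall fun _ => ENNReal.ofReal_lt_top)]
  simp_rw [ENNReal.toReal_ofReal (hF.nonneg _ _), smul_eq_mul]

theorem integrable_polarLaw (hF : RegularDensity F C) {φ : ℝ × E p → ℝ} (hφ : Measurable φ)
    (hi : Integrable (fun q : ℝ × unitSphere p => φ (q.1, q.2)) (polarMeasure p)) :
    Integrable φ (polarLaw F) := by
  rw [polarLaw, integrable_map_measure hφ.aestronglyMeasurable measurable_coe_polar.aemeasurable,
    integrable_withDensity_iff_integrable_smul' hF.measurable_polar.ennreal_ofReal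
      (Eventually.of_forall fun _ => ENNReal.ofReal_lt_top)]
  simp_rw [ENNReal.toReal_ofReal (hF.nonneg _ _), smul_eq_mul]
  refine hi.bdd_mul (c := C) hF.measurable_polar.aestronglyMeasurable
    (Eventually.of_forall fun q => ?_)
  rw [Real.norm_of_nonneg (hF.nonneg _ _)]
  exact hF.le _ _

/-- The law charges only points with positive radius and unit direction. -/
theorem ae_polarLaw (hF : RegularDensity F C) :
    ∀ᵐ x ∂(polarLaw F), 0 < x.1 ∧ x.2 ∈ unitSphere p := by
  have hm : MeasurableSet {x : ℝ × E p | 0 < x.1 ∧ x.2 ∈ unitSphere p} :=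
    measurableSet_Ioi.prod Metric.isClosed_sphere.measurableSet
  rw [polarLaw, ae_map_iff measurable_coe_polar.aemeasurable hm,
    ae_withDensity_iff hF.measurable_polar.ennreal_ofReal]
  refine Eventually.of_forall fun q hq => ⟨?_, q.2.2⟩
  by_contra h
  rw [hF.eq_zero _ (not_lt.1 h)] at hq
  simp at hq

theorem integrable_sphere (hF : RegularDensity F C) (u : ℝ) :
    Integrable (fun w : unitSphere p => F u w) (sphereMeasure p) :=
  Integrable.of_bound (hF.measurable_sphere u).aestronglyMeasurable C
    (Eventually.of_forall fun w => by
      rw [Real.norm_of_nonneg (hF.nonneg _ _)]; exact hF.le _ _)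

end RegularDensity

/-- The marginal density of the radius. -/
noncomputable def radialDensity (F : ℝ → E p → ℝ) (u : ℝ) : ℝ :=
  ∫ w : unitSphere p, F u w ∂(sphereMeasure p)

/-- The function `f(u,v) - ω_{p-1}⁻¹ f_U(u)`, where `f_U` is the marginal density of the radius: the
limit of the projections of the kernels. -/
noncomputable def limitFun (F : ℝ → E p → ℝ) (x : ℝ × E p) : ℝ :=
  F x.1 x.2 - (sphereArea p)⁻¹ * radialDensity F x.1

theorem sphereMeasure_real_univ (hp : 1 ≤ p) : (sphereMeasure p).real univ = sphereArea p := by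
  rw [measureReal_def, sphereMeasure_univ hp, ENNReal.toReal_ofReal (sphereArea_pos hp).le]

/-- Averages over the sphere obey pointwise bounds. -/
theorem abs_average_le (hp : 1 ≤ p) {φ : unitSphere p → ℝ} {B : ℝ} (hφ : ∀ w, |φ w| ≤ B) :
    |(sphereArea p)⁻¹ * ∫ w, φ w ∂(sphereMeasure p)| ≤ B := by
  have hω := sphereArea_pos hp
  have h := norm_integral_le_of_norm_le_const (μ := sphereMeasure p) (f := φ)
    (Eventually.of_forall hφ)
  rw [sphereMeasure_real_univ hp] at h
  rw [abs_mul, abs_of_pos (inv_pos.2 hω), inv_mul_le_iff₀ hω, mul_comm]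
  exact h

namespace RegularDensity

theorem measurable_radialDensity (hF : RegularDensity F C) : Measurable (radialDensity F) :=
  (StronglyMeasurable.integral_prod_right
    (f := fun (u : ℝ) (w : unitSphere p) => F u w)
    hF.measurable_polar.stronglyMeasurable).measurable

theorem measurable_limitFun (hF : RegularDensity F C) : Measurable (limitFun F) :=
  hF.measurable.sub ((hF.measurable_radialDensity.comp measurable_fst).const_mul _)

theorem radialDensity_nonneg (hF : RegularDensity F C) (u : ℝ) : 0 ≤ radialDensity F u :=
  integral_nonneg fun w => hF.nonneg u w

theorem abs_limitFun_le (hF : RegularDensity F C) (hp : 1 ≤ p) (x : ℝ × E p) :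
    |limitFun F x| ≤ 2 * C := by
  have h1 := abs_average_le hp (φ := fun w => F x.1 w) (B := C) fun w => by
    rw [abs_of_nonneg (hF.nonneg _ _)]; exact hF.le _ _
  have h2 : |F x.1 x.2| ≤ C := by
    rw [abs_of_nonneg (hF.nonneg _ _)]; exact hF.le _ _
  exact (abs_sub _ _).trans (by unfold radialDensity; linarith)

theorem limitFun_of_nonpos (hF : RegularDensity F C) {u : ℝ} (hu : u ≤ 0) (v : E p) :
    limitFun F (u, v) = 0 := by
  simp [limitFun, radialDensity, hF.eq_zero u hu]

theorem lipschitz_limitFun (hF : RegularDensity F C) (hp : 1 ≤ p) {v : E p}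
    (hv : v ∈ unitSphere p) {u u' : ℝ} (hu : 0 < u) (hu' : 0 < u') :
    |limitFun F (u, v) - limitFun F (u', v)| ≤ 2 * C * |u - u'| := by
  have h1 := abs_average_le hp (φ := fun w => F u w - F u' w)
    fun w => hF.lipschitz w w.2 u hu u' hu'
  rw [integral_sub (hF.integrable_sphere u) (hF.integrable_sphere u')] at h1
  have h2 := hF.lipschitz v hv u hu u' hu'
  have e : limitFun F (u, v) - limitFun F (u', v) = (F u v - F u' v) -
      (sphereArea p)⁻¹ * (∫ w : unitSphere p, F u w ∂(sphereMeasure p) -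
        ∫ w : unitSphere p, F u' w ∂(sphereMeasure p)) := by
    simp only [limitFun, radialDensity]; ring
  rw [e]
  exact (abs_sub _ _).trans (by linarith)

theorem second_difference_limitFun (hF : RegularDensity F C) (hp : 1 ≤ p) {v : E p}
    (hv : v ∈ unitSphere p) {u s : ℝ} (hs : |s| < u) :
    |limitFun F (u + s, v) + limitFun F (u - s, v) - 2 * limitFun F (u, v)| ≤ 2 * C * s ^ 2 := by
  have h1 := abs_average_le hp (φ := fun w => F (u + s) w + F (u - s) w - 2 * F u w)
    fun w => hF.radial w w.2 u s hs
  have i1 : Integrable (fun w : unitSphere p => F (u + s) w + F (u - s) w) (sphereMeasure p) :=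
    (hF.integrable_sphere _).add (hF.integrable_sphere _)
  rw [integral_sub i1 ((hF.integrable_sphere u).const_mul 2),
    integral_add (hF.integrable_sphere _) (hF.integrable_sphere _), integral_const_mul] at h1
  have h2 := hF.radial v hv u s hs
  have e : limitFun F (u + s, v) + limitFun F (u - s, v) - 2 * limitFun F (u, v) =
      (F (u + s) v + F (u - s) v - 2 * F u v) - (sphereArea p)⁻¹ *
        (∫ w : unitSphere p, F (u + s) w ∂(sphereMeasure p) +
          ∫ w : unitSphere p, F (u - s) w ∂(sphereMeasure p) -
            2 * ∫ w : unitSphere p, F u w ∂(sphereMeasure p)) := by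
    simp only [limitFun, radialDensity]; ring
  rw [e]
  exact (abs_sub _ _).trans (by linarith)

end RegularDensity

/-! ### Spherical smoothing -/

/-- Reflection of the sphere in the axis through `v` preserves integrals. -/
theorem integral_reflect {v : E p} (hv : v ∈ unitSphere p) (φ : unitSphere p → ℝ) :
    ∫ w, φ ⟨_, reflect_mem hv w.2⟩ ∂(sphereMeasure p) = ∫ w, φ w ∂(sphereMeasure p) := by
  set R := (Submodule.span ℝ {v}).reflection
  have hR : ∀ w, R w = (2 * inner ℝ v w) • v - w := fun w => by
    rw [Submodule.reflection_apply,
      Submodule.starProjection_unit_singleton ℝ (mem_sphere_zero_iff_norm.1 hv), two_smul]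
    module
  have hemb : MeasurableEmbedding (sphereMap R) := by
    have hRR : ∀ w, sphereMap R (sphereMap R w) = w := fun w => Subtype.ext (by simp [sphereMap, R])
    exact (MeasurableEquiv.mk ⟨sphereMap R, sphereMap R, hRR, hRR⟩
      (measurePreserving_sphereMap R).measurable
      (measurePreserving_sphereMap R).measurable).measurableEmbedding
  rw [← (measurePreserving_sphereMap R).integral_comp hemb φ]
  refine integral_congr_ae (Eventually.of_forall fun w => ?_)
  exact congrArg φ (Subtype.ext (hR w).symm : _ = sphereMap R w)

theorem integrable_fisherKernel_mul (κ : ℝ) (v : E p) {φ : unitSphere p → ℝ} (hφ : Measurable φ)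
    {B : ℝ} (hB : ∀ w, |φ w| ≤ B) :
    Integrable (fun w : unitSphere p => fisherKernel p κ (inner ℝ v (w : E p)) * φ w)
      (sphereMeasure p) := by
  have hc : Continuous fun w : unitSphere p => fisherKernel p κ (inner ℝ v (w : E p)) := by
    fun_prop
  exact (hc.integrable_of_hasCompactSupport (HasCompactSupport.of_compactSpace _)).mul_bdd
    hφ.aestronglyMeasurable (Eventually.of_forall hB)

namespace RegularDensity

/-- Smoothing with the Fisher–von Mises kernel has bias of order `1/κ`: by the reflection
symmetry of the kernel the increments of the density may be replaced by second differences. -/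
theorem exists_abs_spherical_smooth_sub_le (hF : RegularDensity F C) (hp : 2 ≤ p) :
    ∃ A, 0 < A ∧ ∀ κ : ℝ, 1 ≤ κ → ∀ u, ∀ v ∈ unitSphere p,
      |∫ w : unitSphere p, fisherKernel p κ (inner ℝ v (w : E p)) * F u w ∂(sphereMeasure p)
        - F u v| ≤ A / κ := by
  obtain ⟨D, hD, hmom⟩ := exists_integral_one_sub_mul_fisherKernel_le hp
  have hC := hF.nonneg_const
  refine ⟨C * D + 1, by positivity, fun κ hκ u v hv => ?_⟩
  have hκ0 : 0 < κ := by linarith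
  have hv1 := mem_sphere_zero_iff_norm.1 hv
  set q : unitSphere p → ℝ := fun w => fisherKernel p κ (inner ℝ v (w : E p)) with hq
  set r : unitSphere p → unitSphere p := fun w => ⟨_, reflect_mem hv w.2⟩ with hr
  have hrm : Measurable r := by
    refine Measurable.subtype_mk ?_
    fun_prop
  have hqr : ∀ w, q (r w) = q w := fun w => by
    simp only [hq, hr]
    congr 1
    rw [inner_sub_right, inner_smul_right, real_inner_self_eq_norm_sq, hv1]
    ring
  have hFb : ∀ w : E p, |F u w| ≤ C := fun w => by
    rw [abs_of_nonneg (hF.nonneg _ _)]; exact hF.le _ _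
  have i1 : Integrable (fun w => q w * F u w) (sphereMeasure p) :=
    integrable_fisherKernel_mul κ v (hF.measurable_sphere u) fun w => hFb w
  have i2 : Integrable (fun w => q w * F u (r w)) (sphereMeasure p) :=
    integrable_fisherKernel_mul κ v ((hF.measurable_sphere u).comp hrm) fun w => hFb (r w)
  have i3 : Integrable q (sphereMeasure p) := by
    simpa using integrable_fisherKernel_mul κ v (φ := fun _ => 1) (B := 1) measurable_const
      (by simp)
  have hsym : ∫ w, q w * F u (r w) ∂(sphereMeasure p) = ∫ w, q w * F u w ∂(sphereMeasure p) := by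
    rw [← integral_reflect hv fun w => q w * F u w]
    exact integral_congr_ae (Eventually.of_forall fun w => by
      show q w * F u (r w) = q (r w) * F u (r w)
      rw [hqr])
  have hone : ∫ w, q w ∂(sphereMeasure p) = 1 := integral_fisherKernel hp κ hv1
  have h2 : 2 * (∫ w, q w * F u w ∂(sphereMeasure p) - F u v) =
      ∫ w, q w * (F u w + F u (r w) - 2 * F u v) ∂(sphereMeasure p) := by
    have i12 : Integrable (fun w => q w * F u w + q w * F u (r w)) (sphereMeasure p) := i1.add i2
    simp_rw [mul_sub (q _), mul_add (q _)]
    rw [integral_sub i12 (i3.mul_const _), integral_add i1 i2, hsym, integral_mul_const,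
      hone]
    ring
  have i4 : Integrable (fun w : unitSphere p => C * ((1 - inner ℝ v (w : E p)) * q w))
      (sphereMeasure p) := by
    have hc : Continuous fun w : unitSphere p => C * ((1 - inner ℝ v (w : E p)) * q w) := by
      fun_prop
    exact hc.integrable_of_hasCompactSupport (HasCompactSupport.of_compactSpace _)
  have h3 : |∫ w, q w * (F u w + F u (r w) - 2 * F u v) ∂(sphereMeasure p)| ≤ C * (D / κ) := by
    refine (norm_integral_le_of_norm_le
      (f := fun w => q w * (F u w + F u (r w) - 2 * F u v)) i4
      (Eventually.of_forall fun w => ?_)).trans ?_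
    · have hq0 : 0 ≤ q w := fisherKernel_nonneg hp κ _
      rw [norm_mul, Real.norm_of_nonneg hq0]
      calc _ ≤ q w * (C * (1 - inner ℝ v (w : E p))) :=
            mul_le_mul_of_nonneg_left (hF.spherical u v hv w w.2) hq0
        _ = _ := by ring
    · rw [integral_const_mul]
      exact mul_le_mul_of_nonneg_left (hmom κ hκ v hv1) hC
  rw [← h2, abs_mul, abs_two] at h3
  have h4 : C * (D / κ) ≤ (C * D + 1) / κ := by
    rw [← mul_div_assoc]; gcongr; linarith
  linarith [abs_nonneg (∫ w, q w * F u w ∂(sphereMeasure p) - F u v)]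

end RegularDensity

/-! ### The kernel of the `U`-statistic -/

variable {K : ℝ → ℝ}

/-- The symmetric kernel of the `U`-statistic, as a function of two points in polar
coordinates. -/
noncomputable def smoothKernel (p : ℕ) (K : ℝ → ℝ) (h κ : ℝ) (x y : ℝ × E p) : ℝ :=
  h⁻¹ * K ((x.1 - y.1) / h) * (fisherKernel p κ (inner ℝ x.2 y.2) - (sphereArea p)⁻¹)

theorem measurable_smoothKernel (hK : KernelAssumption K) (h κ : ℝ) :
    Measurable (Function.uncurry (smoothKernel p K h κ)) := by
  have h1 : Measurable fun z : (ℝ × E p) × (ℝ × E p) => K ((z.1.1 - z.2.1) / h) :=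
    hK.measurable.comp (by fun_prop)
  have h2 : Measurable fun z : (ℝ × E p) × (ℝ × E p) => fisherKernel p κ (inner ℝ z.1.2 z.2.2) :=
    (continuous_fisherKernel p κ).measurable.comp (by fun_prop)
  exact (h1.const_mul _).mul (h2.sub_const _)

theorem smoothKernel_symm (hK : KernelAssumption K) (h κ : ℝ) (x y : ℝ × E p) :
    smoothKernel p K h κ x y = smoothKernel p K h κ y x := by
  unfold smoothKernel
  rw [← hK.symm, real_inner_comm, ← neg_div, neg_sub]

theorem integrable_sphere_of_continuous {φ : unitSphere p → ℝ} (hφ : Continuous φ) :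
    Integrable φ (sphereMeasure p) :=
  hφ.integrable_of_hasCompactSupport (HasCompactSupport.of_compactSpace _)

theorem integrable_smoothKernel_polar (hK : KernelAssumption K) {h : ℝ} (hh : 0 < h) (κ : ℝ)
    (x : ℝ × E p) :
    Integrable (fun q : ℝ × unitSphere p => smoothKernel p K h κ x (q.1, q.2)) (polarMeasure p) :=
  (integrable_rescale hh hK.integrable x.1).mul_prod
    (integrable_sphere_of_continuous
      (φ := fun w : unitSphere p => fisherKernel p κ (inner ℝ x.2 (w : E p)) - (sphereArea p)⁻¹)
      (by fun_prop))

namespace RegularDensity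

theorem integrable_smoothKernel (hF : RegularDensity F C) (hK : KernelAssumption K) {h : ℝ}
    (hh : 0 < h) (κ : ℝ) (x : ℝ × E p) :
    Integrable (smoothKernel p K h κ x) (polarLaw F) :=
  hF.integrable_polarLaw ((measurable_smoothKernel hK h κ).comp measurable_prodMk_left)
    (integrable_smoothKernel_polar hK hh κ x)

end RegularDensity

/-! ### The second moment of the kernel -/

/-- A probability density bounded by `M` has squared `L²` distance at most `M` from the uniform
density. -/
theorem integral_sq_fisherKernel_sub_le (hp : 2 ≤ p) {κ M : ℝ}
    (hM : ∀ t ∈ Icc (-1 : ℝ) 1, fisherKernel p κ t ≤ M) {v : E p} (hv : ‖v‖ = 1) :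
    ∫ w : unitSphere p, (fisherKernel p κ (inner ℝ v (w : E p)) - (sphereArea p)⁻¹) ^ 2
      ∂(sphereMeasure p) ≤ M := by
  set q : unitSphere p → ℝ := fun w => fisherKernel p κ (inner ℝ v (w : E p)) with hq
  have hω := sphereArea_pos (show 1 ≤ p by omega)
  have hqc : Continuous q := by fun_prop
  have i1 := integrable_sphere_of_continuous hqc
  have i2 : Integrable (fun w => M * q w - 2 * (sphereArea p)⁻¹ * q w) (sphereMeasure p) :=
    (i1.const_mul _).sub (i1.const_mul _)
  have hone : ∫ w, q w ∂(sphereMeasure p) = 1 := integral_fisherKernel hp κ hv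
  have hle : ∀ w, (q w - (sphereArea p)⁻¹) ^ 2 ≤
      M * q w - 2 * (sphereArea p)⁻¹ * q w + (sphereArea p)⁻¹ ^ 2 := fun w => by
    have h1 : q w ≤ M := hM _ (abs_le.1 (by
      have := abs_real_inner_le_norm v (w : E p)
      rwa [hv, mem_sphere_zero_iff_norm.1 w.2, one_mul] at this))
    have h0 : 0 ≤ q w := fisherKernel_nonneg hp κ _
    nlinarith
  have i3 : Integrable (fun w => M * q w - 2 * (sphereArea p)⁻¹ * q w + (sphereArea p)⁻¹ ^ 2)
      (sphereMeasure p) := i2.add (integrable_const _)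
  refine (integral_mono (integrable_sphere_of_continuous (by fun_prop)) i3 hle).trans ?_
  rw [integral_add i2 (integrable_const _), integral_sub (i1.const_mul _) (i1.const_mul _),
    integral_const_mul, integral_const_mul, hone, integral_const,
    sphereMeasure_real_univ (by omega), smul_eq_mul]
  have : sphereArea p * (sphereArea p)⁻¹ ^ 2 = (sphereArea p)⁻¹ := by field_simp
  rw [this]
  have := inv_pos.2 hω
  linarith

namespace RegularDensity

/-- The second moment of a row of the kernel is of order `h⁻¹` times the maximum of the spherical
kernel. -/
theorem integral_sq_smoothKernel_le (hF : RegularDensity F C) (hK : KernelAssumption K)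
    (hp : 2 ≤ p) {h : ℝ} (hh : 0 < h) {κ M : ℝ} (hM : ∀ t ∈ Icc (-1 : ℝ) 1, fisherKernel p κ t ≤ M)
    (u : ℝ) {v : E p} (hv : ‖v‖ = 1) :
    Integrable (fun y => smoothKernel p K h κ (u, v) y ^ 2) (polarLaw F) ∧
    ∫ y, smoothKernel p K h κ (u, v) y ^ 2 ∂(polarLaw F) ≤ C * (h⁻¹ * (∫ t, K t ^ 2) * M) := by
  set b : unitSphere p → ℝ := fun w =>
    (fisherKernel p κ (inner ℝ v (w : E p)) - (sphereArea p)⁻¹) ^ 2 with hb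
  have hm : Measurable fun y => smoothKernel p K h κ (u, v) y ^ 2 :=
    ((measurable_smoothKernel hK h κ).comp measurable_prodMk_left).pow_const 2
  have ik := integrable_rescale hh hK.integrable_sq u
  have ib : Integrable b (sphereMeasure p) := integrable_sphere_of_continuous (by fun_prop)
  have e : ∀ q : ℝ × unitSphere p, smoothKernel p K h κ (u, v) (q.1, q.2) ^ 2 =
      h⁻¹ * ((h⁻¹ * K ((u - q.1) / h) ^ 2) * b q.2) := fun q => by
    simp only [smoothKernel, hb]; ring
  have i1 : Integrable (fun q : ℝ × unitSphere p => (h⁻¹ * K ((u - q.1) / h) ^ 2) * b q.2)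
      (polarMeasure p) := ik.mul_prod ib
  have i2 : Integrable (fun q : ℝ × unitSphere p => smoothKernel p K h κ (u, v) (q.1, q.2) ^ 2)
      (polarMeasure p) := by
    simp_rw [e]
    exact i1.const_mul _
  refine ⟨hF.integrable_polarLaw hm i2, ?_⟩
  rw [hF.integral_polarLaw hm]
  have hC := hF.nonneg_const
  have h1 : ∫ q : ℝ × unitSphere p, F q.1 q.2 * smoothKernel p K h κ (u, v) (q.1, q.2) ^ 2
      ∂(polarMeasure p) ≤ ∫ q : ℝ × unitSphere p,
        C * smoothKernel p K h κ (u, v) (q.1, q.2) ^ 2 ∂(polarMeasure p) := by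
    refine integral_mono_of_nonneg (Eventually.of_forall fun q =>
      mul_nonneg (hF.nonneg _ _) (sq_nonneg _)) (i2.const_mul C) (Eventually.of_forall fun q => ?_)
    exact mul_le_mul_of_nonneg_right (hF.le _ _) (sq_nonneg _)
  refine h1.trans ?_
  rw [integral_const_mul]
  refine mul_le_mul_of_nonneg_left ?_ hC
  simp_rw [e]
  rw [integral_const_mul, integral_prod_mul (fun r => h⁻¹ * K ((u - r) / h) ^ 2) b,
    integral_rescale hh (fun t => K t ^ 2), mul_assoc]
  have hK2 : 0 ≤ ∫ t, K t ^ 2 := integral_nonneg fun t => sq_nonneg _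
  have := integral_sq_fisherKernel_sub_le hp hM hv
  gcongr

theorem memLp_smoothKernel (hF : RegularDensity F C) [IsProbabilityMeasure (polarLaw F)]
    (hK : KernelAssumption K) (hp : 2 ≤ p) {h : ℝ} (hh : 0 < h) {κ M : ℝ}
    (hM : ∀ t ∈ Icc (-1 : ℝ) 1, fisherKernel p κ t ≤ M) :
    MemLp (Function.uncurry (smoothKernel p K h κ)) 2 ((polarLaw F).prod (polarLaw F)) ∧
    ∫ z, smoothKernel p K h κ z.1 z.2 ^ 2 ∂((polarLaw F).prod (polarLaw F)) ≤
      C * (h⁻¹ * (∫ t, K t ^ 2) * M) := by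
  have hm := measurable_smoothKernel (p := p) hK h κ
  have hb : ∀ᵐ x ∂(polarLaw F), Integrable (fun y => smoothKernel p K h κ x y ^ 2) (polarLaw F) ∧
      ∫ y, smoothKernel p K h κ x y ^ 2 ∂(polarLaw F) ≤ C * (h⁻¹ * (∫ t, K t ^ 2) * M) := by
    filter_upwards [hF.ae_polarLaw] with x hx
    exact hF.integral_sq_smoothKernel_le hK hp hh hM x.1 (mem_sphere_zero_iff_norm.1 hx.2)
  have hsm : Measurable fun z : (ℝ × E p) × (ℝ × E p) => smoothKernel p K h κ z.1 z.2 ^ 2 :=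
    hm.pow_const 2
  have hi : Integrable (fun z : (ℝ × E p) × (ℝ × E p) => smoothKernel p K h κ z.1 z.2 ^ 2)
      ((polarLaw F).prod (polarLaw F)) := by
    rw [integrable_prod_iff hsm.aestronglyMeasurable]
    refine ⟨hb.mono fun x hx => hx.1, ?_⟩
    refine Integrable.of_bound
      hsm.norm.stronglyMeasurable.integral_prod_right.aestronglyMeasurable
      (C * (h⁻¹ * (∫ t, K t ^ 2) * M)) (hb.mono fun x hx => ?_)
    rw [Real.norm_of_nonneg (integral_nonneg fun y => norm_nonneg _)]
    simp_rw [Real.norm_of_nonneg (sq_nonneg _)]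
    exact hx.2
  refine ⟨(memLp_two_iff_integrable_sq hm.aestronglyMeasurable).2 hi, ?_⟩
  rw [integral_prod _ hi]
  have := integral_mono_ae hi.integral_prod_left (integrable_const _) (hb.mono fun x hx => hx.2)
  simpa using this

end RegularDensity

/-! ### The projection of the kernel -/

/-- The spherical smoothing of the density, minus its spherical average. -/
noncomputable def sphericalSmooth (F : ℝ → E p → ℝ) (κ : ℝ) (v : E p) (u : ℝ) : ℝ :=
  ∫ w : unitSphere p, (fisherKernel p κ (inner ℝ v (w : E p)) - (sphereArea p)⁻¹) * F u w
    ∂(sphereMeasure p)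

namespace RegularDensity

theorem measurable_sphericalSmooth (hF : RegularDensity F C) (κ : ℝ) (v : E p) :
    Measurable (sphericalSmooth F κ v) := by
  have h1 : Measurable fun q : ℝ × unitSphere p =>
      (fisherKernel p κ (inner ℝ v (q.2 : E p)) - (sphereArea p)⁻¹) * F q.1 q.2 := by
    refine Measurable.mul (Continuous.measurable (by fun_prop)) hF.measurable_polar
  exact (StronglyMeasurable.integral_prod_right (f := fun (u : ℝ) (w : unitSphere p) =>
    (fisherKernel p κ (inner ℝ v (w : E p)) - (sphereArea p)⁻¹) * F u w)
    h1.stronglyMeasurable).measurable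

theorem sphericalSmooth_sub_limitFun (hF : RegularDensity F C) (κ : ℝ) (v : E p) (u : ℝ) :
    sphericalSmooth F κ v u - limitFun F (u, v) =
      ∫ w : unitSphere p, fisherKernel p κ (inner ℝ v (w : E p)) * F u w ∂(sphereMeasure p)
        - F u v := by
  have i1 := integrable_fisherKernel_mul κ v (hF.measurable_sphere u) (B := C) fun w => by
    rw [abs_of_nonneg (hF.nonneg _ _)]; exact hF.le _ _
  simp only [sphericalSmooth, limitFun, radialDensity, sub_mul]
  rw [integral_sub i1 ((hF.integrable_sphere u).const_mul _), integral_const_mul]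
  ring

/-- The projection smooths the density on the sphere and then in the radius. -/
theorem kernelProj_smoothKernel (hF : RegularDensity F C) (hK : KernelAssumption K) {h : ℝ}
    (hh : 0 < h) (κ u : ℝ) (v : E p) :
    kernelProj (polarLaw F) (smoothKernel p K h κ) (u, v) =
      ∫ t, K t * sphericalSmooth F κ v (u - h * t) := by
  have hm : Measurable (smoothKernel p K h κ (u, v)) :=
    (measurable_smoothKernel hK h κ).comp measurable_prodMk_left
  rw [kernelProj, hF.integral_polarLaw hm, integral_prod,
    ← integral_rescale hh (fun t => K t * sphericalSmooth F κ v (u - h * t)) u]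
  · refine integral_congr_ae (Eventually.of_forall fun r => ?_)
    simp only [smoothKernel, sphericalSmooth]
    rw [show u - h * ((u - r) / h) = r by field_simp; ring, ← integral_const_mul,
      ← integral_const_mul]
    refine integral_congr_ae (Eventually.of_forall fun w => ?_)
    ring
  · refine (integrable_smoothKernel_polar hK hh κ (u, v)).bdd_mul (c := C)
      hF.measurable_polar.aestronglyMeasurable (Eventually.of_forall fun q => ?_)
    rw [Real.norm_of_nonneg (hF.nonneg _ _)]
    exact hF.le _ _

/-- Up to `O(1/κ)`, the projection of the kernel is the radial smoothing of the limit. -/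
theorem exists_abs_kernelProj_sub_smooth_le (hF : RegularDensity F C) (hK : KernelAssumption K)
    (hp : 2 ≤ p) : ∃ A, 0 < A ∧ ∀ κ h : ℝ, 1 ≤ κ → 0 < h → ∀ u, ∀ v ∈ unitSphere p,
      |kernelProj (polarLaw F) (smoothKernel p K h κ) (u, v) -
        ∫ t, K t * limitFun F (u - h * t, v)| ≤ A / κ := by
  obtain ⟨A, hA, hsph⟩ := hF.exists_abs_spherical_smooth_sub_le hp
  refine ⟨A, hA, fun κ h hκ hh u v hv => ?_⟩
  have hd : ∀ r, |sphericalSmooth F κ v r - limitFun F (r, v)| ≤ A / κ := fun r => by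
    rw [hF.sphericalSmooth_sub_limitFun]
    exact hsph κ hκ r v hv
  have m1 : Measurable fun t => limitFun F (u - h * t, v) :=
    hF.measurable_limitFun.comp (by fun_prop)
  have m2 : Measurable fun t => sphericalSmooth F κ v (u - h * t) :=
    (hF.measurable_sphericalSmooth κ v).comp (by fun_prop)
  have i1 := hK.integrable_mul m1 fun t => hF.abs_limitFun_le (by omega) _
  have i2 := hK.integrable_mul m2 (B := A / κ + 2 * C) fun t => by
    have := abs_add_le (sphericalSmooth F κ v (u - h * t) - limitFun F (u - h * t, v))
      (limitFun F (u - h * t, v))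
    rw [sub_add_cancel] at this
    linarith [hd (u - h * t), hF.abs_limitFun_le (by omega) (u - h * t, v)]
  rw [hF.kernelProj_smoothKernel hK hh, ← integral_sub i2 i1]
  simp_rw [← mul_sub]
  exact hK.abs_integral_mul_le fun t _ => hd _

/-- The projection differs from its limit by `O(1/κ + h)`, except within `h` of the boundary
`u = 0`. -/
theorem exists_abs_kernelProj_sub_le (hF : RegularDensity F C) (hK : KernelAssumption K)
    (hp : 2 ≤ p) : ∃ A, 0 < A ∧ ∀ κ h : ℝ, 1 ≤ κ → 0 < h → ∀ u > 0, ∀ v ∈ unitSphere p,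
      |kernelProj (polarLaw F) (smoothKernel p K h κ) (u, v) - limitFun F (u, v)| ≤
        (A / κ + 2 * C * h) + (Iio h ×ˢ (univ : Set (E p))).indicator (fun _ => 4 * C) (u, v) := by
  obtain ⟨A, hA, hsmooth⟩ := hF.exists_abs_kernelProj_sub_smooth_le hK hp
  refine ⟨A, hA, fun κ h hκ hh u hu v hv => ?_⟩
  have hC := hF.nonneg_const
  have h1 := hsmooth κ h hκ hh u v hv
  have hm : Measurable fun r => limitFun F (r, v) := hF.measurable_limitFun.comp (by fun_prop)
  have hb : ∀ r, |limitFun F (r, v)| ≤ 2 * C := fun r => hF.abs_limitFun_le (by omega) _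
  have htri := abs_add_le (kernelProj (polarLaw F) (smoothKernel p K h κ) (u, v) -
        ∫ t, K t * limitFun F (u - h * t, v))
      ((∫ t, K t * limitFun F (u - h * t, v)) - limitFun F (u, v))
  rw [sub_add_sub_cancel] at htri
  by_cases huh : u < h
  · rw [indicator_of_mem (show (u, v) ∈ Iio h ×ˢ univ from ⟨huh, mem_univ _⟩)]
    have h2 := hK.abs_integral_mul_le (ψ := fun t => limitFun F (u - h * t, v)) (B := 2 * C)
      fun t _ => hb _
    have h3 := abs_sub (∫ t, K t * limitFun F (u - h * t, v)) (limitFun F (u, v))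
    have h4 := hb u
    have : 0 ≤ 2 * C * h := by positivity
    linarith
  · rw [indicator_of_notMem (fun h' => huh h'.1)]
    have h2 := hK.abs_smooth_sub_le hm hb (fun u hu u' hu' =>
      hF.lipschitz_limitFun (by omega) hv hu hu') hh (not_lt.1 huh)
    linarith

/-- If the density vanishes at radius zero, the bias is of second order in `h` away from the
boundary and of first order near it. -/
theorem exists_abs_kernelProj_sub_le_sq (hF : RegularDensity F C) (hK : KernelAssumption K)
    (hp : 2 ≤ p) (h0 : ∀ v ∈ unitSphere p, Tendsto (fun u => F u v) (𝓝[>] 0) (𝓝 0)) :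
    ∃ A, 0 < A ∧ ∀ κ h : ℝ, 1 ≤ κ → 0 < h → ∀ u > 0, ∀ v ∈ unitSphere p,
      |kernelProj (polarLaw F) (smoothKernel p K h κ) (u, v) - limitFun F (u, v)| ≤
        (A / κ + 2 * C * h ^ 2) +
          (Iio h ×ˢ (univ : Set (E p))).indicator (fun _ => 6 * C * h) (u, v) := by
  obtain ⟨A, hA, hsmooth⟩ := hF.exists_abs_kernelProj_sub_smooth_le hK hp
  refine ⟨A, hA, fun κ h hκ hh u hu v hv => ?_⟩
  have hC := hF.nonneg_const
  have hlin : ∀ u > 0, ∀ v ∈ unitSphere p, F u v ≤ C * u := fun u hu v hv => by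
    have hl : Tendsto (fun r => C * |u - r| + F r v) (𝓝[>] 0) (𝓝 (C * |u - 0| + 0)) := by
      refine Tendsto.add (Tendsto.mono_left ?_ nhdsWithin_le_nhds) (h0 v hv)
      exact Continuous.tendsto (by fun_prop) 0
    rw [sub_zero, abs_of_pos hu, add_zero] at hl
    refine ge_of_tendsto hl ?_
    filter_upwards [self_mem_nhdsWithin] with r hr
    have := (le_abs_self _).trans (hF.lipschitz v hv u hu r hr)
    linarith
  have hγ : ∀ r, |limitFun F (r, v)| ≤ 2 * C * |r| := fun r => by
    rcases le_or_gt r 0 with hr | hr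
    · rw [hF.limitFun_of_nonpos hr, abs_zero]; positivity
    · have h1 := abs_average_le (p := p) (by omega) (φ := fun w => F r w) (B := C * r) fun w => by
        rw [abs_of_nonneg (hF.nonneg _ _)]; exact hlin r hr w w.2
      have h2 : |F r v| ≤ C * r := by
        rw [abs_of_nonneg (hF.nonneg _ _)]; exact hlin r hr v hv
      rw [abs_of_pos hr]
      exact (abs_sub _ _).trans (by unfold radialDensity; linarith)
  have h1 := hsmooth κ h hκ hh u v hv
  have hm : Measurable fun r => limitFun F (r, v) := hF.measurable_limitFun.comp (by fun_prop)
  have hb : ∀ r, |limitFun F (r, v)| ≤ 2 * C := fun r => hF.abs_limitFun_le (by omega) _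
  have htri := abs_add_le (kernelProj (polarLaw F) (smoothKernel p K h κ) (u, v) -
        ∫ t, K t * limitFun F (u - h * t, v))
      ((∫ t, K t * limitFun F (u - h * t, v)) - limitFun F (u, v))
  rw [sub_add_sub_cancel] at htri
  by_cases huh : u < h
  · rw [indicator_of_mem (show (u, v) ∈ Iio h ×ˢ univ from ⟨huh, mem_univ _⟩)]
    have h2 := hK.abs_integral_mul_le (ψ := fun t => limitFun F (u - h * t, v))
      (B := 2 * C * (2 * h)) fun t ht => (hγ _).trans (by
        gcongr
        rw [abs_le]
        constructor <;> nlinarith [ht.1, ht.2])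
    have h3 := abs_sub (∫ t, K t * limitFun F (u - h * t, v)) (limitFun F (u, v))
    have h4 := hγ u
    rw [abs_of_pos hu] at h4
    have : 0 ≤ 2 * C * h ^ 2 := by positivity
    nlinarith
  · rw [indicator_of_notMem (fun h' => huh h'.1)]
    have h2 := hK.abs_smooth_sub_le_sq hm hb (fun u s hs =>
      hF.second_difference_limitFun (by omega) hv hs) hh (not_lt.1 huh)
    linarith

/-- The radius is less than `h` with probability `O(h)`. -/
theorem polarLaw_radius_lt_le (hF : RegularDensity F C) (hp : 1 ≤ p) {h : ℝ} (hh : 0 < h) :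
    (polarLaw F).real (Iio h ×ˢ univ) ≤ C * sphereArea p * h := by
  have hC := hF.nonneg_const
  have hω := sphereArea_pos hp
  refine ENNReal.toReal_le_of_le_ofReal (by positivity) ?_
  have hms : MeasurableSet (Iio h ×ˢ (univ : Set (E p))) := measurableSet_Iio.prod .univ
  have hms' : MeasurableSet (Ioo 0 h ×ˢ (univ : Set (unitSphere p))) := measurableSet_Ioo.prod .univ
  rw [polarLaw, Measure.map_apply measurable_coe_polar hms,
    withDensity_apply _ (measurable_coe_polar hms),
    ← lintegral_indicator (measurable_coe_polar hms)]
  calc _ ≤ ∫⁻ q, (Ioo 0 h ×ˢ (univ : Set (unitSphere p))).indicator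
          (fun _ => ENNReal.ofReal C) q ∂(polarMeasure p) := by
        refine lintegral_mono fun q => ?_
        by_cases hq : q ∈ Ioo 0 h ×ˢ (univ : Set (unitSphere p))
        · rw [indicator_of_mem hq]
          exact (indicator_le_self _ _ q).trans (ENNReal.ofReal_le_ofReal (hF.le _ _))
        · rw [indicator_of_notMem hq]
          refine le_of_eq ((indicator_apply_eq_zero).2 fun hq' => ?_)
          rw [hF.eq_zero _ (not_lt.1 fun h0 => hq ⟨⟨h0, hq'.1⟩, mem_univ _⟩), ENNReal.ofReal_zero]
    _ = ENNReal.ofReal (C * sphereArea p * h) := by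
        rw [lintegral_indicator_const hms', Measure.prod_prod, Real.volume_Ioo,
          sphereMeasure_univ hp, sub_zero, ← ENNReal.ofReal_mul hh.le, ← ENNReal.ofReal_mul hC]
        congr 1
        ring

end RegularDensity

/-! ### The limit and the bias of the kernels -/

theorem exists_fisherKernel_le_Icc (p : ℕ) (κ : ℝ) :
    ∃ M, ∀ t ∈ Icc (-1 : ℝ) 1, fisherKernel p κ t ≤ M :=
  (isCompact_Icc.bddAbove_image (continuous_fisherKernel p κ).continuousOn).imp
    fun _ hM _ ht => hM (mem_image_of_mem _ ht)

namespace RegularDensity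

theorem integrable_limitFun (hF : RegularDensity F C) [IsFiniteMeasure (polarLaw F)] (hp : 1 ≤ p) :
    Integrable (limitFun F) (polarLaw F) :=
  Integrable.of_bound hF.measurable_limitFun.aestronglyMeasurable (2 * C)
    (Eventually.of_forall fun x => hF.abs_limitFun_le hp x)

/-- The kernels satisfy the hypotheses of the central limit theorem for `U`-statistics with kernels
that depend on the sample size. -/
theorem kernelLimit (hF : RegularDensity F C) [IsProbabilityMeasure (polarLaw F)]
    (hK : KernelAssumption K) (hp : 2 ≤ p) {h κ : ℕ → ℝ} (hpos : ∀ n, 0 < h n)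
    (hh : Tendsto h atTop (𝓝 0)) (hκ : Tendsto κ atTop atTop)
    (hvar : Tendsto (fun n : ℕ => κ n ^ (((p : ℝ) - 1) / 2) / ((n : ℝ) * h n)) atTop (𝓝 0)) :
    KernelLimit (polarLaw F) (fun n => smoothKernel p K (h n) (κ n)) (limitFun F) where
  measurable n := measurable_smoothKernel hK _ _
  symm n := smoothKernel_symm hK _ _
  integrable n x := hF.integrable_smoothKernel hK (hpos n) _ x
  memLp n := by
    obtain ⟨M, hM⟩ := exists_fisherKernel_le_Icc p (κ n)
    exact (hF.memLp_smoothKernel hK hp (hpos n) hM).1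
  measurable_limit := hF.measurable_limitFun
  bounded := ⟨_, hF.abs_limitFun_le (by omega)⟩
  second_moment := by
    obtain ⟨D, hD, hM⟩ := exists_fisherKernel_le hp
    have hlim := hvar.const_mul (C * ((∫ t, K t ^ 2) * D))
    rw [mul_zero] at hlim
    refine squeeze_zero' (Eventually.of_forall fun n =>
      div_nonneg (integral_nonneg fun z => sq_nonneg _) n.cast_nonneg) ?_ hlim
    filter_upwards [hκ.eventually_ge_atTop 1] with n hn
    have h1 := (hF.memLp_smoothKernel hK hp (hpos n) fun t ht => hM (κ n) hn t ht.2).2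
    calc _ ≤ C * ((h n)⁻¹ * (∫ t, K t ^ 2) * (D * κ n ^ (((p : ℝ) - 1) / 2))) / n := by gcongr
      _ = _ := by field_simp
  proj := by
    obtain ⟨A, hA, hproj⟩ := hF.exists_abs_kernelProj_sub_le hK hp
    have hC := hF.nonneg_const
    have hε : Tendsto (fun n => A / κ n + 2 * C * h n) atTop (𝓝 0) := by
      simpa using (hκ.const_div_atTop A).add (hh.const_mul (2 * C))
    have hlim : Tendsto (fun n => 2 * (A / κ n + 2 * C * h n) ^ 2 +
        32 * C ^ 2 * (C * sphereArea p * h n)) atTop (𝓝 0) := by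
      simpa using ((hε.pow 2).const_mul 2).add ((hh.const_mul (C * sphereArea p)).const_mul
        (32 * C ^ 2))
    refine squeeze_zero'
      (Eventually.of_forall fun n => integral_nonneg fun z => sq_nonneg _) ?_ hlim
    filter_upwards [hκ.eventually_ge_atTop 1] with n hn
    have hms : MeasurableSet (Iio (h n) ×ˢ (univ : Set (E p))) := measurableSet_Iio.prod .univ
    have hi : Integrable ((Iio (h n) ×ˢ (univ : Set (E p))).indicator fun _ => 32 * C ^ 2)
        (polarLaw F) := (integrable_const _).indicator hms
    have hle : ∀ᵐ x ∂(polarLaw F), (kernelProj (polarLaw F) (smoothKernel p K (h n) (κ n)) x -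
        limitFun F x) ^ 2 ≤ 2 * (A / κ n + 2 * C * h n) ^ 2 +
          (Iio (h n) ×ˢ (univ : Set (E p))).indicator (fun _ => 32 * C ^ 2) x := by
      filter_upwards [hF.ae_polarLaw] with x hx
      have h1 := hproj (κ n) (h n) hn (hpos n) x.1 hx.1 x.2 hx.2
      have h2 := pow_le_pow_left₀ (abs_nonneg _) h1 2
      rw [sq_abs] at h2
      refine h2.trans ?_
      by_cases hxm : x ∈ Iio (h n) ×ˢ (univ : Set (E p))
      · rw [indicator_of_mem hxm, indicator_of_mem (show (x.1, x.2) ∈ _ from hxm)]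
        nlinarith [sq_nonneg (A / κ n + 2 * C * h n - 4 * C)]
      · rw [indicator_of_notMem hxm, indicator_of_notMem (show (x.1, x.2) ∉ _ from hxm)]
        nlinarith [sq_nonneg (A / κ n + 2 * C * h n)]
    have hi' : Integrable (fun x => 2 * (A / κ n + 2 * C * h n) ^ 2 +
        (Iio (h n) ×ˢ (univ : Set (E p))).indicator (fun _ => 32 * C ^ 2) x) (polarLaw F) :=
      (integrable_const _).add hi
    refine (integral_mono_of_nonneg (Eventually.of_forall fun x => sq_nonneg _) hi' hle).trans ?_
    rw [integral_add (integrable_const _) hi, integral_indicator_const _ hms, integral_const,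
      probReal_univ, one_smul, smul_eq_mul, mul_comm _ (32 * C ^ 2)]
    have := hF.polarLaw_radius_lt_le (by omega) (hpos n)
    gcongr

/-- The bias is negligible if the density vanishes at radius zero. -/
theorem tendsto_bias (hF : RegularDensity F C) [IsProbabilityMeasure (polarLaw F)]
    (hK : KernelAssumption K) (hp : 2 ≤ p) {h κ : ℕ → ℝ} (hpos : ∀ n, 0 < h n)
    (hκ : Tendsto κ atTop atTop)
    (h0 : ∀ v ∈ unitSphere p, Tendsto (fun u => F u v) (𝓝[>] 0) (𝓝 0))
    (hb : Tendsto (fun n : ℕ => √(n : ℝ) / κ n + √(n : ℝ) * h n ^ 2) atTop (𝓝 0))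
    (hint : ∀ n, Integrable (kernelProj (polarLaw F) (smoothKernel p K (h n) (κ n))) (polarLaw F)) :
    Tendsto (fun n : ℕ => √(n : ℝ) *
      ((∫ x, kernelProj (polarLaw F) (smoothKernel p K (h n) (κ n)) x ∂(polarLaw F)) -
        ∫ x, limitFun F x ∂(polarLaw F))) atTop (𝓝 0) := by
  obtain ⟨A, hA, hproj⟩ := hF.exists_abs_kernelProj_sub_le_sq hK hp h0
  have hC := hF.nonneg_const
  have hω := sphereArea_pos (show 1 ≤ p by omega)
  have hlim := hb.const_mul (A + (2 * C + 6 * C * (C * sphereArea p)))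
  rw [mul_zero] at hlim
  refine squeeze_zero_norm' ?_ hlim
  filter_upwards [hκ.eventually_ge_atTop 1] with n hn
  have hκ0 : 0 < κ n := by linarith
  have hms : MeasurableSet (Iio (h n) ×ˢ (univ : Set (E p))) := measurableSet_Iio.prod .univ
  have hi : Integrable ((Iio (h n) ×ˢ (univ : Set (E p))).indicator fun _ => 6 * C * h n)
      (polarLaw F) := (integrable_const _).indicator hms
  have h1 := norm_integral_le_of_norm_le (μ := polarLaw F)
    (f := fun x => kernelProj (polarLaw F) (smoothKernel p K (h n) (κ n)) x - limitFun F x)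
    (g := fun x => (A / κ n + 2 * C * h n ^ 2) +
      (Iio (h n) ×ˢ (univ : Set (E p))).indicator (fun _ => 6 * C * h n) x)
    ((integrable_const _).add hi) (by
      filter_upwards [hF.ae_polarLaw] with x hx
      exact hproj (κ n) (h n) hn (hpos n) x.1 hx.1 x.2 hx.2)
  rw [integral_sub (hint n) (hF.integrable_limitFun (by omega)),
    integral_add (integrable_const _) hi, integral_indicator_const _ hms, integral_const,
    probReal_univ, one_smul, smul_eq_mul] at h1
  rw [norm_mul, Real.norm_of_nonneg (Real.sqrt_nonneg _)]
  have h2 := hF.polarLaw_radius_lt_le (by omega) (hpos n)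
  have hhn := (hpos n).le
  calc _ ≤ √(n : ℝ) * (A / κ n + 2 * C * h n ^ 2 + C * sphereArea p * h n * (6 * C * h n)) := by
        refine mul_le_mul_of_nonneg_left (h1.trans ?_) (Real.sqrt_nonneg _)
        gcongr
    _ = A * (√(n : ℝ) / κ n) +
        (2 * C + 6 * C * (C * sphereArea p)) * (√(n : ℝ) * h n ^ 2) := by ring
    _ ≤ _ := by
        have a1 : 0 ≤ √(n : ℝ) / κ n := by positivity
        have a2 : 0 ≤ √(n : ℝ) * h n ^ 2 := by positivity
        have a3 : 0 ≤ 2 * C + 6 * C * (C * sphereArea p) := by positivity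
        nlinarith [mul_nonneg hA.le a2, mul_nonneg a3 a1]

end RegularDensity

/-! ### The deviation from spherical symmetry -/

/-- Pythagoras' theorem for the approximation of a function on the sphere by a constant. -/
theorem integral_sq_sub_const (hp : 1 ≤ p) {φ : unitSphere p → ℝ} (hφ : Measurable φ) {B : ℝ}
    (hB : ∀ w, |φ w| ≤ B) (c : ℝ) :
    ∫ w, (φ w - c) ^ 2 ∂(sphereMeasure p) =
      ∫ w, φ w * (φ w - (sphereArea p)⁻¹ * ∫ w, φ w ∂(sphereMeasure p)) ∂(sphereMeasure p) +
        ((∫ w, φ w ∂(sphereMeasure p)) - sphereArea p * c) ^ 2 * (sphereArea p)⁻¹ := by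
  have hω := sphereArea_pos hp
  set m := ∫ w, φ w ∂(sphereMeasure p) with hm
  have i1 : Integrable φ (sphereMeasure p) :=
    Integrable.of_bound hφ.aestronglyMeasurable B (Eventually.of_forall hB)
  have i2 : Integrable (fun w => φ w * φ w) (sphereMeasure p) :=
    i1.mul_bdd hφ.aestronglyMeasurable (Eventually.of_forall hB)
  have i3 : Integrable (fun w => φ w * φ w - 2 * c * φ w) (sphereMeasure p) :=
    i2.sub (i1.const_mul _)
  have e : ∀ w, (φ w - c) ^ 2 = φ w * φ w - 2 * c * φ w + c ^ 2 := fun w => by ring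
  simp_rw [e, mul_sub]
  rw [integral_add i3 (integrable_const _), integral_sub i2 (i1.const_mul _),
    integral_sub i2 (i1.mul_const _), integral_const_mul, integral_mul_const, integral_const,
    sphereMeasure_real_univ hp, ← hm, smul_eq_mul]
  field_simp
  ring

theorem lintegral_density_eq_one (F : ℝ → E p → ℝ) [IsProbabilityMeasure (polarLaw F)] :
    ∫⁻ q : ℝ × unitSphere p, ENNReal.ofReal (F q.1 q.2) ∂(polarMeasure p) = 1 := by
  have := measure_univ (μ := polarLaw F)
  rwa [polarLaw, Measure.map_apply measurable_coe_polar MeasurableSet.univ, preimage_univ,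
    withDensity_apply _ MeasurableSet.univ, setLIntegral_univ] at this

/-- The infimum in the deviation is attained at the radial density, and the deviation is the mean
of `f(U,V) - ω_{p-1}⁻¹ f_U(U)`. -/
theorem RegularDensity.deviation_eq (hF : RegularDensity (extDensity f) C)
    [IsProbabilityMeasure (polarLaw (extDensity f))] (hp : 1 ≤ p) :
    deviation f = ∫ x, limitFun (extDensity f) x ∂(polarLaw (extDensity f)) := by
  set F := extDensity f with hFdef
  have hω := sphereArea_pos hp
  have hB : ∀ u, ∀ w : unitSphere p, |F u w| ≤ C := fun u w => by
    rw [abs_of_nonneg (hF.nonneg _ _)]; exact hF.le _ _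
  set J : ℝ → ℝ := fun u => ∫ w : unitSphere p, F u w * limitFun F (u, w) ∂(sphereMeasure p)
    with hJ
  -- For each radius, the squared distance is the one for the radial density plus a square.
  have hinner : ∀ (g : ℝ → ℝ) (u : ℝ),
      ∫⁻ v : unitSphere p, ENNReal.ofReal ((F u v - g u * (sphereArea p)⁻¹) ^ 2)
        ∂(sphereMeasure p) =
      ENNReal.ofReal (J u + (radialDensity F u - g u) ^ 2 * (sphereArea p)⁻¹) := fun g u => by
    have hm : Measurable fun v : unitSphere p => (F u v - g u * (sphereArea p)⁻¹) ^ 2 :=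
      ((hF.measurable_sphere u).sub_const _).pow_const 2
    rw [← ofReal_integral_eq_lintegral_ofReal _ (Eventually.of_forall fun v => sq_nonneg _),
      integral_sq_sub_const hp (hF.measurable_sphere u) (hB u)]
    · rw [show sphereArea p * (g u * (sphereArea p)⁻¹) = g u by field_simp]
      rfl
    · refine Integrable.of_bound hm.aestronglyMeasurable ((C + |g u * (sphereArea p)⁻¹|) ^ 2)
        (Eventually.of_forall fun v => ?_)
      rw [Real.norm_of_nonneg (sq_nonneg _), ← sq_abs]
      have := (abs_sub (F u v) (g u * (sphereArea p)⁻¹)).trans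
        (add_le_add_left (hB u v) _)
      gcongr
  have hswap : ∀ g : ℝ → ℝ, Measurable g →
      ∫⁻ v : unitSphere p, ∫⁻ u in Ioi (0 : ℝ),
        ENNReal.ofReal ((f u (v : E p) - g u * (sphereArea p)⁻¹) ^ 2) ∂volume ∂(sphereMeasure p) =
      ∫⁻ u in Ioi (0 : ℝ),
        ENNReal.ofReal (J u + (radialDensity F u - g u) ^ 2 * (sphereArea p)⁻¹) := fun g hg => by
    have h1 : ∀ v : unitSphere p, ∫⁻ u in Ioi (0 : ℝ),
        ENNReal.ofReal ((f u (v : E p) - g u * (sphereArea p)⁻¹) ^ 2) =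
        ∫⁻ u in Ioi (0 : ℝ), ENNReal.ofReal ((F u v - g u * (sphereArea p)⁻¹) ^ 2) := fun v => by
      refine setLIntegral_congr_fun measurableSet_Ioi fun u hu => ?_
      simp only [hFdef, extDensity_eq hu v.2]
    simp_rw [h1]
    rw [lintegral_lintegral_swap]
    · simp_rw [hinner]
    · refine Measurable.aemeasurable ?_
      have := hF.measurable_polar.comp (measurable_swap (α := unitSphere p) (β := ℝ))
      exact (((this.sub ((hg.comp measurable_snd).mul_const _)).pow_const 2).ennreal_ofReal)
  have hJ0 : ∀ u, 0 ≤ J u := fun u => by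
    have := integral_sq_sub_const hp (hF.measurable_sphere u) (hB u)
      ((sphereArea p)⁻¹ * radialDensity F u)
    rw [show (∫ w : unitSphere p, F u w ∂(sphereMeasure p)) -
      sphereArea p * ((sphereArea p)⁻¹ * radialDensity F u) = 0 by
        unfold radialDensity; field_simp; ring] at this
    have h2 : ∫ w : unitSphere p, (F u w - (sphereArea p)⁻¹ * radialDensity F u) ^ 2
        ∂(sphereMeasure p) = J u := by rw [this]; simp [hJ, limitFun, radialDensity]
    rw [← h2]
    exact integral_nonneg fun w => sq_nonneg _
  have hmass := lintegral_density_eq_one F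
  have hFint : Integrable (fun q : ℝ × unitSphere p => F q.1 q.2) (polarMeasure p) := by
    refine ⟨hF.measurable_polar.aestronglyMeasurable, ?_⟩
    rw [hasFiniteIntegral_iff_ofReal (Eventually.of_forall fun q => hF.nonneg _ _), hmass]
    exact ENNReal.one_lt_top
  have hFg : Integrable (fun q : ℝ × unitSphere p => F q.1 q.2 * limitFun F (q.1, q.2))
      (polarMeasure p) :=
    hFint.mul_bdd (hF.measurable_limitFun.comp measurable_coe_polar).aestronglyMeasurable
      (Eventually.of_forall fun q => hF.abs_limitFun_le hp (q.1, q.2))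
  have hrad : IsRadialDensity (radialDensity F) := by
    refine ⟨hF.measurable_radialDensity, hF.radialDensity_nonneg, ?_⟩
    rw [← hmass, lintegral_prod _ hF.measurable_polar.ennreal_ofReal.aemeasurable,
      setLIntegral_eq_of_support_subset]
    · refine lintegral_congr fun u => ?_
      rw [radialDensity, ofReal_integral_eq_lintegral_ofReal (hF.integrable_sphere u)
        (Eventually.of_forall fun w => hF.nonneg _ _)]
    · intro u hu
      by_contra h
      simp [radialDensity, hF.eq_zero u (not_lt.1 h)] at hu
  have hval : ∫⁻ u in Ioi (0 : ℝ), ENNReal.ofReal (J u) =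
      ENNReal.ofReal (∫ x, limitFun F x ∂(polarLaw F)) := by
    rw [hF.integral_polarLaw hF.measurable_limitFun, integral_prod _ hFg,
      ofReal_integral_eq_lintegral_ofReal hFg.integral_prod_left (Eventually.of_forall hJ0)]
    refine setLIntegral_eq_of_support_subset fun u hu => ?_
    by_contra h
    simp [hJ, hF.eq_zero u (not_lt.1 h)] at hu
  have hENN : deviationENN f = ENNReal.ofReal (∫ x, limitFun F x ∂(polarLaw F)) := by
    refine le_antisymm ?_ ?_
    · refine (iInf₂_le (radialDensity F) hrad).trans ?_
      rw [hswap _ hF.measurable_radialDensity, ← hval]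
      simp
    · refine le_iInf₂ fun g hg => ?_
      rw [hswap g hg.1, ← hval]
      refine lintegral_mono fun u => ENNReal.ofReal_le_ofReal ?_
      have : 0 ≤ (radialDensity F u - g u) ^ 2 * (sphereArea p)⁻¹ := by positivity
      linarith
  rw [deviation, hENN, ENNReal.toReal_ofReal]
  rw [hF.integral_polarLaw hF.measurable_limitFun, integral_prod _ hFg]
  exact integral_nonneg hJ0

/-- The limit function has positive variance if its mean is positive: otherwise the density would
take only the value zero and values above a positive threshold, and by connectedness be
constantly zero or bounded from below on a set of infinite measure. -/
theorem RegularDensity.variance_pos (hF : RegularDensity F C) [IsProbabilityMeasure (polarLaw F)]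
    (hp : 2 ≤ p) (hm : 0 < ∫ x, limitFun F x ∂(polarLaw F)) :
    0 < Var[limitFun F; polarLaw F] := by
  set m := ∫ x, limitFun F x ∂(polarLaw F) with hmdef
  have hω := sphereArea_pos (show 1 ≤ p by omega)
  by_contra hle
  have h0 : Var[limitFun F; polarLaw F] = 0 := le_antisymm (not_lt.1 hle) (variance_nonneg _ _)
  have hae : ∀ᵐ x ∂(polarLaw F), limitFun F x = m := by
    refine (evariance_eq_zero_iff hF.measurable_limitFun.aemeasurable).1 ?_
    rw [← MemLp.ofReal_variance_eq, h0, ENNReal.ofReal_zero]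
    exact MemLp.of_bound hF.measurable_limitFun.aestronglyMeasurable (2 * C)
      (Eventually.of_forall fun x => hF.abs_limitFun_le (by omega) x)
  -- Where `F` does not vanish, it equals `m` plus the nonnegative spherical average.
  have hae' : ∀ᵐ q ∂(polarMeasure p), F q.1 q.2 ≠ 0 → m ≤ F q.1 q.2 := by
    have hms : MeasurableSet {x | limitFun F x = m} :=
      hF.measurable_limitFun (measurableSet_singleton m)
    rw [polarLaw, ae_map_iff measurable_coe_polar.aemeasurable hms,
      ae_withDensity_iff hF.measurable_polar.ennreal_ofReal] at hae
    filter_upwards [hae] with q hq hne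
    have hpos := (hF.nonneg q.1 q.2).lt_of_ne' hne
    have h1 := hq (by simpa using hpos)
    have h2 : 0 ≤ (sphereArea p)⁻¹ * radialDensity F q.1 :=
      mul_nonneg (inv_pos.2 hω).le (hF.radialDensity_nonneg _)
    simp only [limitFun] at h1
    linarith
  set S : Set (ℝ × unitSphere p) := Ioi 0 ×ˢ univ with hS
  have hSo : IsOpen S := isOpen_Ioi.prod isOpen_univ
  have hcont : ContinuousOn (fun q : ℝ × unitSphere p => F q.1 q.2) S :=
    hF.continuousOn.comp (f := fun q : ℝ × unitSphere p => (q.1, (q.2 : E p)))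
      (Continuous.continuousOn (by fun_prop)) fun q hq => ⟨hq.1, q.2.2⟩
  have hconn : IsPreconnected S := by
    have : PreconnectedSpace (unitSphere p) := by
      refine isPreconnected_iff_preconnectedSpace.1 (isPreconnected_sphere ?_ 0 1)
      rw [← Module.finrank_eq_rank, finrank_euclideanSpace_fin]
      exact_mod_cast hp
    exact isPreconnected_Ioi.prod isPreconnected_univ
  -- The set where `0 < F < m` is open and null, hence empty.
  have hgap : ∀ q ∈ S, F q.1 q.2 ∉ Ioo 0 m := by
    have hO : IsOpen (S ∩ (fun q : ℝ × unitSphere p => F q.1 q.2) ⁻¹' Ioo 0 m) :=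
      hcont.isOpen_inter_preimage hSo isOpen_Ioo
    have hnull : polarMeasure p (S ∩ (fun q : ℝ × unitSphere p => F q.1 q.2) ⁻¹' Ioo 0 m) = 0 :=
      measure_mono_null (fun q hq => fun hq' : _ → _ =>
        absurd (hq' hq.2.1.ne') (not_le.2 hq.2.2)) (ae_iff.1 hae')
    have hempty := hO.measure_eq_zero_iff _ |>.1 hnull
    intro q hq hq'
    exact (hempty ▸ (⟨hq, hq'⟩ : q ∈ S ∩ _) : q ∈ (∅ : Set _))
  have hmass := lintegral_density_eq_one F
  by_cases hz : ∀ q ∈ S, F q.1 q.2 = 0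
  · have : ∀ q : ℝ × unitSphere p, ENNReal.ofReal (F q.1 q.2) = 0 := fun q => by
      rcases le_or_gt q.1 0 with h | h
      · simp [hF.eq_zero _ h]
      · simp [hz q ⟨h, mem_univ _⟩]
    simp [this] at hmass
  · push Not at hz
    obtain ⟨q₀, hq₀, hne⟩ := hz
    have hge : ∀ q ∈ S, m ≤ F q.1 q.2 := by
      intro q hq
      by_contra hlt
      have hq0 : F q.1 q.2 = 0 := by
        by_contra hq0
        exact hgap q hq ⟨(hF.nonneg _ _).lt_of_ne' hq0, not_le.1 hlt⟩
      have hq₀' : m ≤ F q₀.1 q₀.2 := by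
        by_contra h
        exact hgap q₀ hq₀ ⟨(hF.nonneg _ _).lt_of_ne' hne, not_le.1 h⟩
      obtain ⟨r, hr, hr'⟩ := hconn.intermediate_value hq hq₀ hcont
        (show m / 2 ∈ Icc (F q.1 q.2) (F q₀.1 q₀.2) from ⟨by linarith, by linarith⟩)
      exact hgap r hr ⟨by linarith, by linarith⟩
    -- A density on a set of infinite measure is not bounded from below by a positive constant.
    have hinf : (∫⁻ q : ℝ × unitSphere p, S.indicator (fun _ => ENNReal.ofReal m) q
        ∂(polarMeasure p)) ≤ 1 := by
      rw [← hmass]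
      refine lintegral_mono fun q => ?_
      refine indicator_le' (fun q hq => ENNReal.ofReal_le_ofReal (hge q hq))
        (fun _ _ => bot_le) q
    rw [lintegral_indicator_const hSo.measurableSet, hS, Measure.prod_prod, Real.volume_Ioi,
      sphereMeasure_univ (by omega), ENNReal.top_mul (by simpa using hω),
      ENNReal.mul_top (by simpa using hm)] at hinf
    exact absurd hinf (by simp)

/-! ### Normal quantiles -/

theorem continuous_cdf {μ : Measure ℝ} [IsProbabilityMeasure μ] [NullSingletonClass μ] :
    Continuous (cdf μ) := by
  refine continuous_iff_continuousAt.2 fun x => ?_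
  rw [(monotone_cdf μ).continuousAt_iff_leftLim_eq_rightLim, (cdf μ).rightLim_eq]
  have h := (cdf μ).measure_singleton x
  rw [measure_cdf, measure_singleton] at h
  have h1 := ENNReal.ofReal_eq_zero.1 h.symm
  exact le_antisymm ((monotone_cdf μ).leftLim_le le_rfl) (by linarith)

theorem cdf_normalQuantile {q : ℝ} (h0 : 0 < q) (h1 : q < 1) :
    cdf (gaussianReal 0 1) (normalQuantile q) = q := by
  have := nullSingletonClass_gaussianReal (μ := 0) (v := 1) one_ne_zero
  have hc : Continuous (cdf (gaussianReal 0 1)) := continuous_cdf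
  set Φ := cdf (gaussianReal 0 1) with hΦ
  set S : Set ℝ := {x | q ≤ Φ x} with hS
  have hne : S.Nonempty :=
    ((tendsto_cdf_atTop (gaussianReal 0 1)).eventually_const_le h1).exists
  obtain ⟨b, hb⟩ := ((tendsto_cdf_atBot (gaussianReal 0 1)).eventually_lt_const h0).exists
  have hbdd : BddBelow S := ⟨b, fun x hx => by
    by_contra hlt
    have := monotone_cdf (gaussianReal 0 1) (not_le.1 hlt).le
    exact absurd (hx.trans this) (not_le.2 hb)⟩
  have hmem : normalQuantile q ∈ S :=
    (isClosed_le continuous_const hc).csInf_mem hne hbdd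
  refine le_antisymm ?_ hmem
  have hl : Tendsto Φ (𝓝[<] normalQuantile q) (𝓝 (Φ (normalQuantile q))) :=
    (hc.tendsto _).mono_left nhdsWithin_le_nhds
  refine le_of_tendsto hl ?_
  filter_upwards [self_mem_nhdsWithin] with x hx
  exact (not_le.1 fun h => not_le.2 (show x < sInf S from hx) (csInf_le hbdd h)).le

/-! ### The statistics as functions of the polar coordinates -/

section Algebra

variable {𝒳 : Type*} {H : 𝒳 → 𝒳 → ℝ}

/-- The `U`-statistic of the observations with index in `s`. -/
noncomputable def uStatOn (H : 𝒳 → 𝒳 → ℝ) (s : Finset ℕ) (x : ℕ → 𝒳) : ℝ :=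
  ((s.card : ℝ) * ((s.card : ℝ) - 1))⁻¹ * ∑ i ∈ s, ∑ j ∈ s.erase i, H (x i) (x j)

theorem uStatOn_range (H : 𝒳 → 𝒳 → ℝ) (n : ℕ) (x : ℕ → 𝒳) :
    uStatOn H (Finset.range n) x = uStat H n x := by
  simp [uStatOn, uStat, rowSum]

/-- Deleting an observation removes its row and its column. -/
theorem sum_erase_erase (hH : ∀ x y, H x y = H y x) {n i : ℕ} (hi : i ∈ Finset.range n)
    (x : ℕ → 𝒳) :
    ∑ j ∈ (Finset.range n).erase i, ∑ k ∈ ((Finset.range n).erase i).erase j, H (x j) (x k) =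
      ∑ j ∈ Finset.range n, rowSum H n x j - 2 * rowSum H n x i := by
  have h1 : ∀ j ∈ (Finset.range n).erase i,
      ∑ k ∈ ((Finset.range n).erase i).erase j, H (x j) (x k) =
        rowSum H n x j - H (x i) (x j) := fun j hj => by
    have hij : i ∈ (Finset.range n).erase j :=
      Finset.mem_erase.2 ⟨(Finset.ne_of_mem_erase hj).symm, hi⟩
    rw [Finset.erase_right_comm, rowSum, ← Finset.add_sum_erase _ _ hij, hH (x i)]
    ring
  rw [Finset.sum_congr rfl h1, Finset.sum_sub_distrib, ← Finset.add_sum_erase _ _ hi]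
  simp only [rowSum]
  ring

/-- The jackknife variance is a multiple of the empirical variance of the row sums. Three
observations are needed for the statistic of the reduced sample not to divide by zero. -/
theorem jackknife_eq (hH : ∀ x y, H x y = H y x) {n : ℕ} (hn : 3 ≤ n) (x : ℕ → 𝒳) {ps : ℕ → ℝ}
    (hps : ∀ i ∈ Finset.range n, ps i =
      n * uStatOn H (Finset.range n) x - (n - 1) * uStatOn H ((Finset.range n).erase i) x) :
    1 / (4 * ((n : ℝ) - 1)) * ∑ i ∈ Finset.range n,
      (ps i - (n : ℝ)⁻¹ * ∑ j ∈ Finset.range n, ps j) ^ 2 =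
      (n : ℝ) * (n - 1) / (n - 2) ^ 2 * rowVar H n x := by
  have hn3 : (3 : ℝ) ≤ n := by exact_mod_cast hn
  have hn0 : (n : ℝ) ≠ 0 := by positivity
  have hn1 : (n : ℝ) - 1 ≠ 0 := by linarith
  have hn2 : (n : ℝ) - 2 ≠ 0 := by linarith
  set S := ∑ i ∈ Finset.range n, rowSum H n x i with hS
  have hps' : ∀ i ∈ Finset.range n, ps i =
      2 * rowSum H n x i / (n - 2) - S / ((n - 1) * (n - 2)) := fun i hi => by
    have hc : (((Finset.range n).erase i).card : ℝ) = n - 1 := by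
      rw [Finset.card_erase_of_mem hi, Finset.card_range, Nat.cast_sub (by omega), Nat.cast_one]
    rw [hps i hi, uStatOn_range, uStat, uStatOn, sum_erase_erase hH hi, hc, ← hS,
      show (n : ℝ) - 1 - 1 = n - 2 by ring]
    field_simp
    ring
  have hmean : (n : ℝ)⁻¹ * ∑ j ∈ Finset.range n, ps j =
      2 * S / (n * (n - 2)) - S / ((n - 1) * (n - 2)) := by
    rw [Finset.sum_congr rfl hps', Finset.sum_sub_distrib, ← Finset.sum_div, ← Finset.mul_sum, ← hS,
      Finset.sum_const, Finset.card_range, nsmul_eq_mul]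
    field_simp
  have hd : ∀ i ∈ Finset.range n, (ps i - (n : ℝ)⁻¹ * ∑ j ∈ Finset.range n, ps j) ^ 2 =
      4 * (n - 1) ^ 2 / (n - 2) ^ 2 *
        (((n : ℝ) - 1)⁻¹ * rowSum H n x i - uStat H n x) ^ 2 := fun i hi => by
    rw [hmean, hps' i hi, uStat, ← hS]
    field_simp
    ring
  rw [Finset.sum_congr rfl hd, ← Finset.mul_sum, rowVar]
  field_simp

end Algebra

/-- The polar coordinates of a point; the direction of the origin is the junk value `0`. -/
noncomputable def polar (y : E p) : ℝ × E p := (‖y‖, direction y)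

theorem measurable_polar : Measurable (polar : E p → ℝ × E p) :=
  measurable_norm.prodMk (measurable_norm.inv.smul measurable_id)

theorem Mhat_eq_uStatOn (hp : 2 ≤ p) {κ : ℝ} (hκ : 0 < κ) (h : ℝ) (s : Finset ℕ) (y : ℕ → E p) :
    Mhat K h κ s y = uStatOn (smoothKernel p K h κ) s fun i => polar (y i) := by
  simp only [Mhat, Mhat1, Mhat2, uStatOn, smoothKernel, polar, ← langevin_div_c1 hp hκ]
  simp only [Finset.mul_sum, ← Finset.sum_sub_distrib]
  refine Finset.sum_congr rfl fun i _ => Finset.sum_congr rfl fun j _ => ?_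
  simp only [mul_inv, div_eq_mul_inv]
  ring

/-- The jackknife scale `2 σ̂_n`, in terms of the row sums. -/
noncomputable def jackknifeScale {𝒳 : Type*} (H : 𝒳 → 𝒳 → ℝ) (n : ℕ) (x : ℕ → 𝒳) : ℝ :=
  2 * √((n : ℝ) * (n - 1) / (n - 2) ^ 2 * rowVar H n x)

theorem stdErr_eq (hp : 2 ≤ p) (hK : KernelAssumption K) {κ : ℝ} (hκ : 0 < κ) (h : ℝ) {n : ℕ}
    (hn : 3 ≤ n) (y : ℕ → E p) :
    stdErr K h κ n y =
      jackknifeScale (smoothKernel p K h κ) n (fun i => polar (y i)) / √(n : ℝ) := by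
  have := jackknife_eq (smoothKernel_symm (p := p) hK h κ) hn (fun i => polar (y i))
    (ps := pseudovalue K h κ n y) fun i _ => by
      rw [pseudovalue, Mhat_eq_uStatOn hp hκ, Mhat_eq_uStatOn hp hκ]
  rw [stdErr, sigmaHat, jackknifeScale, ← this]
  rfl

/-! ### The limit of the rejection probabilities -/

section Limits

variable {Ω : Type*} [MeasurableSpace Ω] {P : Measure Ω} [IsProbabilityMeasure P]
  {𝒳 : Type*} [MeasurableSpace 𝒳] {lam : Measure 𝒳} [IsProbabilityMeasure lam]
  {H : ℕ → 𝒳 → 𝒳 → ℝ} {g : 𝒳 → ℝ} {X : ℕ → Ω → 𝒳}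

namespace KernelLimit

theorem measurable_jackknifeScale (h : KernelLimit lam H g) (hX : ∀ i, Measurable (X i)) (n : ℕ) :
    Measurable fun ω => jackknifeScale (H n) n fun i => X i ω := by
  have hr : ∀ i, Measurable fun ω => rowSum (H n) n (fun i => X i ω) i := fun i =>
    Finset.measurable_sum _ fun j _ => (h.measurable n).comp ((hX i).prodMk (hX j))
  have hU := h.measurable_uStat hX n
  have hV : Measurable fun ω => rowVar (H n) n fun i => X i ω :=
    (Finset.measurable_sum _ fun i _ => (((hr i).const_mul _).sub hU).pow_const 2).const_mul _
  exact ((hV.const_mul _).sqrt).const_mul _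

theorem tendstoInMeasure_jackknifeScale (h : KernelLimit lam H g) (hX : ∀ i, Measurable (X i))
    (hind : iIndepFun X P) (hlaw : ∀ i, P.map (X i) = lam) :
    TendstoInMeasure P (fun n ω => jackknifeScale (H n) n fun i => X i ω) atTop
      fun _ => 2 * √Var[g; lam] := by
  have hc : Tendsto (fun n : ℕ => (n : ℝ) * (n - 1) / (n - 2) ^ 2) atTop (𝓝 1) := by
    have h1 : Tendsto (fun n : ℕ => ((n : ℝ))⁻¹) atTop (𝓝 0) := tendsto_inv_atTop_nhds_zero_nat
    have h2 : Tendsto (fun n : ℕ => (1 - ((n : ℝ))⁻¹) / (1 - 2 * ((n : ℝ))⁻¹) ^ 2) atTop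
        (𝓝 ((1 - 0) / (1 - 2 * 0) ^ 2)) :=
      (h1.const_sub 1).div (((h1.const_mul 2).const_sub 1).pow 2) (by norm_num)
    rw [show ((1 : ℝ) - 0) / (1 - 2 * 0) ^ 2 = 1 by norm_num] at h2
    refine h2.congr' ?_
    filter_upwards [eventually_ge_atTop 3] with n hn
    have hn3 : (3 : ℝ) ≤ n := by exact_mod_cast hn
    have : (n : ℝ) - 2 ≠ 0 := by linarith
    have hn0 : (n : ℝ) ≠ 0 := by positivity
    field_simp
  have := tendstoInMeasure_comp₂ (tendstoInMeasure_const_seq hc)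
    (h.tendstoInMeasure_rowVar hX hind hlaw) (ψ := fun q => 2 * √(q.1 * q.2)) (by fun_prop)
  simpa [jackknifeScale] using this

/-- The expectation of the `U`-statistic. -/
theorem integral_uStat (h : KernelLimit lam H g) (hX : ∀ i, Measurable (X i))
    (hind : iIndepFun X P) (hlaw : ∀ i, P.map (X i) = lam) {n : ℕ} (hn : 2 ≤ n) :
    ∫ ω, uStat (H n) n (fun i => X i ω) ∂P = ∫ x, kernelProj lam (H n) x ∂lam := by
  have hn2 : (2 : ℝ) ≤ n := by exact_mod_cast hn
  have hint : ∀ i, ∀ j ∈ (Finset.range n).erase i, Integrable (fun ω => H n (X i ω) (X j ω)) P :=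
    fun i j hj => (memLp_pair hX hind hlaw (Finset.ne_of_mem_erase hj).symm
      (h.memLp n)).integrable (by norm_num)
  have hrow : ∀ i ∈ Finset.range n, ∫ ω, rowSum (H n) n (fun i => X i ω) i ∂P =
      ((n : ℝ) - 1) * ∫ x, kernelProj lam (H n) x ∂lam := fun i hi => by
    simp only [rowSum]
    rw [integral_finsetSum _ (hint i), Finset.sum_congr rfl fun j hj => integral_pair hX hind hlaw
      (Finset.ne_of_mem_erase hj).symm (h.measurable n), ← integral_kernelProj (h.memLp n),
      Finset.sum_const, Finset.card_erase_of_mem hi, Finset.card_range, nsmul_eq_mul,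
      Nat.cast_sub (by omega), Nat.cast_one]
  simp only [uStat]
  rw [integral_const_mul, integral_finsetSum _ fun i _ => by
      simp only [rowSum]; exact integrable_finsetSum _ (hint i),
    Finset.sum_congr rfl hrow, Finset.sum_const, Finset.card_range, nsmul_eq_mul]
  have h1 : (n : ℝ) - 1 ≠ 0 := by linarith
  have h0 : (n : ℝ) ≠ 0 := by linarith
  field_simp

/-- The limiting distribution function of the studentized `U`-statistic, on and off the
boundary. -/
theorem tendsto_measureReal_studentized (h : KernelLimit lam H g) (hX : ∀ i, Measurable (X i))
    (hind : iIndepFun X P) (hlaw : ∀ i, P.map (X i) = lam) {Δ : ℝ}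
    (hbd : ∫ x, g x ∂lam = Δ → 0 < Var[g; lam] ∧ Tendsto (fun n : ℕ =>
      √(n : ℝ) * (∫ x, kernelProj lam (H n) x ∂lam - Δ)) atTop (𝓝 0)) (c : ℝ) :
    Tendsto (fun n : ℕ => P.real {ω | uStat (H n) n (fun i => X i ω) ≤
        Δ + c * (jackknifeScale (H n) n (fun i => X i ω) / √(n : ℝ))}) atTop
      (𝓝 (if ∫ x, g x ∂lam < Δ then 1 else if ∫ x, g x ∂lam = Δ then
        cdf (gaussianReal 0 1) c else 0)) := by
  have hs := h.tendstoInMeasure_jackknifeScale hX hind hlaw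
  have hsm := h.measurable_jackknifeScale hX
  rcases eq_or_ne (∫ x, g x ∂lam) Δ with heq | hne
  · rw [if_neg heq.not_lt, if_pos heq]
    exact h.tendsto_measureReal_le hX hind hlaw (hbd heq).1 hs hsm (hbd heq).2 c
  set T : ℕ → Ω → ℝ := fun n ω => uStat (H n) n (fun i => X i ω) -
    c * (jackknifeScale (H n) n (fun i => X i ω) / √(n : ℝ)) with hTdef
  have hT : TendstoInMeasure P T atTop fun _ => ∫ x, g x ∂lam := by
    have hsq : Tendsto (fun n : ℕ => (√(n : ℝ))⁻¹) atTop (𝓝 0) :=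
      (Real.tendsto_sqrt_atTop.comp tendsto_natCast_atTop_atTop).inv_tendsto_atTop
    have h1 := tendstoInMeasure_comp₂ hs (tendstoInMeasure_const_seq (P := P) hsq)
      (ψ := fun q => q.1 * q.2) (by fun_prop)
    have h2 := tendstoInMeasure_comp₂ (h.tendstoInMeasure_uStat hX hind hlaw) h1
      (ψ := fun q => q.1 - c * q.2) (by fun_prop)
    simpa [hTdef, div_eq_mul_inv] using h2
  have hTm : ∀ n, Measurable (T n) := fun n =>
    (h.measurable_uStat hX n).sub (((hsm n).div_const _).const_mul _)
  have hset : ∀ n, {ω | uStat (H n) n (fun i => X i ω) ≤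
      Δ + c * (jackknifeScale (H n) n (fun i => X i ω) / √(n : ℝ))} = {ω | T n ω ≤ Δ} := fun n => by
    ext ω
    simp only [hTdef, mem_ofPred_eq, sub_le_iff_le_add]
  simp_rw [hset]
  rcases lt_or_gt_of_ne hne with hlt | hgt
  · rw [if_pos hlt]
    have h1 := (tendsto_measureReal_gt_of_lt hT hlt).const_sub 1
    rw [sub_zero] at h1
    refine h1.congr fun n => ?_
    rw [← probReal_compl_eq_one_sub (measurableSet_lt measurable_const (hTm n))]
    congr 1
    ext ω
    simp
  · rw [if_neg (not_lt.2 hgt.le), if_neg hne]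
    exact tendsto_measureReal_le_of_lt hT hgt

end KernelLimit
end Limits
end SphDev

theorem mainTheorem7 {p : ℕ} (hp : 2 ≤ p)
    {Ω : Type*} [MeasurableSpace Ω] (P : Measure Ω) [IsProbabilityMeasure P]
    -- independent observations, whose polar coordinates have the density `f`
    (Y : ℕ → Ω → SphDev.E p) (hYm : ∀ i, Measurable (Y i)) (hYi : iIndepFun Y P)
    (f : ℝ → SphDev.E p → ℝ) (hYf : ∀ i, SphDev.HasPolarDensity (P.map (Y i)) f)
    (hf : SphDev.DensityAssumption f)
    (K : ℝ → ℝ) (hK : SphDev.KernelAssumption K)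
    -- bandwidths
    (h κ : ℕ → ℝ) (hpos : ∀ n, 0 < h n) (hh : Tendsto h atTop (𝓝 0))
    (hκ : Tendsto κ atTop atTop)
    (hvar : Tendsto (fun n : ℕ => κ n ^ (((p : ℝ) - 1) / 2) / ((n : ℝ) * h n)) atTop (𝓝 0))
    -- threshold and level
    (Δ α : ℝ) (hΔ : 0 < Δ) (hα0 : 0 < α) (hα1 : α < 1)
    -- at the boundary of the hypotheses only, the bias is negligible: either by the
    -- bandwidth condition, or because it is of order `o(n^{-1/2})`
    (hbias : SphDev.deviation f = Δ →
      ((Tendsto (fun n : ℕ => √(n : ℝ) / κ n + √(n : ℝ) * h n ^ 2) atTop (𝓝 0) ∧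
          ∀ v ∈ SphDev.unitSphere p, Tendsto (fun u => f u v) (𝓝[>] 0) (𝓝 0)) ∨
        Tendsto (fun n : ℕ => √(n : ℝ) *
          ((∫ ω, SphDev.Mhat K (h n) (κ n) (Finset.range n) (fun i => Y i ω) ∂P)
            - SphDev.deviation f)) atTop (𝓝 0))) :
    Tendsto (fun n : ℕ => P.real {ω |
        SphDev.Mhat K (h n) (κ n) (Finset.range n) (fun i => Y i ω) >
          Δ + SphDev.normalQuantile (1 - α) *
            SphDev.stdErr K (h n) (κ n) n (fun i => Y i ω)}) atTop
      (𝓝 (if SphDev.deviation f > Δ then 1 else if SphDev.deviation f = Δ then α else 0)) ∧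
    Tendsto (fun n : ℕ => P.real {ω |
        SphDev.Mhat K (h n) (κ n) (Finset.range n) (fun i => Y i ω) ≤
          Δ + SphDev.normalQuantile α *
            SphDev.stdErr K (h n) (κ n) n (fun i => Y i ω)}) atTop
      (𝓝 (if SphDev.deviation f < Δ then 1 else if SphDev.deviation f = Δ then α else 0)) := by
  obtain ⟨C, -, hF⟩ := hf.regularDensity (hYf 0).1
  set F := SphDev.extDensity f with hFdef
  set X : ℕ → Ω → ℝ × SphDev.E p := fun i ω => SphDev.polar (Y i ω) with hXdef
  have hX : ∀ i, Measurable (X i) := fun i => SphDev.measurable_polar.comp (hYm i)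
  have hind : iIndepFun X P :=
    hYi.comp (fun _ => SphDev.polar) fun _ => SphDev.measurable_polar
  have hlaw : ∀ i, P.map (X i) = SphDev.polarLaw F := fun i => by
    rw [← (hYf i).map_eq_polarLaw]
    exact (Measure.map_map SphDev.measurable_polar (hYm i)).symm
  have : IsProbabilityMeasure (SphDev.polarLaw F) := by
    rw [← hlaw 0]
    exact Measure.isProbabilityMeasure_map (hX 0).aemeasurable
  have hlim := hF.kernelLimit hK hp hpos hh hκ hvar
  have hdev := hF.deviation_eq (by omega)
  have hint : ∀ n, Integrable (SphDev.kernelProj (SphDev.polarLaw F)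
      (SphDev.smoothKernel p K (h n) (κ n))) (SphDev.polarLaw F) := fun n =>
    (SphDev.memLp_kernelProj (hlim.measurable n) (hlim.memLp n)).integrable (by norm_num)
  -- The kernel is normalized as in the statistic once `κ n > 0`; the jackknife needs `n ≥ 3`.
  have hstat : ∀ᶠ n in atTop, ∀ ω,
      SphDev.Mhat K (h n) (κ n) (Finset.range n) (fun i => Y i ω) =
        SphDev.uStat (SphDev.smoothKernel p K (h n) (κ n)) n (fun i => X i ω) ∧
      SphDev.stdErr K (h n) (κ n) n (fun i => Y i ω) =
        SphDev.jackknifeScale (SphDev.smoothKernel p K (h n) (κ n)) n (fun i => X i ω) /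
          √(n : ℝ) := by
    filter_upwards [hκ.eventually_gt_atTop 0, eventually_ge_atTop 3] with n hn hn3 ω
    exact ⟨by rw [SphDev.Mhat_eq_uStatOn hp hn, SphDev.uStatOn_range],
      SphDev.stdErr_eq hp hK hn _ hn3 _⟩
  have hbd : ∫ x, SphDev.limitFun F x ∂(SphDev.polarLaw F) = Δ →
      0 < Var[SphDev.limitFun F; SphDev.polarLaw F] ∧ Tendsto (fun n : ℕ => √(n : ℝ) *
        (∫ x, SphDev.kernelProj (SphDev.polarLaw F) (SphDev.smoothKernel p K (h n) (κ n)) x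
          ∂(SphDev.polarLaw F) - Δ)) atTop (𝓝 0) := by
    intro heq
    refine ⟨hF.variance_pos hp (by rwa [heq]), ?_⟩
    rcases hbias (hdev.trans heq) with ⟨hb, h0⟩ | hb
    · rw [← heq]
      refine hF.tendsto_bias hK hp hpos hκ (fun v hv => (h0 v hv).congr' ?_) hb hint
      filter_upwards [self_mem_nhdsWithin] with u hu
      exact (SphDev.extDensity_eq hu hv).symm
    · refine hb.congr' ?_
      filter_upwards [hstat, eventually_ge_atTop 2] with n hn hn2
      rw [integral_congr_ae (Eventually.of_forall fun ω => (hn ω).1),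
        hlim.integral_uStat hX hind hlaw hn2, hdev, heq]
  have key := hlim.tendsto_measureReal_studentized hX hind hlaw hbd
  rw [← hdev] at key
  constructor
  · have h1 := (key (SphDev.normalQuantile (1 - α))).const_sub 1
    rw [SphDev.cdf_normalQuantile (by linarith) (by linarith)] at h1
    convert h1.congr' ?_ using 2
    · rcases lt_trichotomy (SphDev.deviation f) Δ with hlt | heq | hgt
      · simp [hlt, hlt.ne, not_lt.2 hlt.le]
      · simp [heq]
      · simp [hgt, hgt.ne', not_lt.2 hgt.le]
    · filter_upwards [hstat] with n hn
      rw [← probReal_compl_eq_one_sub (measurableSet_le (hlim.measurable_uStat hX n)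
        (((hlim.measurable_jackknifeScale hX n).div_const _).const_mul _ |>.const_add _))]
      congr 1
      ext ω
      simp [(hn ω).1, (hn ω).2]
  · have h1 := key (SphDev.normalQuantile α)
    rw [SphDev.cdf_normalQuantile hα0 hα1] at h1
    refine h1.congr' ?_
    filter_upwards [hstat] with n hn
    congr 1
    ext ω
    simp [(hn ω).1, (hn ω).2]
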